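/- **Conventions.** For a set $I$ of positive integers, $\pm I=I\cup(-I)$, and $[n]=\{1,\dots,n\}$. $S(J)$ is the group of permutations of a finite set $J$ of integers, whose elements act trivially on every integer outside $J$; $\#(\pi)$ is the number of cycles of $\pi$ on its domain; $\delta(k)=-k$. Products of permutations act from right to left. A permutation connects two sets if one of its cycles meets both. $\pi|_{J'}$ is the permutation induced on $J'$ (delete from the cycles of $\pi$ all elements not in $J'$). A *premap* on $\pm I$ is $\pi\in S(\pm I)$ with $\pi(k)=-\pi^{-1}(-k)$ for all $k$ and no cycle of which contains both $k$ and $-k$ for any $k$. If $\gamma\in S(J)$ and $J$ never contains both $k$ and $-k$, then $\gamma_+$ is $\gamma$ as a permutation of $\pm J$ and $\gamma_-=\delta\gamma_+\delta$. For $\varepsilon:I\to\{1,-1\}$, extended by $\varepsilon(-k)=\varepsilon(k)$, put $\delta_\varepsilon(k)=\varepsilon(k)k$. For $\gamma\in S(I)$ and a premap $\pi$ on $\pm I$, put $$\chi(\gamma,\pi)=\tfrac12\#(\gamma_+\gamma_-^{-1})+\tfrac12\#(\pi)+\tfrac12\#(\gamma_+^{-1}\pi^{-1}\gamma_-)-|I|,$$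 all three permutations being taken on $\pm I$. For a premap $\pi$, $\pi/2$ is the restriction of $\pi$ to the union of those cycles whose element of smallest absolute value is positive. For matrices, $A^{(1)}=A$, $A^{(-1)}=A^T$, and $Y^{(k)}=Y_k$, $Y^{(-k)}=Y_k^T$ for $k>0$; $\mathrm{Tr}$ is the trace, $\mathrm{tr}=\frac1N\mathrm{Tr}$, and $\mathrm{tr}_\pi(Y)$ is the product over the cycles $(c_1,\dots,c_r)$ of $\pi$ of $\mathrm{tr}(Y^{(c_1)}\cdots Y^{(c_r)})$. Finally $k_2(A,B)=\mathbb E(AB)-\mathbb E(A)\mathbb E(B)$. **The ensemble.** For every $N\ge1$ let $\{X_\lambda\}_{\lambda\in\Lambda}$ be random $N\times N$ matrices (real or complex) on a probability space. Suppose that for every finite set $I$ of positive integers there are a set $PM_c(\pm I)$ of premaps on $\pm I$, not depending on $N$, and complex weights $f_c(\pi)$, $\pi\in PM_c(\pm I)$ (which may depend on $I$, on $N$ and on the labels $\lambda_k$), such that: 1. for every $\gamma\in S(I)$, every $\varepsilon:I\to\{1,-1\}$, all labels $\lambda_k\in\Lambda$ $(k\in I)$ and all random $N\times N$ matrices $Y_k$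 $(k\in I)$ whose entries have finite moments of all orders and which are independent from the $X_\lambda$, the expectation on the left below exists and $$\mathbb E\Big(\mathrm{tr}_\gamma\big((X_{\lambda_k}^{(\varepsilon(k))}Y_k)_{k\in I}\big)\Big)=\sum_{\pi\in PM_c(\pm I)}N^{\chi(\gamma,\delta_\varepsilon\pi\delta_\varepsilon)-2\#(\gamma)}f_c(\pi)\,\mathbb E\Big(\mathrm{tr}_{\gamma_-^{-1}\delta_\varepsilon\pi\delta_\varepsilon\gamma_+/2}\big((Y_k)_{k\in I}\big)\Big);$$ 2. for every $J\subseteq I$, the $\pi\in PM_c(\pm I)$ that do not connect $\pm J$ and $\pm(I\setminus J)$ are exactly the products $\pi_1\pi_2$ with $\pi_1\in PM_c(\pm J)$ and $\pi_2\in PM_c(\pm(I\setminus J))$, and for these $f_c(\pi)=f_c(\pi|_{\pm J})\,f_c(\pi|_{\pm(I\setminus J)})$; 3. $\lim_{N\to\infty}f_c(\pi)$ exists for every $\pi\in PM_c(\pm I)$. **Annular noncrossing permutations.** Let $\gamma\in S(J)$ have exactly two cycles. For $x,y\in J$ in different cycles, $\lambda_{x,y}$ is the permutation of $J\setminus\{x,y\}$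 with $\gamma^{-1}(x)\mapsto\gamma(y)$, $\gamma^{-1}(y)\mapsto\gamma(x)$ and $a\mapsto\gamma(a)$ otherwise (if $\{x\}$ is a cycle of $\gamma$, then instead $\gamma^{-1}(y)\mapsto\gamma(y)$, and symmetrically). $S_{\mathrm{ann\text{-}nc}}(\gamma)$ is the set of $\pi\in S(J)$ such that $\langle\gamma,\pi\rangle$ is transitive on $J$ and such that there are no distinct elements of $J$ with one of the following properties, where in the last two $x$ and $y$ lie in different cycles of $\gamma$: * $\gamma|_{\{a,b,c\}}=(a,b,c)=\pi|_{\{a,b,c\}}$; * $\gamma|_{\{a,b,c,d\}}=(a,b)(c,d)$ and $\pi|_{\{a,b,c,d\}}=(a,c,b,d)$; * $\gamma|_{\{a,b,c,d\}}=(a,b,c,d)$ and $\pi|_{\{a,b,c,d\}}=(a,c)(b,d)$; * $\lambda_{x,y}|_{\{a,b,c\}}=(a,b,c)$ and $\pi|_{\{a,b,c,x,y\}}=(a,b,c)(x,y)$; * $\lambda_{x,y}|_{\{a,b,c,d\}}=(a,b,c,d)$ and $\pi|_{\{a,b,c,d,x,y\}}=(a,c)(b,d)(x,y)$. **Lemma.**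 Let $m,n\ge1$, $\varepsilon:[m+n]\to\{1,-1\}$ and $\lambda_1,\dots,\lambda_{m+n}\in\Lambda$, and put $$\gamma=(1,\dots,m)(m+1,\dots,m+n),\qquad \gamma_{\mathrm{op}}=(1,\dots,m)(-m-n,\dots,-m-1).$$ Then the following limit exists and $$\lim_{N\to\infty}k_2\Big(\mathrm{Tr}\big(X_{\lambda_1}^{(\varepsilon(1))}\cdots X_{\lambda_m}^{(\varepsilon(m))}\big),\mathrm{Tr}\big(X_{\lambda_{m+1}}^{(\varepsilon(m+1))}\cdots X_{\lambda_{m+n}}^{(\varepsilon(m+n))}\big)\Big)$$ $$=\sum_{\substack{\pi\in S_{\mathrm{ann\text{-}nc}}(\gamma)\\ \delta_\varepsilon\pi_+\pi_-^{-1}\delta_\varepsilon\in PM_c(\pm[m+n])}}\lim_{N\to\infty}f_c(\delta_\varepsilon\pi_+\pi_-^{-1}\delta_\varepsilon)+\sum_{\substack{\pi\in S_{\mathrm{ann\text{-}nc}}(\gamma_{\mathrm{op}})\\ \delta_\varepsilon\pi_+\pi_-^{-1}\delta_\varepsilon\in PM_c(\pm[m+n])}}\lim_{N\to\infty}f_c(\delta_\varepsilon\pi_+\pi_-^{-1}\delta_\varepsilon).$$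 -/

import Mathlib

open MeasureTheory ProbabilityTheory Filter Topology

namespace RealFluct

/-! ### Permutations of sets of integers

A permutation of a finite set `S` of integers is a permutation of `ℤ` acting trivially outside `S`.
The set it is considered on (needed to count its cycles) is always given explicitly. -/

/-- The copy of `I` inside the integers. -/
def pos (I : Finset ℕ) : Finset ℤ := I.image (fun k : ℕ => (k : ℤ))

/-- `-I`. -/
def neg (I : Finset ℕ) : Finset ℤ := I.image (fun k : ℕ => -(k : ℤ))

/-- `±I = I ∪ (-I)`. -/
def pm (I : Finset ℕ) : Finset ℤ := pos I ∪ neg I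

/-- `S(S)`: the permutations of the finite set `S`, as permutations of `ℤ` trivial outside `S`. -/
noncomputable def permsOn (S : Finset ℤ) : Finset (Equiv.Perm ℤ) :=
  (Finset.univ : Finset (Equiv.Perm {k : ℤ // k ∈ S})).map
    ⟨Equiv.Perm.ofSubtype, Equiv.Perm.ofSubtype_injective⟩

theorem mem_permsOn (S : Finset ℤ) (π : Equiv.Perm ℤ) :
    π ∈ permsOn S ↔ ∀ k, k ∉ S → π k = k := by
  constructor
  · intro h k hk
    simp only [permsOn, Finset.mem_map, Finset.mem_univ, true_and,
      Function.Embedding.coeFn_mk] at h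
    obtain ⟨σ, rfl⟩ := h
    exact Equiv.Perm.ofSubtype_apply_of_not_mem σ hk
  · intro h
    have h2 : ∀ k, π k ≠ k → k ∈ S := fun k hk => by
      by_contra hS
      exact hk (h k hS)
    have h1 : ∀ k, π k ∈ S ↔ k ∈ S := fun k => by
      by_cases hk : π k = k
      · rw [hk]
      · exact ⟨fun _ => h2 k hk, fun _ => h2 (π k) (fun e => hk (π.injective e))⟩
    simp only [permsOn, Finset.mem_map, Finset.mem_univ, true_and,
      Function.Embedding.coeFn_mk]
    exact ⟨π.subtypePerm h1, Equiv.Perm.ofSubtype_subtypePerm h1 h2⟩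

/-- The number `#(π)` of cycles of `π`, considered as a permutation of `S`. -/
noncomputable def numCycles (S : Finset ℤ) (π : Equiv.Perm ℤ) : ℕ :=
  Set.ncard {C : Set ℤ | ∃ k ∈ S, C = {j | π.SameCycle k j}}

/-- `π` connects `J` and `K`: some cycle of `π` meets both. -/
def Connects (π : Equiv.Perm ℤ) (J K : Finset ℤ) : Prop :=
  ∃ j ∈ J, ∃ k ∈ K, π.SameCycle j k

/-- `δ : k ↦ -k`. -/
def delta : Equiv.Perm ℤ := Equiv.neg ℤ

/-- `γ₋ = δ γ₊ δ` (here `γ₊` is `γ` itself, as a permutation acting trivially outside its domain). -/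
def minus (γ : Equiv.Perm ℤ) : Equiv.Perm ℤ := delta * γ * delta

/-- `δ_ε : k ↦ ε(k) k`, where `ε` is extended to negative integers by `ε(-k) = ε(k)`. -/
def deltaSign (ε : ℕ → ℤˣ) : Equiv.Perm ℤ :=
  Function.Involutive.toPerm (fun k : ℤ => (ε k.natAbs : ℤ) * k) (by
    intro k
    rcases Int.units_eq_one_or (ε k.natAbs) with h | h <;> simp [h])

/-- `δ_ε π δ_ε`. -/
def signConj (ε : ℕ → ℤˣ) (π : Equiv.Perm ℤ) : Equiv.Perm ℤ :=
  deltaSign ε * π * deltaSign ε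

/-- `π` is a premap on `±I`: a permutation of `±I` with `π(k) = -π⁻¹(-k)`, no cycle of which contains
both `k` and `-k`. -/
def IsPremap (I : Finset ℕ) (π : Equiv.Perm ℤ) : Prop :=
  π ∈ permsOn (pm I) ∧
    (∀ k ∈ pm I, π k = -(π⁻¹ (-k))) ∧
    ∀ k ∈ pm I, ¬ π.SameCycle k (-k)

/-- `χ(γ, π) = #(γ₊γ₋⁻¹)/2 + #(π)/2 + #(γ₊⁻¹π⁻¹γ₋)/2 - |I|` for `γ ∈ S(I)` and a premap `π` on `±I`.
All three permutations are premaps on `±I`, so the divisions by two are exact. -/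
noncomputable def chi (I : Finset ℕ) (γ π : Equiv.Perm ℤ) : ℤ :=
  (numCycles (pm I) (γ * (minus γ)⁻¹) : ℤ) / 2 + (numCycles (pm I) π : ℤ) / 2 +
    (numCycles (pm I) (γ⁻¹ * π⁻¹ * minus γ) : ℤ) / 2 - (I.card : ℤ)

open Classical in
/-- The set of all elements of particular cycles of the premap `π` on `±I`, i.e. of those cycles
whose element of smallest absolute value is positive; with the restriction of `π` to it this is
`π/2`. -/
noncomputable def particular (I : Finset ℕ) (π : Equiv.Perm ℤ) : Finset ℤ :=
  (pm I).filter fun k =>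
    ∃ j : ℤ, 0 < j ∧ π.SameCycle k j ∧ ∀ l : ℤ, π.SameCycle k l → |j| ≤ |l|

/-! ### Traces along permutations -/

/-- The normalized trace `tr = (1/N) Tr`. -/
noncomputable def ntr {N : ℕ} (A : Matrix (Fin N) (Fin N) ℂ) : ℂ := (N : ℂ)⁻¹ * A.trace

/-- The product `M(k) M(π(k)) M(π²(k)) ⋯` once around the cycle of `π` that contains `k`. -/
noncomputable def cycleProd {N : ℕ} (π : Equiv.Perm ℤ) (M : ℤ → Matrix (Fin N) (Fin N) ℂ)
    (k : ℤ) : Matrix (Fin N) (Fin N) ℂ :=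
  ((List.range (Function.minimalPeriod π k)).map fun i => M ((π ^ i) k)).prod

open Classical in
/-- The normalized trace along the cycles of the permutation of `S` given by `π`: one factor
`tr(M(k) M(π(k)) ⋯)` for each cycle, read off from the least element `k` of the cycle. -/
noncomputable def trPerm {N : ℕ} (S : Finset ℤ) (π : Equiv.Perm ℤ)
    (M : ℤ → Matrix (Fin N) (Fin N) ℂ) : ℂ :=
  ∏ k ∈ S.filter (fun k => ∀ j : ℤ, π.SameCycle k j → k ≤ j), ntr (cycleProd π M k)

/-- `A^{(1)} = A`, `A^{(-1)} = Aᵀ`. -/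
def signPow {N : ℕ} (s : ℤˣ) (A : Matrix (Fin N) (Fin N) ℂ) : Matrix (Fin N) (Fin N) ℂ :=
  if s = 1 then A else A.transpose

/-- `Y^{(k)} = Y_k` and `Y^{(-k)} = Y_kᵀ` for positive `k`. -/
def signedFam {N : ℕ} (Y : ℕ → Matrix (Fin N) (Fin N) ℂ) (k : ℤ) :
    Matrix (Fin N) (Fin N) ℂ :=
  if 0 < k then Y k.natAbs else (Y k.natAbs).transpose

/-- `Tr(X_{λ(a+1)}^{(ε(a+1))} ⋯ X_{λ(a+r)}^{(ε(a+r))})`. -/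
def traceWord {N : ℕ} {Λ : Type*} (X : Λ → Matrix (Fin N) (Fin N) ℂ) (ε : ℕ → ℤˣ)
    (lam : ℕ → Λ) (a r : ℕ) : ℂ :=
  (((List.range r).map fun i => signPow (ε (a + i + 1)) (X (lam (a + i + 1)))).prod).trace

/-- The second classical cumulant `k₂(A, B) = E(AB) - E(A)E(B)` (bilinear, no conjugation). -/
noncomputable def cumulant2 {Ω : Type*} [MeasurableSpace Ω] (P : Measure Ω) (A B : Ω → ℂ) : ℂ :=
  (∫ ω, A ω * B ω ∂P) - (∫ ω, A ω ∂P) * ∫ ω, B ω ∂P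

/-! ### The class of ensembles -/

/-- The random matrices `X N l` (`N × N`, `l ∈ Λ`) satisfy a genus expansion over the sets of premaps
`PMc I` (on `±I`, for finite sets `I` of positive integers) with weights `f N lam I π`, which may
depend on `N` and on the labels `lam k = λ_k`, have a limit as `N → ∞`, and are multiplicative.
A real ensemble is one all of whose entries are real. -/
structure SatisfiesGeneral {Ω Λ : Type*} [MeasurableSpace Ω] (P : Measure Ω)
    (X : (N : ℕ) → Λ → Ω → Matrix (Fin N) (Fin N) ℂ)
    (PMc : Finset ℕ → Finset (Equiv.Perm ℤ))
    (f : ℕ → (ℕ → Λ) → Finset ℕ → Equiv.Perm ℤ → ℂ) : Prop where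
  measurable_entry : ∀ N l i j, Measurable fun ω => X N l ω i j
  /-- `PMc I` is a set of premaps on `±I`. -/
  isPremap : ∀ I : Finset ℕ, 0 ∉ I → ∀ π ∈ PMc I, IsPremap I π
  /-- The members of `PMc I` not connecting `±J` and `±(I \ J)` are exactly the products of a member
  of `PMc J` and a member of `PMc (I \ J)`. -/
  split : ∀ I : Finset ℕ, 0 ∉ I → ∀ J ⊆ I, ∀ π : Equiv.Perm ℤ,
    (π ∈ PMc I ∧ ¬ Connects π (pm J) (pm (I \ J))) ↔
      ∃ π₁ ∈ PMc J, ∃ π₂ ∈ PMc (I \ J), π = π₁ * π₂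
  /-- Multiplicativity; `π₁` and `π₂` are the restrictions of `π₁ * π₂` to `±J` and `±(I \ J)`. -/
  multiplicative : ∀ N : ℕ, 0 < N → ∀ (lam : ℕ → Λ) (I : Finset ℕ), 0 ∉ I → ∀ J ⊆ I,
    ∀ π₁ ∈ PMc J, ∀ π₂ ∈ PMc (I \ J),
      f N lam I (π₁ * π₂) = f N lam J π₁ * f N lam (I \ J) π₂
  limit_exists : ∀ (lam : ℕ → Λ) (I : Finset ℕ), 0 ∉ I → ∀ π ∈ PMc I,
    ∃ L : ℂ, Tendsto (fun N => f N lam I π) atTop (𝓝 L)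
  /-- The genus expansion, for all random matrices `Y k` with entries having finite moments of all
  orders and independent from the `X N l`; its left-hand expectation exists. -/
  expansion : ∀ N : ℕ, 0 < N → ∀ I : Finset ℕ, 0 ∉ I → ∀ γ ∈ permsOn (pos I),
    ∀ (ε : ℕ → ℤˣ) (lam : ℕ → Λ) (Y : ℕ → Ω → Matrix (Fin N) (Fin N) ℂ),
      (∀ k i j, Measurable fun ω => Y k ω i j) →
      (∀ k i j (p : ℕ), MemLp (fun ω => Y k ω i j) p P) →
      IndepFun (fun ω (q : Λ × Fin N × Fin N) => X N q.1 ω q.2.1 q.2.2)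
        (fun ω (q : ℕ × Fin N × Fin N) => Y q.1 ω q.2.1 q.2.2) P →
      Integrable (fun ω => trPerm (pos I) γ fun k =>
        signPow (ε k.natAbs) (X N (lam k.natAbs) ω) * Y k.natAbs ω) P ∧
      ∫ ω, trPerm (pos I) γ (fun k =>
          signPow (ε k.natAbs) (X N (lam k.natAbs) ω) * Y k.natAbs ω) ∂P =
        ∑ π ∈ PMc I,
          (N : ℂ) ^ (chi I γ (signConj ε π) - 2 * (numCycles (pos I) γ : ℤ)) * f N lam I π *
            ∫ ω, trPerm (particular I ((minus γ)⁻¹ * signConj ε π * γ))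
              ((minus γ)⁻¹ * signConj ε π * γ) (signedFam fun k => Y k ω) ∂P

/-! ### Annular noncrossing permutations -/

/-- The map induced on `J` by `g`: `k ∈ J` goes to `g^m(k)` for the smallest positive `m` with
`g^m(k) ∈ J`. -/
noncomputable def induced (g : ℤ → ℤ) (J : Finset ℤ) (k : ℤ) : ℤ :=
  g^[sInf {m : ℕ | 0 < m ∧ g^[m] k ∈ J}] k

/-- `g|_J = σ`. -/
def InducedEq (g : ℤ → ℤ) (J : Finset ℤ) (σ : Equiv.Perm ℤ) : Prop :=
  ∀ k ∈ J, induced g J k = σ k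

/-- The cycle `(l₁, l₂, …)` of a list of distinct integers. -/
def cyc (l : List ℤ) : Equiv.Perm ℤ := l.formPerm

/-- `π` is annular nonstandard relative to the permutation `γ` of `S`. -/
def AnnNonstandard (S : Finset ℤ) (γ π : Equiv.Perm ℤ) : Prop :=
  (∃ a ∈ S, ∃ b ∈ S, ∃ c ∈ S, [a, b, c].Nodup ∧
    InducedEq γ {a, b, c} (cyc [a, b, c]) ∧
    InducedEq π {a, b, c} (cyc [a, b, c])) ∨
  (∃ a ∈ S, ∃ b ∈ S, ∃ c ∈ S, ∃ d ∈ S, [a, b, c, d].Nodup ∧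
    InducedEq γ {a, b, c, d} (cyc [a, b] * cyc [c, d]) ∧
    InducedEq π {a, b, c, d} (cyc [a, c, b, d]))

/-- `λ_{x,y}`: it sends `γ⁻¹(x)` to `γ(y)`, `γ⁻¹(y)` to `γ(x)`, and agrees with `γ` elsewhere. It is
only used through the maps it induces on sets not containing `x` and `y`. (If `x` is the only
element of its cycle, then `γ⁻¹(y) ↦ x ↦ γ(y)`, so that `λ_{x,y}` induces on the remaining elements
the other cycle of `γ` with `y` deleted.) -/
def lamXY (γ : Equiv.Perm ℤ) (x y : ℤ) (k : ℤ) : ℤ :=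
  if γ k = x then γ y else if γ k = y then γ x else γ k

/-- `π` is annular crossing relative to the permutation `γ` of `S`, which has two cycles. -/
def AnnCrossing (S : Finset ℤ) (γ π : Equiv.Perm ℤ) : Prop :=
  (∃ a ∈ S, ∃ b ∈ S, ∃ c ∈ S, ∃ d ∈ S, [a, b, c, d].Nodup ∧
    InducedEq γ {a, b, c, d} (cyc [a, b, c, d]) ∧
    InducedEq π {a, b, c, d} (cyc [a, c] * cyc [b, d])) ∨
  (∃ x ∈ S, ∃ y ∈ S, ¬ γ.SameCycle x y ∧
    ∃ a ∈ S, ∃ b ∈ S, ∃ c ∈ S, [a, b, c, x, y].Nodup ∧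
    InducedEq (lamXY γ x y) {a, b, c} (cyc [a, b, c]) ∧
    InducedEq π {a, b, c, x, y} (cyc [a, b, c] * cyc [x, y])) ∨
  (∃ x ∈ S, ∃ y ∈ S, ¬ γ.SameCycle x y ∧
    ∃ a ∈ S, ∃ b ∈ S, ∃ c ∈ S, ∃ d ∈ S, [a, b, c, d, x, y].Nodup ∧
    InducedEq (lamXY γ x y) {a, b, c, d} (cyc [a, b, c, d]) ∧
    InducedEq π {a, b, c, d, x, y} (cyc [a, c] * cyc [b, d] * cyc [x, y]))

/-- The group generated by `γ` and `π` acts transitively on `S`. -/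
def Transitive (S : Finset ℤ) (γ π : Equiv.Perm ℤ) : Prop :=
  ∀ a ∈ S, ∀ b ∈ S, ∃ g ∈ Subgroup.closure ({γ, π} : Set (Equiv.Perm ℤ)), g a = b

open Classical in
/-- `S_{ann-nc}(γ)` for a permutation `γ` of `S` with two cycles: the connected permutations of `S`
that are neither annular nonstandard nor annular crossing. -/
noncomputable def annNC (S : Finset ℤ) (γ : Equiv.Perm ℤ) : Finset (Equiv.Perm ℤ) :=
  (permsOn S).filter fun π =>
    Transitive S γ π ∧ ¬ AnnNonstandard S γ π ∧ ¬ AnnCrossing S γ π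

/-- `δ_ε π₊ π₋⁻¹ δ_ε`. -/
def doubled (ε : ℕ → ℤˣ) (π : Equiv.Perm ℤ) : Equiv.Perm ℤ :=
  signConj ε (π * (minus π)⁻¹)

/-- `γ = (1, …, m)(m+1, …, m+n)`. -/
def gammaPar (m n : ℕ) : Equiv.Perm ℤ :=
  cyc ((List.range m).map fun i : ℕ => (i : ℤ) + 1) *
    cyc ((List.range n).map fun i : ℕ => (m : ℤ) + i + 1)

/-- `γ_op = (1, …, m)(-m-n, …, -m-1)`. -/
def gammaOp (m n : ℕ) : Equiv.Perm ℤ :=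
  cyc ((List.range m).map fun i : ℕ => (i : ℤ) + 1) *
    cyc ((List.range n).map fun i : ℕ => -(m : ℤ) - n + i)

/-- The domain `[m] ∪ (-[m+1, m+n])` of `γ_op`. -/
def domOp (m n : ℕ) : Finset ℤ :=
  pos (Finset.Icc 1 m) ∪ neg (Finset.Icc (m + 1) (m + n))

end RealFluct

namespace RealFluct

open Equiv Equiv.Perm

/-! With every `Y k` equal to the identity, the genus expansion becomes a sum of powers of `N` times
weights (`SatisfiesGeneral.expansion_one`). Unnormalized traces raise the exponent for the product
of the two traces to χ − 2. The Euler characteristic is additive (`chi_mul`) and the weights are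
multiplicative, so the premaps that do not connect the two blocks contribute exactly the product of
the two expectations. The covariance is therefore the sum of N^(χ−2) f_c over the connecting premaps
(`SatisfiesGeneral.cumulant2_eq`). It remains to see that χ ≤ 2 for these and to identify the case
of equality.

For a connecting premap `q` on `S`, the domain ±[m+n], `two_mul_chi_gammaPar` reduces χ ≤ 2 to #(q)
+ #(`double a * q`) ≤ |S|. Here `a` is γ or γ_op on its domain `T`, one half of `S`; both have the
same double (`double_gammaOp`), with four cycles. After a possible reflection, `q` links the two
cycles of one of these choices of `a`. If `double a` and `q` act transitively on `S`, the genus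
inequality (`numCycles_add_le_of_connected`) makes the bound strict. Otherwise the symmetry of `q`
under negation forces it to preserve `T`, hence to be the double of some `p` on `T`. The genus
inequality for `a` and `p` then gives the bound, with equality exactly for planar `p`
(`self_dual_genus`).

The remaining point is that planarity of `p` relative to a two-cycle `g` means absence of the five
forbidden patterns (`planar_iff_not_forbidden`). For x and y on one cycle of `p` but on different
cycles of `g`, `g * swap x y` is a single cycle, `swap x y * p` has one cycle more than `p`, and the
product of the pair is still `g * p`. Annular planarity thus becomes equality in the disc inequality
(`numCycles_add_le`), which is characterized by the absence of equally oriented triples and of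
crossings (`Geodesic.not_nonstandard`, `Geodesic.not_crossing`, `geodesic_of_noncrossing`).
Translating such configurations between the cut disc and the annulus produces the five patterns.
Their formulation by induced maps matches the one by cyclic orders (`forbidden_iff`). -/

/-! ### Coordinates on the cycles of a permutation of finite support -/

/-- The least number of steps that lead from `a` to `b` along the cycle of `g`. -/
noncomputable def steps (g : Perm ℤ) (a b : ℤ) : ℕ := sInf {k : ℕ | (g ^ k) a = b}

/-- The distinct elements `a`, `b`, `c` lie on one cycle of `g`, in this cyclic order. -/
def CycOrd (g : Perm ℤ) (a b c : ℤ) : Prop :=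
  g.SameCycle a b ∧ g.SameCycle a c ∧ 0 < steps g a b ∧ steps g a b < steps g a c

/-- The cycle of `g` through `x` has length `n`. -/
structure HasPeriod (g : Perm ℤ) (x : ℤ) (n : ℕ) : Prop where
  pos : 0 < n
  pow_eq : (g ^ n) x = x
  inj : ∀ i < n, ∀ j < n, (g ^ i) x = (g ^ j) x → i = j

theorem mul_mem_permsOn {S : Finset ℤ} {g h : Perm ℤ} (hg : g ∈ permsOn S) (hh : h ∈ permsOn S) :
    g * h ∈ permsOn S := by
  rw [mem_permsOn] at *
  intro k hk
  rw [Perm.mul_apply, hh k hk, hg k hk]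

theorem inv_mem_permsOn {S : Finset ℤ} {g : Perm ℤ} (hg : g ∈ permsOn S) :
    g⁻¹ ∈ permsOn S := by
  rw [mem_permsOn] at *
  intro k hk
  rw [Perm.inv_eq_iff_eq, hg k hk]

theorem swap_mem_permsOn {S : Finset ℤ} {x y : ℤ} (hx : x ∈ S) (hy : y ∈ S) :
    swap x y ∈ permsOn S := by
  rw [mem_permsOn]
  intro k hk
  exact swap_apply_of_ne_of_ne (fun e => hk (e ▸ hx)) (fun e => hk (e ▸ hy))

theorem permsOn_mono {S T : Finset ℤ} (h : S ⊆ T) {g : Perm ℤ} (hg : g ∈ permsOn S) :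
    g ∈ permsOn T := by
  rw [mem_permsOn] at *
  exact fun k hk => hg k fun hS => hk (h hS)

theorem apply_mem_of_permsOn {S : Finset ℤ} {g : Perm ℤ} (hg : g ∈ permsOn S) {k : ℤ}
    (hk : k ∈ S) : g k ∈ S := by
  rw [mem_permsOn] at hg
  by_contra h
  have := hg _ h
  exact h (by rw [g.injective this]; exact hk)

theorem mem_of_apply_ne {S : Finset ℤ} {g : Perm ℤ} (hg : g ∈ permsOn S) {k : ℤ}
    (hk : g k ≠ k) : k ∈ S := by
  rw [mem_permsOn] at hg
  by_contra h
  exact hk (hg _ h)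

theorem mem_of_sameCycle {S : Finset ℤ} {g : Perm ℤ} (hg : g ∈ permsOn S) {a b : ℤ}
    (h : g.SameCycle a b) (ha : a ∈ S) : b ∈ S := by
  by_contra hb
  rw [mem_permsOn] at hg
  have : a = b := h.symm.eq_of_left (hg b hb) |>.symm
  exact hb (this ▸ ha)

theorem exists_pow_eq_one {S : Finset ℤ} {g : Perm ℤ} (hg : g ∈ permsOn S) :
    ∃ n : ℕ, 0 < n ∧ g ^ n = 1 := by
  simp only [permsOn, Finset.mem_map, Finset.mem_univ, true_and,
      Function.Embedding.coeFn_mk] at hg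
  obtain ⟨σ, rfl⟩ := hg
  refine ⟨orderOf σ, orderOf_pos σ, ?_⟩
  rw [← map_pow, pow_orderOf_eq_one, map_one]

theorem exists_hasPeriod {S : Finset ℤ} {g : Perm ℤ} (hg : g ∈ permsOn S) (x : ℤ) :
    ∃ n, HasPeriod g x n := by
  obtain ⟨m, hm, h⟩ := exists_pow_eq_one hg
  have hp : x ∈ Function.periodicPts g := by
    refine ⟨m, hm, ?_⟩
    rw [Function.IsPeriodicPt, ← Perm.coe_pow, h]
    rfl
  refine ⟨Function.minimalPeriod g x, Function.minimalPeriod_pos_of_mem_periodicPts hp, ?_, ?_⟩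
  · rw [Perm.coe_pow]; exact Function.iterate_minimalPeriod
  · intro i hi j hj
    rw [Perm.coe_pow, Perm.coe_pow]
    exact (Function.iterate_eq_iterate_iff_of_lt_minimalPeriod hi hj).1

namespace HasPeriod

variable {g : Perm ℤ} {x : ℤ} {n : ℕ}

theorem steps_pow (h : HasPeriod g x n) {i : ℕ} (hi : i < n) : steps g x ((g ^ i) x) = i := by
  have h1 : (g ^ steps g x ((g ^ i) x)) x = (g ^ i) x :=
    Nat.sInf_mem (s := {k : ℕ | (g ^ k) x = (g ^ i) x}) ⟨i, rfl⟩
  have h2 : steps g x ((g ^ i) x) ≤ i := Nat.sInf_le rfl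
  exact h.inj _ (by omega) _ hi h1

theorem sameCycle_iff (h : HasPeriod g x n) {z : ℤ} :
    g.SameCycle x z ↔ ∃ i < n, (g ^ i) x = z := by
  constructor
  · rintro ⟨i, rfl⟩
    have hn : (0 : ℤ) < n := by exact_mod_cast h.pos
    refine ⟨(i % n).toNat, by have := Int.emod_lt_of_pos i hn; have := Int.emod_nonneg i hn.ne'; omega, ?_⟩
    have e : ((i % n).toNat : ℤ) = i % n := Int.toNat_of_nonneg (Int.emod_nonneg i hn.ne')
    rw [← zpow_natCast, e]
    conv_rhs => rw [← Int.emod_add_mul_ediv i n, zpow_add, Perm.mul_apply, zpow_mul, zpow_natCast,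
      zpow_apply_eq_self_of_apply_eq_self h.pow_eq]
  · rintro ⟨i, _, rfl⟩
    exact ⟨i, by simp⟩

theorem steps_lt (h : HasPeriod g x n) {z : ℤ} (hz : g.SameCycle x z) :
    steps g x z < n ∧ (g ^ steps g x z) x = z := by
  obtain ⟨i, hi, rfl⟩ := h.sameCycle_iff.1 hz
  rw [h.steps_pow hi]
  exact ⟨hi, rfl⟩

theorem steps_self (h : HasPeriod g x n) : steps g x x = 0 := by
  simpa using h.steps_pow h.pos

theorem steps_inj (h : HasPeriod g x n) {a b : ℤ} (ha : g.SameCycle x a) (hb : g.SameCycle x b)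
    (e : steps g x a = steps g x b) : a = b := by
  rw [← (h.steps_lt ha).2, ← (h.steps_lt hb).2, e]

theorem pow_add_period (h : HasPeriod g x n) (i : ℕ) : (g ^ (i + n)) x = (g ^ i) x := by
  rw [pow_add, Perm.mul_apply, h.pow_eq]

theorem hasPeriod_of_sameCycle (h : HasPeriod g x n) {a : ℤ} (ha : g.SameCycle x a) :
    HasPeriod g a n := by
  obtain ⟨k, hk, rfl⟩ := h.sameCycle_iff.1 ha
  refine ⟨h.pos, ?_, ?_⟩
  · rw [← Perm.mul_apply, (Commute.pow_pow_self g n k).eq, Perm.mul_apply, h.pow_eq]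
  · intro i hi j hj e
    rw [← Perm.mul_apply, ← Perm.mul_apply, (Commute.pow_pow_self g i k).eq,
      (Commute.pow_pow_self g j k).eq, Perm.mul_apply, Perm.mul_apply] at e
    exact h.inj _ hi _ hj ((g ^ k).injective e)

theorem pow_apply_of_pow (_ : HasPeriod g x n) {a : ℤ} {i : ℕ} (ha : (g ^ i) x = a) (k : ℕ) :
    (g ^ k) a = (g ^ (k + i)) x := by
  rw [pow_add, Perm.mul_apply, ha]

/-- Change of origin along the cycle: the difference of the two coordinates, with the period added
when the path from `a` to `b` passes the old origin. -/
theorem steps_eq (h : HasPeriod g x n) {a b : ℤ} (ha : g.SameCycle x a) (hb : g.SameCycle x b) :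
    steps g a b = if steps g x a ≤ steps g x b then steps g x b - steps g x a
      else n + steps g x b - steps g x a := by
  obtain ⟨la, ea⟩ := h.steps_lt ha
  obtain ⟨lb, eb⟩ := h.steps_lt hb
  have h' := h.hasPeriod_of_sameCycle ha
  split_ifs with hab
  · have := h'.steps_pow (i := steps g x b - steps g x a) (by omega)
    rwa [show (g ^ (steps g x b - steps g x a)) a = b by
      rw [h.pow_apply_of_pow ea, Nat.sub_add_cancel hab, eb]] at this
  · have := h'.steps_pow (i := n + steps g x b - steps g x a) (by omega)
    rwa [show (g ^ (n + steps g x b - steps g x a)) a = b by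
      rw [h.pow_apply_of_pow ea, Nat.sub_add_cancel (by omega), add_comm, h.pow_add_period,
        eb]] at this

/-- In terms of the number of steps from `x`, `CycOrd` is the cyclic order of numbers. -/
theorem cycOrd_iff (h : HasPeriod g x n) {a b c : ℤ} (ha : g.SameCycle x a)
    (hb : g.SameCycle x b) (hc : g.SameCycle x c) :
    CycOrd g a b c ↔ (steps g x a < steps g x b ∧ steps g x b < steps g x c) ∨
      (steps g x b < steps g x c ∧ steps g x c < steps g x a) ∨
      (steps g x c < steps g x a ∧ steps g x a < steps g x b) := by
  have la := (h.steps_lt ha).1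
  have lb := (h.steps_lt hb).1
  have lc := (h.steps_lt hc).1
  have hab := ha.symm.trans hb
  have hac := ha.symm.trans hc
  simp only [CycOrd, hab, hac, true_and, h.steps_eq ha hb, h.steps_eq ha hc]
  split_ifs <;> omega

end HasPeriod

section Coordinates

variable {S : Finset ℤ} {g : Perm ℤ}

/-- Coordinates on a cycle, counted from `x`. -/
theorem exists_coord (hg : g ∈ permsOn S) (x : ℤ) :
    ∃ p : ℤ → ℕ, p x = 0 ∧ (∀ a b, g.SameCycle x a → g.SameCycle x b → p a = p b → a = b) ∧
      (∀ a b c, g.SameCycle x a → g.SameCycle x b → g.SameCycle x c →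
        (CycOrd g a b c ↔ (p a < p b ∧ p b < p c) ∨ (p b < p c ∧ p c < p a) ∨
          (p c < p a ∧ p a < p b))) := by
  obtain ⟨n, h⟩ := exists_hasPeriod hg x
  exact ⟨steps g x, h.steps_self, fun a b ha hb => h.steps_inj ha hb,
    fun a b c ha hb hc => h.cycOrd_iff ha hb hc⟩

/-- In coordinates counted from `a`, this and the laws of cyclic order below are linear arithmetic
on at most four numbers. -/
theorem CycOrd.rotate (hg : g ∈ permsOn S) {a b c : ℤ} (h : CycOrd g a b c) : CycOrd g b c a := by
  obtain ⟨p, p0, pi, hp⟩ := exists_coord hg a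
  have hab := h.1
  have hac := h.2.1
  have ha := SameCycle.refl g a
  rw [hp _ _ _ hab hac ha]
  rw [hp _ _ _ ha hab hac] at h
  omega

theorem CycOrd.not_flip (hg : g ∈ permsOn S) {a b c : ℤ} (h : CycOrd g a b c) :
    ¬ CycOrd g a c b := by
  obtain ⟨p, p0, pi, hp⟩ := exists_coord hg a
  have hab := h.1
  have hac := h.2.1
  have ha := SameCycle.refl g a
  rw [hp _ _ _ ha hac hab]
  rw [hp _ _ _ ha hab hac] at h
  omega

theorem CycOrd.ne (hg : g ∈ permsOn S) {a b c : ℤ} (h : CycOrd g a b c) :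
    a ≠ b ∧ a ≠ c ∧ b ≠ c := by
  obtain ⟨p, p0, pi, hp⟩ := exists_coord hg a
  have hab := h.1
  have hac := h.2.1
  have ha := SameCycle.refl g a
  rw [hp _ _ _ ha hab hac] at h
  refine ⟨?_, ?_, ?_⟩ <;> (rintro rfl; omega)

theorem CycOrd.total (hg : g ∈ permsOn S) {a b c : ℤ} (hab : g.SameCycle a b)
    (hac : g.SameCycle a c) (h1 : a ≠ b) (h2 : a ≠ c) (h3 : b ≠ c) :
    CycOrd g a b c ∨ CycOrd g a c b := by
  obtain ⟨p, p0, pi, hp⟩ := exists_coord hg a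
  have ha := SameCycle.refl g a
  rw [hp _ _ _ ha hab hac, hp _ _ _ ha hac hab]
  have : p a ≠ p b := fun e => h1 (pi _ _ ha hab e)
  have : p a ≠ p c := fun e => h2 (pi _ _ ha hac e)
  have : p b ≠ p c := fun e => h3 (pi _ _ hab hac e)
  omega

theorem CycOrd.trans (hg : g ∈ permsOn S) {a b c d : ℤ} (h1 : CycOrd g a b c)
    (h2 : CycOrd g a c d) : CycOrd g a b d ∧ CycOrd g b c d := by
  obtain ⟨p, p0, pi, hp⟩ := exists_coord hg a
  have hab := h1.1
  have hac := h1.2.1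
  have had := h2.2.1
  have ha := SameCycle.refl g a
  rw [hp _ _ _ ha hab had, hp _ _ _ hab hac had]
  rw [hp _ _ _ ha hab hac] at h1
  rw [hp _ _ _ ha hac had] at h2
  constructor <;> omega

end Coordinates

/-! ### Splitting a cycle by a transposition -/

section Split

variable {g : Perm ℤ} {x y : ℤ}

/-- The first step from `x` jumps to the successor of `y`; from there on neither `x` nor `y` is met
until the cycle closes at `x`, so the path is that of `g`, shifted by `steps g x y`. -/
theorem mul_swap_pow_left {n : ℕ} (h : HasPeriod g x n) (hy : g.SameCycle x y) {k : ℕ}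
    (hk : k + steps g x y ≤ n) (hk0 : 0 < k) :
    ((g * swap x y) ^ k) x = (g ^ (k + steps g x y)) x := by
  obtain ⟨ly, ey⟩ := h.steps_lt hy
  induction k with
  | zero => omega
  | succ k ih =>
    rw [pow_succ', Perm.mul_apply]
    rcases Nat.eq_zero_or_pos k with rfl | hk'
    · simp only [pow_zero, Perm.one_apply, Perm.mul_apply, swap_apply_left]
      conv_lhs => rw [← ey]
      rw [← Perm.mul_apply, ← pow_succ', Nat.zero_add, Nat.add_comm]
    · rw [ih (by omega) hk', Perm.mul_apply, swap_apply_of_ne_of_ne, ← Perm.mul_apply, ← pow_succ']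
      · congr 2; omega
      · intro e
        have := h.inj (k + steps g x y) (by omega) 0 h.pos (by simpa using e)
        omega
      · intro e
        have := h.inj (k + steps g x y) (by omega) _ ly (by rw [e, ey])
        omega

/-- The first step from `y` goes to the successor of `x`; the path then follows `g` until it arrives
at `y`. -/
theorem mul_swap_pow_right {n : ℕ} (h : HasPeriod g x n) (hy : g.SameCycle x y) {k : ℕ}
    (hk : k ≤ steps g x y) (hk0 : 0 < k) :
    ((g * swap x y) ^ k) y = (g ^ k) x := by
  obtain ⟨ly, ey⟩ := h.steps_lt hy
  induction k with
  | zero => omega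
  | succ k ih =>
    rw [pow_succ', Perm.mul_apply]
    rcases Nat.eq_zero_or_pos k with rfl | hk'
    · simp
    · rw [ih (by omega) hk', Perm.mul_apply, swap_apply_of_ne_of_ne, ← Perm.mul_apply, ← pow_succ']
      · intro e
        have := h.inj k (by omega) 0 h.pos (by simpa using e)
        omega
      · intro e
        have := h.inj k (by omega) _ ly (by rw [e, ey])
        omega

theorem steps_pos_of_ne {n : ℕ} (h : HasPeriod g x n) (hy : g.SameCycle x y) (hxy : x ≠ y) :
    0 < steps g x y := by
  rcases Nat.eq_zero_or_pos (steps g x y) with e | e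
  · exact absurd (h.steps_inj (SameCycle.refl g x) hy (by rw [e, h.steps_self])) hxy
  · exact e

theorem hasPeriod_mul_swap_left {n : ℕ} (h : HasPeriod g x n) (hy : g.SameCycle x y)
    (hxy : x ≠ y) : HasPeriod (g * swap x y) x (n - steps g x y) := by
  obtain ⟨ly, ey⟩ := h.steps_lt hy
  have l0 := steps_pos_of_ne h hy hxy
  refine ⟨by omega, ?_, ?_⟩
  · rw [mul_swap_pow_left h hy (by omega) (by omega), Nat.sub_add_cancel ly.le, h.pow_eq]
  -- The start `x` keeps exponent 0 and all later points are shifted past `y`; distinct `i` thus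
  -- give distinct exponents below `n`.
  · have key : ∀ i < n - steps g x y, ((g * swap x y) ^ i) x =
        (g ^ (if i = 0 then 0 else i + steps g x y)) x := by
      intro i hi
      split_ifs with h0
      · simp [h0]
      · exact mul_swap_pow_left h hy (by omega) (by omega)
    intro i hi j hj e
    rw [key i hi, key j hj] at e
    have := h.inj _ (by split_ifs <;> omega) _ (by split_ifs <;> omega) e
    split_ifs at this <;> omega

theorem hasPeriod_mul_swap_right {n : ℕ} (h : HasPeriod g x n) (hy : g.SameCycle x y)
    (hxy : x ≠ y) : HasPeriod (g * swap x y) y (steps g x y) := by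
  obtain ⟨ly, ey⟩ := h.steps_lt hy
  have l0 := steps_pos_of_ne h hy hxy
  refine ⟨l0, ?_, ?_⟩
  · rw [mul_swap_pow_right h hy le_rfl l0, ey]
  · have key : ∀ i < steps g x y, ((g * swap x y) ^ i) y =
        (g ^ (if i = 0 then steps g x y else i)) x := by
      intro i hi
      split_ifs with h0
      · simp [h0, ey]
      · exact mul_swap_pow_right h hy (by omega) (by omega)
    intro i hi j hj e
    rw [key i hi, key j hj] at e
    have := h.inj _ (by split_ifs <;> omega) _ (by split_ifs <;> omega) e
    split_ifs at this <;> omega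

/-- The cycle through `x` after splitting, with its coordinates. -/
theorem mul_swap_sameCycle_left {n : ℕ} (h : HasPeriod g x n) (hy : g.SameCycle x y)
    (hxy : x ≠ y) (z : ℤ) :
    (g * swap x y).SameCycle x z ↔ g.SameCycle x z ∧ (z = x ∨ steps g x y < steps g x z) := by
  obtain ⟨ly, ey⟩ := h.steps_lt hy
  have h1 := hasPeriod_mul_swap_left h hy hxy
  rw [h1.sameCycle_iff]
  constructor
  · rintro ⟨i, hi, rfl⟩
    rcases Nat.eq_zero_or_pos i with rfl | h0
    · exact ⟨SameCycle.refl g _, Or.inl rfl⟩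
    · rw [mul_swap_pow_left h hy (by omega) h0, h.steps_pow (by omega)]
      exact ⟨⟨_, by rw [zpow_natCast]⟩, Or.inr (by omega)⟩
  · rintro ⟨hz, rfl | hz'⟩
    · exact ⟨0, h1.pos, rfl⟩
    · obtain ⟨lz, ez⟩ := h.steps_lt hz
      refine ⟨steps g x z - steps g x y, by omega, ?_⟩
      rw [mul_swap_pow_left h hy (by omega) (by omega), Nat.sub_add_cancel hz'.le, ez]

theorem mul_swap_sameCycle_right {n : ℕ} (h : HasPeriod g x n) (hy : g.SameCycle x y)
    (hxy : x ≠ y) (z : ℤ) :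
    (g * swap x y).SameCycle y z ↔
      g.SameCycle x z ∧ z ≠ x ∧ steps g x z ≤ steps g x y := by
  obtain ⟨ly, ey⟩ := h.steps_lt hy
  have h1 := hasPeriod_mul_swap_right h hy hxy
  rw [h1.sameCycle_iff]
  constructor
  · rintro ⟨i, hi, rfl⟩
    rcases Nat.eq_zero_or_pos i with rfl | h0
    · exact ⟨hy, hxy.symm, le_rfl⟩
    · rw [mul_swap_pow_right h hy (by omega) h0, h.steps_pow (by omega)]
      refine ⟨⟨_, by rw [zpow_natCast]⟩, ?_, by omega⟩
      intro e
      have := h.inj i (by omega) 0 h.pos (by simpa using e)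
      omega
  · rintro ⟨hz, hzx, hz'⟩
    obtain ⟨lz, ez⟩ := h.steps_lt hz
    have hz0 := steps_pos_of_ne h hz hzx.symm
    rcases hz'.lt_or_eq with hlt | heq
    · exact ⟨steps g x z, hlt, by rw [mul_swap_pow_right h hy hz' hz0, ez]⟩
    · exact ⟨0, h1.pos, h.steps_inj hy hz heq.symm⟩

/-- At z = x the truncated subtraction gives the correct value 0. -/
theorem mul_swap_steps_left {n : ℕ} (h : HasPeriod g x n) (hy : g.SameCycle x y)
    (hxy : x ≠ y) {z : ℤ} (hz : (g * swap x y).SameCycle x z) :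
    steps (g * swap x y) x z = steps g x z - steps g x y := by
  obtain ⟨ly, ey⟩ := h.steps_lt hy
  have h1 := hasPeriod_mul_swap_left h hy hxy
  obtain ⟨hz1, rfl | hz2⟩ := (mul_swap_sameCycle_left h hy hxy z).1 hz
  · rw [h1.steps_self, h.steps_self, Nat.zero_sub]
  · obtain ⟨lz, ez⟩ := h.steps_lt hz1
    have := h1.steps_pow (i := steps g x z - steps g x y) (by omega)
    rwa [mul_swap_pow_left h hy (by omega) (by omega), Nat.sub_add_cancel hz2.le, ez] at this

/-- The old coordinate of `y` is the largest on its piece and the new one is 0. All others stay, so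
the coordinates are only rotated. -/
theorem mul_swap_steps_right {n : ℕ} (h : HasPeriod g x n) (hy : g.SameCycle x y)
    (hxy : x ≠ y) {z : ℤ} (hz : (g * swap x y).SameCycle y z) :
    steps (g * swap x y) y z = if z = y then 0 else steps g x z := by
  obtain ⟨ly, ey⟩ := h.steps_lt hy
  have h1 := hasPeriod_mul_swap_right h hy hxy
  obtain ⟨hz1, hz2, hz3⟩ := (mul_swap_sameCycle_right h hy hxy z).1 hz
  split_ifs with e
  · rw [e, h1.steps_self]
  · obtain ⟨lz, ez⟩ := h.steps_lt hz1
    have hlt : steps g x z < steps g x y :=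
      lt_of_le_of_ne hz3 fun e' => e (h.steps_inj hz1 hy e')
    have := h1.steps_pow hlt
    rwa [mul_swap_pow_right h hy hz3 (steps_pos_of_ne h hz1 hz2.symm), ez] at this

theorem pow_eq_pow_of_agree {g g' : Perm ℤ} {a : ℤ} (h : ∀ z, g.SameCycle a z → g' z = g z)
    (k : ℕ) : (g' ^ k) a = (g ^ k) a := by
  induction k with
  | zero => rfl
  | succ k ih =>
    rw [pow_succ', pow_succ', Perm.mul_apply, Perm.mul_apply, ih]
    exact h _ ⟨k, by rw [zpow_natCast]⟩

theorem steps_eq_of_agree {g g' : Perm ℤ} {a : ℤ} (h : ∀ z, g.SameCycle a z → g' z = g z)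
    (b : ℤ) : steps g' a b = steps g a b := by
  simp only [steps, pow_eq_pow_of_agree h]

theorem sameCycle_iff_exists_pow {S : Finset ℤ} {g : Perm ℤ} (hg : g ∈ permsOn S) {a b : ℤ} :
    g.SameCycle a b ↔ ∃ k : ℕ, (g ^ k) a = b := by
  obtain ⟨n, h⟩ := exists_hasPeriod hg a
  refine ⟨fun hab => ?_, fun ⟨k, hk⟩ => ⟨k, by rw [zpow_natCast, hk]⟩⟩
  obtain ⟨i, _, hi⟩ := h.sameCycle_iff.1 hab
  exact ⟨i, hi⟩

theorem sameCycle_iff_of_agree {S S' : Finset ℤ} {g g' : Perm ℤ} (hg : g ∈ permsOn S)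
    (hg' : g' ∈ permsOn S') {a : ℤ}
    (h : ∀ z, g.SameCycle a z → g' z = g z) (b : ℤ) : g'.SameCycle a b ↔ g.SameCycle a b := by
  rw [sameCycle_iff_exists_pow hg, sameCycle_iff_exists_pow hg']
  simp only [pow_eq_pow_of_agree h]

theorem cycOrd_iff_of_agree {S S' : Finset ℤ} {g g' : Perm ℤ} (hg : g ∈ permsOn S)
    (hg' : g' ∈ permsOn S') {a : ℤ} (h : ∀ z, g.SameCycle a z → g' z = g z) (b c : ℤ) :
    CycOrd g' a b c ↔ CycOrd g a b c := by
  simp only [CycOrd, sameCycle_iff_of_agree hg hg' h, steps_eq_of_agree h]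

variable {S : Finset ℤ}

/-- `g * swap x y` splits the cycle `(x P y Q)` of `g` into `(x Q)` and `(y P)`. -/
theorem split_left (hg : g ∈ permsOn S) {q : ℤ} (h : CycOrd g x y q) :
    (g * swap x y).SameCycle x q := by
  obtain ⟨n, hn⟩ := exists_hasPeriod hg x
  rw [mul_swap_sameCycle_left hn h.1 (h.ne hg).1]
  exact ⟨h.2.1, Or.inr h.2.2.2⟩

theorem split_right (hg : g ∈ permsOn S) {p : ℤ} (h : CycOrd g x p y) :
    (g * swap x y).SameCycle y p := by
  obtain ⟨n, hn⟩ := exists_hasPeriod hg x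
  rw [mul_swap_sameCycle_right hn h.2.1 (h.ne hg).2.1]
  exact ⟨h.1, (h.ne hg).1.symm, h.2.2.2.le⟩

theorem split_not_sameCycle (hg : g ∈ permsOn S) (hy : g.SameCycle x y) (hxy : x ≠ y) :
    ¬ (g * swap x y).SameCycle x y := by
  obtain ⟨n, hn⟩ := exists_hasPeriod hg x
  rw [mul_swap_sameCycle_left hn hy hxy]
  rintro ⟨_, h | h⟩
  · exact hxy h.symm
  · omega

theorem split_agree (hy : g.SameCycle x y) {a : ℤ} (ha : ¬ g.SameCycle x a) (z : ℤ)
    (hz : g.SameCycle a z) : (g * swap x y) z = g z := by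
  rw [Perm.mul_apply, swap_apply_of_ne_of_ne]
  · rintro rfl; exact ha hz.symm
  · rintro rfl; exact ha (hy.trans hz.symm)

theorem mem_of_sameCycle_ne (hg : g ∈ permsOn S) (hy : g.SameCycle x y) (hxy : x ≠ y) :
    x ∈ S ∧ y ∈ S := by
  have hx : x ∈ S := mem_of_apply_ne hg fun e => hxy (hy.eq_of_left e)
  exact ⟨hx, mem_of_sameCycle hg hy hx⟩

theorem mul_swap_mem (hg : g ∈ permsOn S) (hx : x ∈ S) (hy : y ∈ S) :
    g * swap x y ∈ permsOn S :=
  mul_mem_permsOn hg (swap_mem_permsOn hx hy)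

theorem split_mem (hg : g ∈ permsOn S) (hy : g.SameCycle x y) (hxy : x ≠ y) :
    g * swap x y ∈ permsOn S :=
  mul_swap_mem hg (mem_of_sameCycle_ne hg hy hxy).1 (mem_of_sameCycle_ne hg hy hxy).2

theorem split_sameCycle_of_not (hg : g ∈ permsOn S) (hy : g.SameCycle x y) (hxy : x ≠ y) {a : ℤ}
    (ha : ¬ g.SameCycle x a) (b : ℤ) :
    (g * swap x y).SameCycle a b ↔ g.SameCycle a b :=
  sameCycle_iff_of_agree hg (split_mem hg hy hxy) (split_agree hy ha) b

theorem split_or (hg : g ∈ permsOn S) (hy : g.SameCycle x y) (hxy : x ≠ y) {a : ℤ}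
    (ha : g.SameCycle x a) :
    (g * swap x y).SameCycle x a ∨ (g * swap x y).SameCycle y a := by
  obtain ⟨n, hn⟩ := exists_hasPeriod hg x
  rw [mul_swap_sameCycle_left hn hy hxy, mul_swap_sameCycle_right hn hy hxy]
  by_cases h : a = x
  · exact Or.inl ⟨ha, Or.inl h⟩
  · rcases lt_or_ge (steps g x y) (steps g x a) with h' | h'
    · exact Or.inl ⟨ha, Or.inr h'⟩
    · exact Or.inr ⟨ha, h, h'⟩

theorem split_le (hg : g ∈ permsOn S) (hy : g.SameCycle x y) (hxy : x ≠ y) {a b : ℤ}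
    (h : (g * swap x y).SameCycle a b) : g.SameCycle a b := by
  obtain ⟨n, hn⟩ := exists_hasPeriod hg x
  by_cases ha : g.SameCycle x a
  · rcases split_or hg hy hxy ha with h1 | h1
    · exact ha.symm.trans ((mul_swap_sameCycle_left hn hy hxy b).1 (h1.trans h)).1
    · exact ha.symm.trans ((mul_swap_sameCycle_right hn hy hxy b).1 (h1.trans h)).1
  · exact (split_sameCycle_of_not hg hy hxy ha b).1 h

/-- On each of the two pieces the new coordinates arise from the old ones by a shift or a cyclic
rotation, neither of which changes cyclic order; cycles away from `x` are untouched. -/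
theorem split_cycOrd (hg : g ∈ permsOn S) (hy : g.SameCycle x y) (hxy : x ≠ y) {a b c : ℤ}
    (h : CycOrd (g * swap x y) a b c) : CycOrd g a b c := by
  obtain ⟨n, hn⟩ := exists_hasPeriod hg x
  by_cases ha : g.SameCycle x a
  · have hb := ha.trans (split_le hg hy hxy h.1)
    have hc := ha.trans (split_le hg hy hxy h.2.1)
    rw [hn.cycOrd_iff ha hb hc]
    rcases split_or hg hy hxy ha with h1 | h1
    · have hb1 := h1.trans h.1
      have hc1 := h1.trans h.2.1
      rw [(hasPeriod_mul_swap_left hn hy hxy).cycOrd_iff h1 hb1 hc1,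
        mul_swap_steps_left hn hy hxy h1, mul_swap_steps_left hn hy hxy hb1,
        mul_swap_steps_left hn hy hxy hc1] at h
      have aux : ∀ z, (g * swap x y).SameCycle x z →
          steps g x z = 0 ∨ steps g x y < steps g x z := by
        intro z hz
        obtain ⟨_, rfl | h2⟩ := (mul_swap_sameCycle_left hn hy hxy z).1 hz
        · exact Or.inl hn.steps_self
        · exact Or.inr h2
      have := aux a h1
      have := aux b hb1
      have := aux c hc1
      omega
    · have hb1 := h1.trans h.1
      have hc1 := h1.trans h.2.1
      rw [(hasPeriod_mul_swap_right hn hy hxy).cycOrd_iff h1 hb1 hc1,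
        mul_swap_steps_right hn hy hxy h1, mul_swap_steps_right hn hy hxy hb1,
        mul_swap_steps_right hn hy hxy hc1] at h
      have aux : ∀ z, (g * swap x y).SameCycle y z →
          0 < steps g x z ∧ (z = y → steps g x z = steps g x y) ∧
            (z ≠ y → steps g x z < steps g x y) := by
        intro z hz
        obtain ⟨h2, h3, h4⟩ := (mul_swap_sameCycle_right hn hy hxy z).1 hz
        exact ⟨steps_pos_of_ne hn h2 h3.symm, fun e => by rw [e],
          fun e => lt_of_le_of_ne h4 fun e' => e (hn.steps_inj h2 hy e')⟩
      have := aux a h1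
      have := aux b hb1
      have := aux c hc1
      split_ifs at h <;> omega
  · exact (cycOrd_iff_of_agree hg (split_mem hg hy hxy) (split_agree hy ha) b c).1 h

/-- The converse comes from totality: on a common piece some orientation holds, and the opposite one
would carry over to `g`. -/
theorem split_cycOrd_iff (hg : g ∈ permsOn S) (hy : g.SameCycle x y) (hxy : x ≠ y) {a b c : ℤ}
    (hab : (g * swap x y).SameCycle a b) (hac : (g * swap x y).SameCycle a c) :
    CycOrd (g * swap x y) a b c ↔ CycOrd g a b c := by
  refine ⟨split_cycOrd hg hy hxy, fun h => ?_⟩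
  obtain ⟨h1, h2, h3⟩ := h.ne hg
  rcases CycOrd.total (split_mem hg hy hxy) hab hac h1 h2 h3 with h' | h'
  · exact h'
  · exact absurd (split_cycOrd hg hy hxy h') (h.not_flip hg)

end Split

/-! ### Counting cycles -/

/-- The cycle of `g` that contains `k`. -/
def orbitOf (g : Perm ℤ) (k : ℤ) : Set ℤ := {j | g.SameCycle k j}

theorem orbitOf_eq_iff {g : Perm ℤ} {a b : ℤ} : orbitOf g a = orbitOf g b ↔ g.SameCycle a b := by
  constructor
  · intro h
    have : b ∈ orbitOf g b := SameCycle.refl g b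
    rw [← h] at this
    exact this
  · intro h
    ext j
    exact ⟨fun hj => h.symm.trans hj, fun hj => h.trans hj⟩

theorem numCycles_eq_image (S : Finset ℤ) (g : Perm ℤ) :
    numCycles S g = (orbitOf g '' (S : Set ℤ)).ncard := by
  unfold numCycles
  congr 1
  ext C
  simp only [Set.mem_ofPred_eq, Set.mem_image, Finset.mem_coe, orbitOf]
  exact ⟨fun ⟨k, hk, e⟩ => ⟨k, hk, e.symm⟩, fun ⟨k, hk, e⟩ => ⟨k, hk, e.symm⟩⟩

theorem finite_orbits (S : Finset ℤ) (g : Perm ℤ) : (orbitOf g '' (S : Set ℤ)).Finite :=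
  S.finite_toSet.image _

theorem numCycles_congr {S : Finset ℤ} {g h : Perm ℤ}
    (e : ∀ a ∈ S, ∀ b, g.SameCycle a b ↔ h.SameCycle a b) : numCycles S g = numCycles S h := by
  rw [numCycles_eq_image, numCycles_eq_image]
  congr 1
  apply Set.image_congr
  intro a ha
  ext b
  exact e a ha b

theorem numCycles_inv (S : Finset ℤ) (g : Perm ℤ) : numCycles S g⁻¹ = numCycles S g :=
  numCycles_congr fun _ _ _ => sameCycle_inv

theorem numCycles_one (S : Finset ℤ) : numCycles S 1 = S.card := by
  rw [numCycles_eq_image, Set.ncard_image_of_injective, Set.ncard_coe_finset]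
  intro a b h
  rw [orbitOf_eq_iff, sameCycle_one] at h
  exact h

theorem numCycles_le (S : Finset ℤ) (g : Perm ℤ) : numCycles S g ≤ S.card := by
  rw [numCycles_eq_image]
  exact (Set.ncard_image_le S.finite_toSet).trans (by rw [Set.ncard_coe_finset])

theorem numCycles_split {S : Finset ℤ} {g : Perm ℤ} {x y : ℤ} (hg : g ∈ permsOn S)
    (hy : g.SameCycle x y) (hxy : x ≠ y) :
    numCycles S (g * swap x y) = numCycles S g + 1 := by
  obtain ⟨hxS, hyS⟩ := mem_of_sameCycle_ne hg hy hxy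
  set g1 := g * swap x y with hg1
  have hns : ¬ g1.SameCycle x y := split_not_sameCycle hg hy hxy
  rw [numCycles_eq_image, numCycles_eq_image]
  -- The cycles away from `x` are common to both permutations. Beside them `g` has one cycle and the
  -- split permutation has two.
  set R := orbitOf g '' {a | a ∈ S ∧ ¬ g.SameCycle x a} with hR
  have e0 : orbitOf g '' (S : Set ℤ) = insert (orbitOf g x) R := by
    ext C
    constructor
    · rintro ⟨a, ha, rfl⟩
      by_cases h : g.SameCycle x a
      · left; exact orbitOf_eq_iff.2 h.symm
      · right; exact ⟨a, ⟨ha, h⟩, rfl⟩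
    · rintro (rfl | ⟨a, ⟨ha, _⟩, rfl⟩)
      · exact ⟨x, hxS, rfl⟩
      · exact ⟨a, ha, rfl⟩
  have eR : ∀ a, ¬ g.SameCycle x a → orbitOf g1 a = orbitOf g a := by
    intro a ha
    ext b
    exact split_sameCycle_of_not hg hy hxy ha b
  have e1 : orbitOf g1 '' (S : Set ℤ) = insert (orbitOf g1 x) (insert (orbitOf g1 y) R) := by
    ext C
    constructor
    · rintro ⟨a, ha, rfl⟩
      by_cases h : g.SameCycle x a
      · rcases split_or hg hy hxy h with h' | h'
        · left; exact orbitOf_eq_iff.2 h'.symm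
        · right; left; exact orbitOf_eq_iff.2 h'.symm
      · right; right; exact ⟨a, ⟨ha, h⟩, (eR a h).symm⟩
    · rintro (rfl | rfl | ⟨a, ⟨ha, h⟩, rfl⟩)
      · exact ⟨x, hxS, rfl⟩
      · exact ⟨y, hyS, rfl⟩
      · exact ⟨a, ha, eR a h⟩
  have hfin : R.Finite := (S.finite_toSet.subset fun a ha => ha.1).image _
  have n0 : orbitOf g x ∉ R := by
    rintro ⟨a, ⟨_, h⟩, e⟩
    exact h (orbitOf_eq_iff.1 e).symm
  have n1 : orbitOf g1 y ∉ R := by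
    rintro ⟨a, ⟨_, h⟩, e⟩
    rw [← eR a h, orbitOf_eq_iff] at e
    exact h (hy.trans (split_le hg hy hxy e.symm))
  have n2 : orbitOf g1 x ∉ insert (orbitOf g1 y) R := by
    rintro (e | ⟨a, ⟨_, h⟩, e⟩)
    · exact hns (orbitOf_eq_iff.1 e)
    · rw [← eR a h, orbitOf_eq_iff] at e
      exact h (split_le hg hy hxy e.symm)
  rw [e0, e1, Set.ncard_insert_of_notMem n2 (hfin.insert _), Set.ncard_insert_of_notMem n1 hfin,
    Set.ncard_insert_of_notMem n0 hfin]

/-! ### Cyclic order under inversion -/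

section Inverse

variable {S : Finset ℤ} {g : Perm ℤ}

/-- Exponent 0 is kept apart so that the exponent on the right stays below the period. -/
theorem HasPeriod.inv_pow {x : ℤ} {n : ℕ} (h : HasPeriod g x n) {i : ℕ} (hi : i < n) :
    (g⁻¹ ^ i) x = (g ^ (if i = 0 then 0 else n - i)) x := by
  split_ifs with h0
  · simp [h0]
  · rw [_root_.inv_pow, Perm.inv_eq_iff_eq, ← Perm.mul_apply, ← pow_add,
      Nat.add_sub_cancel' hi.le, h.pow_eq]

theorem HasPeriod.inv {x : ℤ} {n : ℕ} (h : HasPeriod g x n) : HasPeriod g⁻¹ x n := by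
  refine ⟨h.pos, ?_, ?_⟩
  · rw [_root_.inv_pow, Perm.inv_eq_iff_eq, h.pow_eq]
  · intro i hi j hj e
    rw [h.inv_pow hi, h.inv_pow hj] at e
    have := h.inj _ (by split_ifs <;> omega) _ (by split_ifs <;> omega) e
    split_ifs at this <;> omega

theorem HasPeriod.steps_inv {x : ℤ} {n : ℕ} (h : HasPeriod g x n) {z : ℤ}
    (hz : g.SameCycle x z) :
    steps g⁻¹ x z = if steps g x z = 0 then 0 else n - steps g x z := by
  obtain ⟨lz, ez⟩ := h.steps_lt hz
  have h0 := h.pos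
  have := h.inv.steps_pow (i := if steps g x z = 0 then 0 else n - steps g x z)
    (by split_ifs <;> omega)
  rw [h.inv_pow (by split_ifs <;> omega)] at this
  rwa [show (if (if steps g x z = 0 then 0 else n - steps g x z) = 0 then 0 else
    n - (if steps g x z = 0 then 0 else n - steps g x z)) = steps g x z by
      split_ifs <;> omega, ez] at this

theorem cycOrd_inv (hg : g ∈ permsOn S) {a b c : ℤ} : CycOrd g⁻¹ a b c ↔ CycOrd g a c b := by
  obtain ⟨n, h⟩ := exists_hasPeriod hg a
  simp only [CycOrd, sameCycle_inv]
  constructor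
  · rintro ⟨hb, hc, h1, h2⟩
    have lb := (h.steps_lt hb).1
    have lc := (h.steps_lt hc).1
    rw [h.steps_inv hb] at h1 h2
    rw [h.steps_inv hc] at h2
    refine ⟨hc, hb, ?_⟩
    split_ifs at h1 h2 <;> omega
  · rintro ⟨hc, hb, h1, h2⟩
    have lb := (h.steps_lt hb).1
    have lc := (h.steps_lt hc).1
    refine ⟨hb, hc, ?_⟩
    rw [h.steps_inv hb, h.steps_inv hc]
    split_ifs <;> omega

end Inverse

/-! ### Splitting by multiplication from the left -/

section LeftSplit

variable {S : Finset ℤ} {g : Perm ℤ} {x y : ℤ}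

/-- Inversion exchanges left and right multiplication, so every statement about left splitting is
inherited from right splitting of `g⁻¹`. -/
theorem swap_mul_eq (g : Perm ℤ) (x y : ℤ) : swap x y * g = (g⁻¹ * swap x y)⁻¹ := by
  simp

theorem lsplit_mem (hg : g ∈ permsOn S) (hy : g.SameCycle x y) (hxy : x ≠ y) :
    swap x y * g ∈ permsOn S := by
  rw [swap_mul_eq]
  exact inv_mem_permsOn (split_mem (inv_mem_permsOn hg) (sameCycle_inv.2 hy) hxy)

/-- `swap x y * g` splits the cycle `(x A y B)` of `g` into `(x A)` and `(y B)`. -/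
theorem lsplit_right (hg : g ∈ permsOn S) {b : ℤ} (h : CycOrd g x y b) :
    (swap x y * g).SameCycle y b := by
  rw [swap_mul_eq, sameCycle_inv]
  exact split_right (inv_mem_permsOn hg) ((cycOrd_inv hg).2 h)

theorem lsplit_sameCycle_of_not (hg : g ∈ permsOn S) (hy : g.SameCycle x y) (hxy : x ≠ y) {a : ℤ}
    (ha : ¬ g.SameCycle x a) (b : ℤ) :
    (swap x y * g).SameCycle a b ↔ g.SameCycle a b := by
  rw [swap_mul_eq, sameCycle_inv, split_sameCycle_of_not (inv_mem_permsOn hg)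
    (sameCycle_inv.2 hy) hxy (by rwa [sameCycle_inv]), sameCycle_inv]

theorem lsplit_or (hg : g ∈ permsOn S) (hy : g.SameCycle x y) (hxy : x ≠ y) {a : ℤ}
    (ha : g.SameCycle x a) :
    (swap x y * g).SameCycle x a ∨ (swap x y * g).SameCycle y a := by
  rw [swap_mul_eq, sameCycle_inv, sameCycle_inv]
  exact split_or (inv_mem_permsOn hg) (sameCycle_inv.2 hy) hxy (sameCycle_inv.2 ha)

theorem lsplit_le (hg : g ∈ permsOn S) (hy : g.SameCycle x y) (hxy : x ≠ y) {a b : ℤ}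
    (h : (swap x y * g).SameCycle a b) : g.SameCycle a b := by
  rw [swap_mul_eq, sameCycle_inv] at h
  exact sameCycle_inv.1 (split_le (inv_mem_permsOn hg) (sameCycle_inv.2 hy) hxy h)

theorem lsplit_cycOrd_iff (hg : g ∈ permsOn S) (hy : g.SameCycle x y) (hxy : x ≠ y) {a b c : ℤ}
    (hab : (swap x y * g).SameCycle a b) (hac : (swap x y * g).SameCycle a c) :
    CycOrd (swap x y * g) a b c ↔ CycOrd g a b c := by
  rw [swap_mul_eq, sameCycle_inv] at hab hac
  have hg' := inv_mem_permsOn hg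
  rw [swap_mul_eq, cycOrd_inv (split_mem hg' (sameCycle_inv.2 hy) hxy),
    split_cycOrd_iff hg' (sameCycle_inv.2 hy) hxy hac hab, cycOrd_inv hg]

theorem lsplit_cycOrd (hg : g ∈ permsOn S) (hy : g.SameCycle x y) (hxy : x ≠ y) {a b c : ℤ}
    (h : CycOrd (swap x y * g) a b c) : CycOrd g a b c :=
  (lsplit_cycOrd_iff hg hy hxy h.1 h.2.1).1 h

theorem numCycles_lsplit (hg : g ∈ permsOn S) (hy : g.SameCycle x y) (hxy : x ≠ y) :
    numCycles S (swap x y * g) = numCycles S g + 1 := by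
  rw [swap_mul_eq, numCycles_inv, numCycles_split (inv_mem_permsOn hg) (sameCycle_inv.2 hy) hxy,
    numCycles_inv]

theorem remove_fixed (g : Perm ℤ) (x : ℤ) : (swap x (g x) * g) x = x := by simp

/-- Splitting at `x` and its successor isolates `x`: the remaining elements of its cycle all end up
in the piece of `g x`. -/
theorem remove_sameCycle {a b : ℤ} (hg : g ∈ permsOn S) (hx : g x ≠ x) (ha : a ≠ x)
    (hb : b ≠ x) (h : g.SameCycle a b) : (swap x (g x) * g).SameCycle a b := by
  have hy : g.SameCycle x (g x) := ⟨1, by simp⟩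
  by_cases hxa : g.SameCycle x a
  · have aux : ∀ z, z ≠ x → g.SameCycle x z → (swap x (g x) * g).SameCycle (g x) z := by
      intro z hz hxz
      rcases lsplit_or hg hy hx.symm hxz with h' | h'
      · exact absurd (h'.eq_of_left (remove_fixed g x)).symm hz
      · exact h'
    exact (aux a ha hxa).symm.trans (aux b hb (hxa.trans h))
  · rwa [lsplit_sameCycle_of_not hg hy hx.symm hxa]

theorem not_cycOrd_apply (g : Perm ℤ) (x u : ℤ) : ¬ CycOrd g x u (g x) := by
  rintro ⟨_, _, h1, h2⟩
  have : steps g x (g x) ≤ 1 := Nat.sInf_le (by simp)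
  omega

end LeftSplit

/-! ### Merging two cycles by a transposition -/

section Merge

variable {S : Finset ℤ} {g : Perm ℤ} {x y : ℤ}

/-- From `x` the product jumps into the cycle of `y` and runs once around it, arriving at `y` after
a full period. -/
theorem merge_sameCycle (hg : g ∈ permsOn S) (h : ¬ g.SameCycle x y) :
    (g * swap x y).SameCycle x y := by
  obtain ⟨n, hn⟩ := exists_hasPeriod hg y
  have key : ∀ k, 0 < k → k ≤ n → ((g * swap x y) ^ k) x = (g ^ k) y := by
    intro k h0 hk
    induction k with
    | zero => omega
    | succ k ih =>
      rw [pow_succ', Perm.mul_apply]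
      rcases Nat.eq_zero_or_pos k with rfl | hk'
      · simp
      · rw [ih hk' (by omega), Perm.mul_apply, swap_apply_of_ne_of_ne, ← Perm.mul_apply,
          ← pow_succ']
        · intro e
          exact h (SameCycle.symm ⟨k, by rw [zpow_natCast, e]⟩)
        · intro e
          have := hn.inj k (by omega) 0 hn.pos (by simpa using e)
          omega
  exact ⟨n, by rw [zpow_natCast, key n hn.pos le_rfl, hn.pow_eq]⟩

/-- A second multiplication by the same transposition undoes the first, so merging is splitting read
backwards. -/
theorem numCycles_merge (hg : g ∈ permsOn S) (hx : x ∈ S) (hy : y ∈ S)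
    (h : ¬ g.SameCycle x y) : numCycles S (g * swap x y) + 1 = numCycles S g := by
  have h1 := numCycles_split (mul_swap_mem hg hx hy) (merge_sameCycle hg h)
    (fun e => h (e ▸ SameCycle.refl g x))
  rw [mul_swap_mul_self] at h1
  exact h1.symm

theorem numCycles_mul_swap_le (hg : g ∈ permsOn S) (hx : x ∈ S) (hy : y ∈ S) :
    numCycles S (g * swap x y) ≤ numCycles S g + 1 := by
  by_cases hxy : x = y
  · subst hxy; rw [swap_self]; exact Nat.le_succ _
  · by_cases h : g.SameCycle x y
    · exact (numCycles_split hg h hxy).le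
    · have := numCycles_merge hg hx hy h
      omega

end Merge

/-! ### The genus inequality and geodesics -/

section Geodesic

variable {S : Finset ℤ} {g p : Perm ℤ}

theorem mul_swap_mul_swap_mul (g p : Perm ℤ) (x y : ℤ) :
    (g * swap x y) * (swap x y * p) = g * p := by
  rw [mul_assoc, ← mul_assoc (swap x y), swap_mul_self, one_mul]

theorem exists_apply_ne (h : p ≠ 1) : ∃ x, p x ≠ x := by
  by_contra hc
  push Not at hc
  exact h (Equiv.ext hc)

theorem sameCycle_apply_self (g : Perm ℤ) (x : ℤ) : g.SameCycle x (g x) := ⟨1, by simp⟩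

/-- Induction on the distance of `p` from the identity. Moving a transposition from `p` to `g` keeps
the product, gains one cycle of `p` and changes the number of cycles of `g` by at most one. -/
theorem numCycles_add_le (hg : g ∈ permsOn S) (hp : p ∈ permsOn S) :
    numCycles S p + numCycles S (g * p) ≤ S.card + numCycles S g := by
  induction hk : S.card - numCycles S p generalizing g p with
  | zero =>
    -- A nontrivial `p` could still be split and so has fewer than |S| cycles, which excludes it
    -- here.
    by_cases h1 : p = 1
    · subst h1; rw [numCycles_one, mul_one]
    · obtain ⟨x, hx⟩ := exists_apply_ne h1
      have hy := sameCycle_apply_self p x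
      have := numCycles_lsplit hp hy hx.symm
      have := numCycles_le S (swap x (p x) * p)
      omega
  | succ k ih =>
    by_cases h1 : p = 1
    · subst h1; rw [numCycles_one, mul_one]
    · obtain ⟨x, hx⟩ := exists_apply_ne h1
      have hy := sameCycle_apply_self p x
      obtain ⟨hxS, hyS⟩ := mem_of_sameCycle_ne hp hy hx.symm
      have h2 := numCycles_lsplit hp hy hx.symm
      have := ih (mul_swap_mem hg hxS hyS) (lsplit_mem hp hy hx.symm) (by omega)
      rw [mul_swap_mul_swap_mul] at this
      have := numCycles_mul_swap_le hg hxS hyS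
      omega

/-- Equality in `numCycles_add_le`. -/
def Geodesic (S : Finset ℤ) (g p : Perm ℤ) : Prop :=
  numCycles S p + numCycles S (g * p) = S.card + numCycles S g

/-- If `x` and `y` lay on different cycles of `g`, moving the transposition would merge them, and
the inequality for the new pair would contradict equality for the old one. -/
theorem Geodesic.split (hg : g ∈ permsOn S) (hp : p ∈ permsOn S) (h : Geodesic S g p) {x y : ℤ}
    (hy : p.SameCycle x y) (hxy : x ≠ y) :
    g.SameCycle x y ∧ Geodesic S (g * swap x y) (swap x y * p) := by
  obtain ⟨hxS, hyS⟩ := mem_of_sameCycle_ne hp hy hxy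
  have h2 := numCycles_lsplit hp hy hxy
  have h3 := numCycles_add_le (mul_swap_mem hg hxS hyS) (lsplit_mem hp hy hxy)
  unfold Geodesic at *
  rw [mul_swap_mul_swap_mul] at *
  by_cases hs : g.SameCycle x y
  · have := numCycles_split hg hs hxy
    exact ⟨hs, by omega⟩
  · have := numCycles_merge hg hxS hyS hs
    omega

/-- Cutting at `a`, `b` leaves `b`, `c` together in `p` but puts `c` with `a` in `g`. A second
application of `Geodesic.split` then rejoins `a` and `b`, which the cut has separated. -/
theorem Geodesic.not_nonstandard (hg : g ∈ permsOn S) (hp : p ∈ permsOn S) (h : Geodesic S g p)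
    {a b c : ℤ} (h1 : CycOrd g a b c) (h2 : CycOrd p a b c) : False := by
  obtain ⟨hab, hac, hbc⟩ := h1.ne hg
  obtain ⟨hs, h'⟩ := h.split hg hp h2.1 hab
  have h3 := (h'.split (split_mem hg hs hab) (lsplit_mem hp h2.1 hab)
    (lsplit_right hp h2) hbc).1
  exact split_not_sameCycle hg hs hab ((split_left hg h1).trans h3.symm)

/-- Cutting at `a`, `c` separates `b` from `d` in `g`, while the cycle of `p` through `b` and `d`
survives. -/
theorem Geodesic.not_crossing (hg : g ∈ permsOn S) (hp : p ∈ permsOn S) (h : Geodesic S g p)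
    {a b c d : ℤ} (h1 : CycOrd g a b c) (h2 : CycOrd g a c d) (hac : p.SameCycle a c)
    (hbd : p.SameCycle b d) (hab : ¬ p.SameCycle a b) : False := by
  have nac := (h1.ne hg).2.1
  have nbd := ((h1.trans hg h2).1.ne hg).2.2
  obtain ⟨hs, h'⟩ := h.split hg hp hac nac
  have h3 := (h'.split (split_mem hg hs nac) (lsplit_mem hp hac nac)
    ((lsplit_sameCycle_of_not hp hac nac hab d).2 hbd) nbd).1
  exact split_not_sameCycle hg hs nac
    ((split_left hg h2).trans (h3.symm.trans (split_right hg h1).symm))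

/-- Induction by splitting off an element `x` moved by `p`. The absence of both configurations
guarantees that no cycle of the remaining permutation meets both pieces of the split cycle of `g`,
so the hypotheses are inherited. -/
theorem geodesic_of_noncrossing (hg : g ∈ permsOn S) (hp : p ∈ permsOn S)
    (h0 : ∀ x, g.SameCycle x (p x))
    (h1 : ∀ a b c, CycOrd g a b c → ¬ CycOrd p a b c)
    (h2 : ∀ a b c d, CycOrd g a b c → CycOrd g a c d → p.SameCycle a c → p.SameCycle b d →
      p.SameCycle a b) : Geodesic S g p := by
  induction hk : S.card - numCycles S p generalizing g p with
  | zero =>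
    by_cases h1 : p = 1
    · subst h1; unfold Geodesic; rw [numCycles_one, mul_one]
    · obtain ⟨x, hx⟩ := exists_apply_ne h1
      have hy := sameCycle_apply_self p x
      have := numCycles_lsplit hp hy hx.symm
      have := numCycles_le S (swap x (p x) * p)
      omega
  | succ k ih =>
    by_cases hp1 : p = 1
    · subst hp1; unfold Geodesic; rw [numCycles_one, mul_one]
    obtain ⟨x, hx⟩ := exists_apply_ne hp1
    have hy := sameCycle_apply_self p x
    have hgy := h0 x
    have hxy := hx.symm
    obtain ⟨hxS, hyS⟩ := mem_of_sameCycle_ne hp hy hx.symm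
    have h3 := numCycles_lsplit hp hy hxy
    have h4 := numCycles_split hg hgy hxy
    have hpf := remove_fixed p x
    -- A cycle through both pieces is impossible: if it comes from the cycle of `x` in `p`, then x,
    -- p x, u have the same orientation in `g` and `p`; otherwise the pair v, u crosses the pair x,
    -- p x.
    have aux : ∀ u v, u ≠ x → (g * swap x (p x)).SameCycle x u →
        (g * swap x (p x)).SameCycle (p x) v → (swap x (p x) * p).SameCycle u v → False := by
      intro u v hux hu hv huv
      have hns := split_not_sameCycle hg hgy hxy
      have o1 : CycOrd g x (p x) u := by
        rcases CycOrd.total hg hgy (split_le hg hgy hxy hu) hxy hux.symm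
          (by rintro rfl; exact hns hu) with h | h
        · exact h
        · exact absurd (hu.trans (split_right hg h).symm) hns
      have hpuv := lsplit_le hp hy hxy huv
      by_cases hpu : p.SameCycle x u
      · refine h1 _ _ _ o1 ?_
        rcases CycOrd.total hp hy hpu hxy hux.symm (o1.ne hg).2.2 with h | h
        · exact h
        · exact absurd h (not_cycOrd_apply p x u)
      · have hpv : ¬ p.SameCycle x v := fun h => hpu (h.trans hpuv.symm)
        have hvx : x ≠ v := by rintro rfl; exact hpv (SameCycle.refl _ _)
        have hvy : p x ≠ v := by rintro rfl; exact hpv hy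
        have o2 : CycOrd g x v (p x) := by
          rcases CycOrd.total hg hgy (hgy.trans (split_le hg hgy hxy hv)) hxy hvx hvy with h | h
          · exact absurd ((split_left hg h).trans hv.symm) hns
          · exact h
        exact hpv (h2 _ _ _ _ o2 o1 hy hpuv.symm)
    have := ih (g := g * swap x (p x)) (p := swap x (p x) * p)
      (mul_swap_mem hg hxS hyS) (lsplit_mem hp hy hxy) ?_ ?_ ?_ (by omega)
    · unfold Geodesic at *
      rw [mul_swap_mul_swap_mul] at this
      omega
    · intro z
      set w := (swap x (p x) * p) z with hw
      have hzw : (swap x (p x) * p).SameCycle z w := sameCycle_apply_self _ _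
      have hgw : g.SameCycle z w := by
        have hpz := h0 z
        rw [hw, Perm.mul_apply]
        by_cases e1 : p z = x
        · rw [e1, swap_apply_left]; rw [e1] at hpz; exact hpz.trans hgy
        · by_cases e2 : p z = p x
          · rw [e2, swap_apply_right]; rw [e2] at hpz; exact hpz.trans hgy.symm
          · rwa [swap_apply_of_ne_of_ne e1 e2]
      by_cases hz : z = x
      · have : w = x := by rw [hw, hz, hpf]
        rw [this, hz]
      have hwx : w ≠ x := by
        intro e
        rw [e] at hzw
        exact hz (hzw.symm.eq_of_left hpf).symm
      by_cases hxz : g.SameCycle x z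
      · rcases split_or hg hgy hxy hxz with a1 | a1 <;>
          rcases split_or hg hgy hxy (hxz.trans hgw) with a2 | a2
        · exact a1.symm.trans a2
        · exact (aux z w hz a1 a2 hzw).elim
        · exact (aux w z hwx a2 a1 hzw.symm).elim
        · exact a1.symm.trans a2
      · exact (split_sameCycle_of_not hg hgy hxy hxz w).2 hgw
    · intro a b c o1 o2
      exact h1 a b c (split_cycOrd hg hgy hxy o1) (lsplit_cycOrd hp hy hxy o2)
    · intro a b c d o1 o2 hac hbd
      have o1' := split_cycOrd hg hgy hxy o1
      have o2' := split_cycOrd hg hgy hxy o2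
      have := h2 a b c d o1' o2' (lsplit_le hp hy hxy hac) (lsplit_le hp hy hxy hbd)
      have hax : a ≠ x := by
        rintro rfl
        exact (o1'.ne hg).2.1 (hac.eq_of_left hpf)
      have hbx : b ≠ x := by
        rintro rfl
        exact ((o1'.trans hg o2').2.ne hg).2.1 (hbd.eq_of_left hpf)
      exact remove_sameCycle hp hx hax hbx this

end Geodesic

/-! ### The genus inequality for connected pairs -/

/-- No proper nonempty subset of `S` is invariant under both `g` and `p`. -/
def Connected (S : Finset ℤ) (g p : Perm ℤ) : Prop :=
  ∀ T ⊆ S, T.Nonempty → (∀ k ∈ T, g k ∈ T ∧ p k ∈ T) → T = S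

section Connected

variable {S : Finset ℤ} {g p : Perm ℤ}

/-- If `p` never left a cycle of `g`, a single cycle of `g` would be an invariant set, hence
everything. -/
theorem Connected.exists_link (hg : g ∈ permsOn S) (hp : p ∈ permsOn S) (h : Connected S g p)
    (hc : numCycles S g ≠ 1) (hS : S.Nonempty) : ∃ x ∈ S, ¬ g.SameCycle x (p x) := by
  classical
  by_contra hcon
  push Not at hcon
  obtain ⟨s, hs⟩ := hS
  have hT := h (S.filter fun k => g.SameCycle s k) (Finset.filter_subset _ _)
    ⟨s, by simp [hs, SameCycle.refl]⟩ (by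
      intro k hk
      rw [Finset.mem_filter] at hk
      rw [Finset.mem_filter, Finset.mem_filter]
      exact ⟨⟨apply_mem_of_permsOn hg hk.1, hk.2.trans (sameCycle_apply_self g k)⟩,
        apply_mem_of_permsOn hp hk.1, hk.2.trans (hcon k hk.1)⟩)
  apply hc
  rw [numCycles_eq_image, Set.ncard_eq_one]
  refine ⟨orbitOf g s, ?_⟩
  ext C
  constructor
  · rintro ⟨a, ha, rfl⟩
    have : a ∈ S.filter fun k => g.SameCycle s k := by rw [hT]; exact ha
    rw [Finset.mem_filter] at this
    exact orbitOf_eq_iff.2 this.2.symm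
  · rintro rfl
    exact ⟨s, hs, rfl⟩

theorem numCycles_pos (hS : S.Nonempty) (g : Perm ℤ) : 0 < numCycles S g := by
  obtain ⟨s, hs⟩ := hS
  rw [numCycles_eq_image, Set.ncard_pos (finite_orbits S g)]
  exact ⟨_, s, hs, rfl⟩

theorem pow_mem_of_invariant {T : Finset ℤ} (hT : ∀ k ∈ T, g k ∈ T) (n : ℕ) {k : ℤ} (hk : k ∈ T) :
    (g ^ n) k ∈ T := by
  induction n with
  | zero => exact hk
  | succ n ih => rw [pow_succ', Perm.mul_apply]; exact hT _ ih

theorem mem_of_sameCycle_invariant (hg : g ∈ permsOn S) {T : Finset ℤ} (hT : ∀ k ∈ T, g k ∈ T)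
    {a b : ℤ} (h : g.SameCycle a b) (ha : a ∈ T) : b ∈ T := by
  obtain ⟨k, rfl⟩ := (sameCycle_iff_exists_pow hg).1 h
  exact pow_mem_of_invariant hT k ha

/-- Induction on the number of cycles of `g`: at a link the cycles of `g` are merged and `p` is
split, so the sum is unchanged. With one cycle left, `numCycles_add_le` is the claim. -/
theorem numCycles_add_le_of_connected (hg : g ∈ permsOn S) (hp : p ∈ permsOn S)
    (hS : S.Nonempty) (h : Connected S g p) :
    numCycles S g + numCycles S p + numCycles S (g * p) ≤ S.card + 2 := by
  induction hk : numCycles S g generalizing g p with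
  | zero => exact absurd hk (numCycles_pos hS g).ne'
  | succ k ih =>
    by_cases h1 : k = 0
    · have := numCycles_add_le hg hp
      omega
    obtain ⟨x, hxS, hx⟩ := h.exists_link hg hp (by omega) hS
    have hxy : x ≠ p x := by intro e; rw [← e] at hx; exact hx (SameCycle.refl _ _)
    have hy := sameCycle_apply_self p x
    have hyS := apply_mem_of_permsOn hp hxS
    have h2 := numCycles_lsplit hp hy hxy
    have h3 := numCycles_merge hg hxS hyS hx
    have hm := mul_swap_mem hg hxS hyS
    have := ih hm (lsplit_mem hp hy hxy) ?_ (by omega)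
    · rw [mul_swap_mul_swap_mul] at this
      omega
    intro T hTS hT0 hT
    -- Connectedness survives the move: `x` and `p x` share a cycle after merging, so a set
    -- invariant under the new pair is invariant under the transposition and hence under the old
    -- pair.
    have hTg := fun k hk => (hT k hk).1
    have hiff : x ∈ T ↔ p x ∈ T :=
      ⟨mem_of_sameCycle_invariant hm hTg (merge_sameCycle hg hx),
        mem_of_sameCycle_invariant hm hTg (merge_sameCycle hg hx).symm⟩
    have key : ∀ z, swap x (p x) z ∈ T ↔ z ∈ T := by
      intro z
      by_cases e1 : z = x
      · rw [e1, swap_apply_left, hiff]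
      · by_cases e2 : z = p x
        · rw [e2, swap_apply_right, hiff]
        · rw [swap_apply_of_ne_of_ne e1 e2]
    refine h T hTS hT0 fun z hz => ⟨?_, ?_⟩
    · have := (hT _ ((key z).2 hz)).1
      simpa using this
    · have := (hT z hz).2
      rwa [Perm.mul_apply, key] at this

end Connected

/-! ### Cyclic order after merging two cycles -/

section MergeOrder

variable {S : Finset ℤ} {g : Perm ℤ} {x y : ℤ}

theorem ne_of_not_sameCycle {a b : ℤ} (h : ¬ g.SameCycle a b) : a ≠ b := by
  rintro rfl; exact h (SameCycle.refl _ _)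

theorem merge_cycOrd_iff (hg : g ∈ permsOn S) (hx : x ∈ S) (hy : y ∈ S) (h : ¬ g.SameCycle x y)
    {a b c : ℤ} (hab : g.SameCycle a b) (hac : g.SameCycle a c) :
    CycOrd (g * swap x y) a b c ↔ CycOrd g a b c := by
  have := split_cycOrd_iff (mul_swap_mem hg hx hy) (merge_sameCycle hg h) (ne_of_not_sameCycle h)
    (a := a) (b := b) (c := c) (by rwa [mul_swap_mul_self]) (by rwa [mul_swap_mul_self])
  rw [mul_swap_mul_self] at this
  exact this.symm

theorem merge_le (hg : g ∈ permsOn S) (hx : x ∈ S) (hy : y ∈ S) (h : ¬ g.SameCycle x y)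
    {a b : ℤ} (hab : g.SameCycle a b) : (g * swap x y).SameCycle a b := by
  refine split_le (mul_swap_mem hg hx hy) (merge_sameCycle hg h) (ne_of_not_sameCycle h) ?_
  rwa [mul_swap_mul_self]

/-- `g * swap x y` merges the cycles `(x A)` and `(y B)` of `g` into `(x B y A)`. -/
theorem merge_left (hg : g ∈ permsOn S) (hx : x ∈ S) (hy : y ∈ S) (h : ¬ g.SameCycle x y)
    {a : ℤ} (ha : g.SameCycle x a) (hax : a ≠ x) : CycOrd (g * swap x y) x y a := by
  have hG := mul_swap_mem hg hx hy
  have hxy := ne_of_not_sameCycle h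
  rcases CycOrd.total hG (merge_sameCycle hg h) (merge_le hg hx hy h ha) hxy hax.symm
    (by rintro rfl; exact h ha) with h' | h'
  · exact h'
  · have := split_right hG h'
    rw [mul_swap_mul_self] at this
    exact absurd (ha.trans this.symm) h

theorem merge_right (hg : g ∈ permsOn S) (hx : x ∈ S) (hy : y ∈ S) (h : ¬ g.SameCycle x y)
    {a : ℤ} (ha : g.SameCycle y a) (hay : a ≠ y) : CycOrd (g * swap x y) x a y := by
  have hG := mul_swap_mem hg hx hy
  have hxy := ne_of_not_sameCycle h
  rcases CycOrd.total hG (merge_sameCycle hg h)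
    ((merge_sameCycle hg h).trans (merge_le hg hx hy h ha)) hxy
    (by rintro rfl; exact h ha.symm) hay.symm with h' | h'
  · have := split_left hG h'
    rw [mul_swap_mul_self] at this
    exact absurd (this.trans ha.symm) h
  · exact h'

theorem sameCycle_or_of_numCycles_eq_two (h2 : numCycles S g = 2) {z : ℤ} (hx : x ∈ S)
    (hy : y ∈ S) (hz : z ∈ S) (h : ¬ g.SameCycle x y) : g.SameCycle x z ∨ g.SameCycle y z := by
  rw [numCycles_eq_image, Set.ncard_eq_two] at h2
  obtain ⟨A, B, _, e⟩ := h2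
  have mem : ∀ k ∈ S, orbitOf g k = A ∨ orbitOf g k = B := by
    intro k hk
    have : orbitOf g k ∈ orbitOf g '' (S : Set ℤ) := ⟨k, hk, rfl⟩
    rw [e] at this
    exact this
  rw [← orbitOf_eq_iff] at h
  rw [← orbitOf_eq_iff, ← orbitOf_eq_iff]
  rcases mem x hx with h1 | h1 <;> rcases mem y hy with h2 | h2 <;> rcases mem z hz with h3 | h3 <;>
    simp_all

end MergeOrder

/-! ### Annular noncrossing permutations and the genus -/

/-- The five forbidden configurations of an annular noncrossing permutation, in terms of the cyclic
orders of `g` and `p`. -/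
inductive Forbidden (g p : Perm ℤ) : Prop
  | nonstd_three {a b c : ℤ} : CycOrd g a b c → CycOrd p a b c → Forbidden g p
  | nonstd_four {a b c d : ℤ} : g.SameCycle a b → g.SameCycle c d → ¬ g.SameCycle a c →
      CycOrd p a c b → CycOrd p a b d → Forbidden g p
  | cross_four {a b c d : ℤ} : CycOrd g a b c → CycOrd g a c d → p.SameCycle a c →
      p.SameCycle b d → ¬ p.SameCycle a b → Forbidden g p
  | cross_five {x y a b c : ℤ} : ¬ g.SameCycle x y → CycOrd (g * swap x y) a b c →
      CycOrd p a b c → p.SameCycle x y → ¬ p.SameCycle x a → Forbidden g p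
  | cross_six {x y a b c d : ℤ} : ¬ g.SameCycle x y → CycOrd (g * swap x y) a b c →
      CycOrd (g * swap x y) a c d → p.SameCycle a c → p.SameCycle b d → p.SameCycle x y →
      ¬ p.SameCycle a b → ¬ p.SameCycle x a → ¬ p.SameCycle x b → Forbidden g p

section Annular

variable {S : Finset ℤ} {g p : Perm ℤ}

/-- Cutting the annulus along a link: `g` goes from two cycles to one, `p` gains one, and the
product is the same. -/
theorem geodesic_merge_iff (hg : g ∈ permsOn S) (hp : p ∈ permsOn S) (h2 : numCycles S g = 2)
    {x y : ℤ} (hx : ¬ g.SameCycle x y) (hy : p.SameCycle x y) :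
    Geodesic S (g * swap x y) (swap x y * p) ↔
      numCycles S p + numCycles S (g * p) = S.card := by
  have hxy := ne_of_not_sameCycle hx
  obtain ⟨hxS, hyS⟩ := mem_of_sameCycle_ne hp hy hxy
  have h3 := numCycles_merge hg hxS hyS hx
  have h4 := numCycles_lsplit hp hy hxy
  unfold Geodesic
  rw [mul_swap_mul_swap_mul]
  omega

/-- There is a step of `p` between the two cycles of `g`; following the cycle of `p` through it,
there must also be a step in the opposite direction, so each cycle of `g` is entered. -/
theorem exists_entry (hg2 : numCycles S g = 2) (hp : p ∈ permsOn S)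
    (hlink : ∃ x ∈ S, ¬ g.SameCycle x (p x)) {a : ℤ} (ha : a ∈ S) :
    ∃ x, ¬ g.SameCycle a x ∧ g.SameCycle a (p x) := by
  obtain ⟨x, hx, hl⟩ := hlink
  by_contra hcon
  push Not at hcon
  have hpx := apply_mem_of_permsOn hp hx
  have hax : g.SameCycle a x := by
    rcases sameCycle_or_of_numCycles_eq_two hg2 hx hpx ha hl with h | h
    · exact h.symm
    · by_contra h'
      exact hcon x h' h.symm
  have hpow : ∀ k : ℕ, ¬ g.SameCycle a ((p ^ k) (p x)) := by
    intro k
    induction k with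
    | zero => exact fun h => hl (hax.symm.trans h)
    | succ k ih => rw [pow_succ', Perm.mul_apply]; exact hcon _ ih
  obtain ⟨k, hk⟩ := (sameCycle_iff_exists_pow hp).1 (sameCycle_apply_self p x).symm
  exact hpow k (by rwa [hk])

/-- In each pattern a link is chosen along which the annulus is cut so that the pattern becomes an
equally oriented triple or a crossing in the disc. -/
theorem not_forbidden_of_planar (hg : g ∈ permsOn S) (hp : p ∈ permsOn S)
    (h2 : numCycles S g = 2) (hlink : ∃ x ∈ S, ¬ g.SameCycle x (p x))
    (hpl : numCycles S p + numCycles S (g * p) = S.card) : ¬ Forbidden g p := by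
  rintro (⟨o1, o2⟩ | ⟨hab, hcd, hac, o1, o2⟩ | ⟨o1, o2, hac, hbd, hab⟩ | ⟨hxy, o1, o2, hy, hxa⟩ |
    ⟨hxy, o1, o2, hac, hbd, hy, hab, hxa, hxb⟩)
  · rename_i a b c
    have haS := (mem_of_sameCycle_ne hg o1.1 (o1.ne hg).1).1
    -- The link starts in the other cycle of `g`, so the element `x` isolated by the cut is none of
    -- `a`, `b`, `c`.
    obtain ⟨x, hx, hpx⟩ := exists_entry h2 hp hlink haS
    have hxy : ¬ g.SameCycle x (p x) := fun h => hx (hpx.trans h.symm)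
    have hy := sameCycle_apply_self p x
    have hne := ne_of_not_sameCycle hxy
    obtain ⟨hxS, hyS⟩ := mem_of_sameCycle_ne hp hy hne
    have hG := (geodesic_merge_iff hg hp h2 hxy hy).2 hpl
    have hax : a ≠ x := ne_of_not_sameCycle hx
    have hbx : b ≠ x := by rintro rfl; exact hx o1.1
    have hcx : c ≠ x := by rintro rfl; exact hx o1.2.1
    exact hG.not_nonstandard (mul_swap_mem hg hxS hyS) (lsplit_mem hp hy hne)
      ((merge_cycOrd_iff hg hxS hyS hxy o1.1 o1.2.1).2 o1)
      ((lsplit_cycOrd_iff hp hy hne (remove_sameCycle hp hne.symm hax hbx o2.1)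
        (remove_sameCycle hp hne.symm hax hcx o2.2.1)).2 o2)
  · rename_i a b c d
    have hy := o1.1
    have hne := ne_of_not_sameCycle hac
    obtain ⟨hxS, hyS⟩ := mem_of_sameCycle_ne hp hy hne
    have hG := (geodesic_merge_iff hg hp h2 hac hy).2 hpl
    have t := o1.trans hp o2
    have hba : b ≠ a := (o1.ne hp).2.1.symm
    have hdc : d ≠ c := (t.1.ne hp).2.2.symm
    have m1 := merge_left hg hxS hyS hac hab hba
    have m2 := merge_right hg hxS hyS hac hcd hdc
    have hm := mul_swap_mem hg hxS hyS
    -- The cut along `a`, `c` arranges the four points as a, d, c, b on the merged cycle, while `p`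
    -- runs through a, c, b, d; hence c, b, d is a common triple.
    exact hG.not_nonstandard hm (lsplit_mem hp hy hne)
      (((m2.trans hm m1).2).rotate hm)
      ((lsplit_cycOrd_iff hp hy hne (lsplit_right hp o1) (lsplit_right hp t.1)).2 t.2)
  · rename_i a b c d
    have haS := (mem_of_sameCycle_ne hg o1.1 (o1.ne hg).1).1
    obtain ⟨x, hx, hpx⟩ := exists_entry h2 hp hlink haS
    have hxy : ¬ g.SameCycle x (p x) := fun h => hx (hpx.trans h.symm)
    have hy := sameCycle_apply_self p x
    have hne := ne_of_not_sameCycle hxy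
    obtain ⟨hxS, hyS⟩ := mem_of_sameCycle_ne hp hy hne
    have hG := (geodesic_merge_iff hg hp h2 hxy hy).2 hpl
    have hax : a ≠ x := ne_of_not_sameCycle hx
    have hbx : b ≠ x := by rintro rfl; exact hx o1.1
    have hcx : c ≠ x := by rintro rfl; exact hx o1.2.1
    have hdx : d ≠ x := by rintro rfl; exact hx o2.2.1
    exact hG.not_crossing (mul_swap_mem hg hxS hyS) (lsplit_mem hp hy hne)
      ((merge_cycOrd_iff hg hxS hyS hxy o1.1 o1.2.1).2 o1)
      ((merge_cycOrd_iff hg hxS hyS hxy o2.1 o2.2.1).2 o2)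
      (remove_sameCycle hp hne.symm hax hcx hac) (remove_sameCycle hp hne.symm hbx hdx hbd)
      fun h => hab (lsplit_le hp hy hne h)
  · rename_i x y a b c
    have hne := ne_of_not_sameCycle hxy
    obtain ⟨hxS, hyS⟩ := mem_of_sameCycle_ne hp hy hne
    have hG := (geodesic_merge_iff hg hp h2 hxy hy).2 hpl
    exact hG.not_nonstandard (mul_swap_mem hg hxS hyS) (lsplit_mem hp hy hne) o1
      ((lsplit_cycOrd_iff hp hy hne ((lsplit_sameCycle_of_not hp hy hne hxa _).2 o2.1)
        ((lsplit_sameCycle_of_not hp hy hne hxa _).2 o2.2.1)).2 o2)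
  · rename_i x y a b c d
    have hne := ne_of_not_sameCycle hxy
    obtain ⟨hxS, hyS⟩ := mem_of_sameCycle_ne hp hy hne
    have hG := (geodesic_merge_iff hg hp h2 hxy hy).2 hpl
    exact hG.not_crossing (mul_swap_mem hg hxS hyS) (lsplit_mem hp hy hne) o1 o2
      ((lsplit_sameCycle_of_not hp hy hne hxa _).2 hac)
      ((lsplit_sameCycle_of_not hp hy hne hxb _).2 hbd)
      fun h => hab (lsplit_le hp hy hne h)

/-- A common cyclic triple can be chosen to contain a given element of the cycles. -/
theorem exists_common_triple {G Q : Perm ℤ} (hG : G ∈ permsOn S) (hQ : Q ∈ permsOn S)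
    {a b c y : ℤ} (o1 : CycOrd G a b c) (o2 : CycOrd Q a b c) (h1 : G.SameCycle y a)
    (h2 : Q.SameCycle y a) : ∃ b' c', CycOrd G y b' c' ∧ CycOrd Q y b' c' := by
  by_cases ea : y = a
  · subst ea; exact ⟨b, c, o1, o2⟩
  by_cases eb : y = b
  · subst eb; exact ⟨c, a, o1.rotate hG, o2.rotate hQ⟩
  by_cases ec : y = c
  · subst ec; exact ⟨a, b, (o1.rotate hG).rotate hG, (o2.rotate hQ).rotate hQ⟩
  have key : ∀ H : Perm ℤ, H ∈ permsOn S → CycOrd H a b c → H.SameCycle y a →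
      (CycOrd H y a b ∧ CycOrd H y b c) ∨ (CycOrd H y b c ∧ CycOrd H y c a) ∨
        (CycOrd H y c a ∧ CycOrd H y a b) := by
    intro H hH o ha
    obtain ⟨q, q0, qi, hq⟩ := exists_coord hH y
    have hy := SameCycle.refl H y
    have hb := ha.trans o.1
    have hc := ha.trans o.2.1
    have na : q y ≠ q a := fun e => ea (qi _ _ hy ha e)
    have nb : q y ≠ q b := fun e => eb (qi _ _ hy hb e)
    have nc : q y ≠ q c := fun e => ec (qi _ _ hy hc e)
    rw [hq _ _ _ ha hb hc] at o
    rw [hq _ _ _ hy ha hb, hq _ _ _ hy hb hc, hq _ _ _ hy hc ha]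
    omega
  have kG := key G hG o1 h1
  have kQ := key Q hQ o2 h2
  -- Each of the two orders satisfies two of the three relations, so at least one relation is common
  -- to both.
  by_cases c1 : CycOrd G y a b ∧ CycOrd Q y a b
  · exact ⟨_, _, c1⟩
  by_cases c2 : CycOrd G y b c ∧ CycOrd Q y b c
  · exact ⟨_, _, c2⟩
  by_cases c3 : CycOrd G y c a ∧ CycOrd Q y c a
  · exact ⟨_, _, c3⟩
  tauto

/-- In `g * swap x y` the element `y` is followed by the cycle of `x`, then by that of `y`. -/
theorem merge_mono (hg : g ∈ permsOn S) {x y : ℤ} (hx : x ∈ S) (hy : y ∈ S)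
    (h : ¬ g.SameCycle x y) {b c : ℤ} (o : CycOrd (g * swap x y) y b c) (hb : g.SameCycle y b)
    (hc : g.SameCycle x c) (hcx : c ≠ x) : False := by
  have hG := mul_swap_mem hg hx hy
  have m1 := merge_left hg hx hy h hc hcx
  have m2 := merge_right hg hx hy h hb (o.ne hG).1.symm
  exact o.not_flip hG ((m2.trans hG m1).2.rotate hG)

/-- A three-element configuration at `y = p x` after merging comes from a forbidden one. -/
theorem forbidden_of_merged_triple (hg : g ∈ permsOn S) (hp : p ∈ permsOn S)
    (h2 : numCycles S g = 2) {x : ℤ} (hx : ¬ g.SameCycle x (p x)) {b c : ℤ}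
    (o1 : CycOrd (g * swap x (p x)) (p x) b c) (o2 : CycOrd p (p x) b c) (hbx : b ≠ x)
    (hcx : c ≠ x) : Forbidden g p := by
  have hy := sameCycle_apply_self p x
  have hne := ne_of_not_sameCycle hx
  obtain ⟨hxS, hyS⟩ := mem_of_sameCycle_ne hp hy hne
  have hG := mul_swap_mem hg hxS hyS
  have hbS := mem_of_sameCycle hp o2.1 hyS
  have hcS := mem_of_sameCycle hp o2.2.1 hyS
  have after : ∀ z, p.SameCycle (p x) z → z ≠ x → z ≠ p x → CycOrd p x (p x) z := by
    intro z hz h1 h2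
    rcases CycOrd.total hp hy (hy.trans hz) hne h1.symm h2.symm with h | h
    · exact h
    · exact absurd h (not_cycOrd_apply p x z)
  have pb := after b o2.1 hbx (o2.ne hp).1.symm
  have pc := after c o2.2.1 hcx (o2.ne hp).2.1.symm
  have pbc : CycOrd p x b c :=
    ((o2.trans hp (pc.rotate hp)).2.rotate hp).rotate hp
  -- The cases are the positions of `b` and `c` on the cycles of `g`. Both with `x`: x, b, c is a
  -- common triple. Only `b` with `x`: the pattern on both cycles occurs. Only `c` with `x`:
  -- excluded by the merged order. Both with `p x`: the triple itself.
  rcases sameCycle_or_of_numCycles_eq_two h2 hxS hyS hbS hx with gb | gb <;>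
    rcases sameCycle_or_of_numCycles_eq_two h2 hxS hyS hcS hx with gc | gc
  · have m := merge_left hg hxS hyS hx gc hcx
    have t := (o1.trans hG (m.rotate hG)).2
    exact .nonstd_three ((merge_cycOrd_iff hg hxS hyS hx gb gc).1
      ((t.rotate hG).rotate hG)) pbc
  · exact .nonstd_four gb gc hx pb pbc
  · exact (merge_mono hg hxS hyS hx o1 gb gc hcx).elim
  · exact .nonstd_three ((merge_cycOrd_iff hg hxS hyS hx gb gc).1 o1) o2

/-- A four-element configuration at `y = p x` after merging comes from a forbidden one. -/
theorem forbidden_of_merged_quadruple (hg : g ∈ permsOn S) (hp : p ∈ permsOn S)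
    (h2 : numCycles S g = 2) {x : ℤ} (hx : ¬ g.SameCycle x (p x)) {b c d : ℤ}
    (o1 : CycOrd (g * swap x (p x)) (p x) b c) (o2 : CycOrd (g * swap x (p x)) (p x) c d)
    (pc : p.SameCycle (p x) c) (pbd : p.SameCycle b d) (pb : ¬ p.SameCycle (p x) b)
    (hcx : c ≠ x) : Forbidden g p := by
  have hy := sameCycle_apply_self p x
  have hne := ne_of_not_sameCycle hx
  obtain ⟨hxS, hyS⟩ := mem_of_sameCycle_ne hp hy hne
  have hG := mul_swap_mem hg hxS hyS
  have o3 := o1.trans hG o2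
  have hbd := (o3.2.ne hG).2.1
  obtain ⟨hbS, hdS⟩ := mem_of_sameCycle_ne hp pbd hbd
  have hcS := mem_of_sameCycle hp pc hyS
  have hbx : b ≠ x := by rintro rfl; exact pb hy.symm
  have hdx : d ≠ x := by rintro rfl; exact pb (hy.symm.trans pbd.symm)
  have hcy := (o1.ne hG).2.1.symm
  have pxyc : CycOrd p x (p x) c := by
    rcases CycOrd.total hp hy (hy.trans pc) hne hcx.symm hcy.symm with h | h
    · exact h
    · exact absurd h (not_cycOrd_apply p x c)
  have pbx : ¬ p.SameCycle b x := fun h => pb (hy.symm.trans h.symm)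
  rcases sameCycle_or_of_numCycles_eq_two h2 hxS hyS hbS hx with gb | gb
  · rcases sameCycle_or_of_numCycles_eq_two h2 hxS hyS hdS hx with gd | gd
    · rcases sameCycle_or_of_numCycles_eq_two h2 hxS hyS hcS hx with gc | gc
      · have ord : ∀ u v, g.SameCycle x u → g.SameCycle x v → v ≠ x →
            CycOrd (g * swap x (p x)) (p x) u v → CycOrd g x u v := by
          intro u v gu gv hv o
          have t := (o.trans hG ((merge_left hg hxS hyS hx gv hv).rotate hG)).2
          exact (merge_cycOrd_iff hg hxS hyS hx gu gv).1 ((t.rotate hG).rotate hG)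
        -- On the cycle of `x`, the element `x` can replace `p x`: it is on the same cycle of `p`
        -- and in the same cyclic position relative to b, c, d.
        exact .cross_four (ord b c gb gc hcx o1) (ord c d gc gd hdx o2) (hy.trans pc) pbd
          fun h => pb (hy.symm.trans h)
      · exact (merge_mono hg hxS hyS hx o2 gc gd hdx).elim
    -- Here `b`, `d` is itself a link between the cycles of `g`. The annulus is cut along it instead
    -- of along x, p x, and the triple x, p x, c becomes equally oriented.
    · have hbd' : ¬ g.SameCycle b d := fun h => hx (gb.trans (h.trans gd.symm))
      have hK := mul_swap_mem hg hbS hdS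
      have bx := merge_left hg hbS hdS hbd' gb.symm hbx.symm
      have by' := merge_right hg hbS hdS hbd' gd.symm (o2.ne hG).2.1
      have key : CycOrd (g * swap b d) x (p x) c := by
        -- Counted from `b`, the cycle of `d` precedes `d` and the rest of the cycle of `b` follows
        -- it. So `p x` comes before `d` and `x` after; `c` falls between `p x` and `d`, or between
        -- `d` and `x`.
        obtain ⟨q, q0, qi, hq⟩ := exists_coord hK b
        have sb := SameCycle.refl (g * swap b d) b
        rw [hq _ _ _ sb bx.1 bx.2.1] at bx
        have sd := by'.2.1
        have sx := (merge_sameCycle hg hbd').trans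
          ((merge_sameCycle hg hbd').symm.trans (merge_le hg hbS hdS hbd' gb.symm))
        have sy := by'.1
        rw [hq _ _ _ sb sy sd] at by'
        rcases sameCycle_or_of_numCycles_eq_two h2 hxS hyS hcS hx with gc | gc
        · have t := (o1.trans hG ((merge_left hg hxS hyS hx gc hcx).rotate hG)).2
          have t1 := (merge_cycOrd_iff hg hxS hyS hx gb gc).1 ((t.rotate hG).rotate hG)
          have t2 := (merge_cycOrd_iff hg hbS hdS hbd' gb gc).2 t1
          have sc := sx.trans t2.2.1
          have bc := merge_left hg hbS hdS hbd' (gb.symm.trans gc) (o1.ne hG).2.2.symm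
          rw [hq _ _ _ sb sd sc] at bc
          rw [hq _ _ _ sx sb sc] at t2
          rw [hq _ _ _ sx sy sc]
          omega
        · have t1 := (merge_cycOrd_iff hg hxS hyS hx gc gd).1 o2
          have t2 := (merge_cycOrd_iff hg hbS hdS hbd' gc gd).2 t1
          have sc := sy.trans t2.1
          rw [hq _ _ _ sy sc sd] at t2
          rw [hq _ _ _ sx sy sc]
          omega
      exact .cross_five hbd' key pxyc pbd pbx
  · rcases sameCycle_or_of_numCycles_eq_two h2 hxS hyS hcS hx with gc | gc
    · exact (merge_mono hg hxS hyS hx o1 gb gc hcx).elim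
    · rcases sameCycle_or_of_numCycles_eq_two h2 hxS hyS hdS hx with gd | gd
      · exact (merge_mono hg hxS hyS hx o2 gc gd hdx).elim
      · exact .cross_four ((merge_cycOrd_iff hg hxS hyS hx gb gc).1 o1)
          ((merge_cycOrd_iff hg hxS hyS hx gc gd).1 o2) pc pbd pb

/-- After cutting along a link x, p x it suffices to exclude triples and crossings in the disc.
Those away from the cycle of `x` in `p` are the patterns with a transversal pair. The others can be
moved so that `p x` is one of their elements, and then come from a pattern of the annulus. -/
theorem planar_of_not_forbidden (hg : g ∈ permsOn S) (hp : p ∈ permsOn S)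
    (h2 : numCycles S g = 2) (hlink : ∃ x ∈ S, ¬ g.SameCycle x (p x))
    (hf : ¬ Forbidden g p) : numCycles S p + numCycles S (g * p) = S.card := by
  obtain ⟨x, hxS, hx⟩ := hlink
  have hy := sameCycle_apply_self p x
  have hne := ne_of_not_sameCycle hx
  have hyS := apply_mem_of_permsOn hp hxS
  have hG := mul_swap_mem hg hxS hyS
  have hQ := lsplit_mem hp hy hne
  have hQx := remove_fixed p x
  have hGall : ∀ z ∈ S, (g * swap x (p x)).SameCycle (p x) z := by
    intro z hz
    have hm := merge_sameCycle hg hx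
    rcases sameCycle_or_of_numCycles_eq_two h2 hxS hyS hz hx with h | h
    · exact hm.symm.trans (merge_le hg hxS hyS hx h)
    · exact merge_le hg hxS hyS hx h
  have hxfix : ∀ u v, u ≠ v → (swap x (p x) * p).SameCycle u v → u ≠ x := by
    rintro u v huv h rfl
    exact huv (h.eq_of_left hQx)
  -- A crossing with one of its two pairs on the cycle of `x` in `p`.
  have quad : ∀ a b c d, CycOrd (g * swap x (p x)) a b c → CycOrd (g * swap x (p x)) a c d →
      (swap x (p x) * p).SameCycle a c → (swap x (p x) * p).SameCycle b d →
      ¬ (swap x (p x) * p).SameCycle a b → p.SameCycle x a → False := by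
    intro a b c d o1 o2 hac hbd hab hxa
    have o3 := o1.trans hG o2
    have hax := hxfix a c (o1.ne hG).2.1 hac
    have hcx := hxfix c a (o1.ne hG).2.1.symm hac.symm
    have hbx := hxfix b d (o3.2.ne hG).2.1 hbd
    have hya := remove_sameCycle hp hne.symm hne.symm hax (hy.symm.trans hxa)
    have fin : ∀ b' c' d', CycOrd (g * swap x (p x)) (p x) b' c' →
        CycOrd (g * swap x (p x)) (p x) c' d' → (swap x (p x) * p).SameCycle a c' →
        (swap x (p x) * p).SameCycle b' d' → ¬ (swap x (p x) * p).SameCycle a b' → False := by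
      intro b' c' d' u1 u2 h1 h3 h4
      have u3 := u1.trans hG u2
      have hc'x := hxfix c' (p x) (u1.ne hG).2.1.symm (h1.symm.trans hya.symm)
      have hb'x := hxfix b' d' (u3.2.ne hG).2.1 h3
      exact hf (forbidden_of_merged_quadruple hg hp h2 hx u1 u2
        (lsplit_le hp hy hne (hya.trans h1)) (lsplit_le hp hy hne h3)
        (fun h => h4 (hya.symm.trans (remove_sameCycle hp hne.symm hne.symm hb'x h))) hc'x)
    have haS := (mem_of_sameCycle_ne hG o1.1 (o1.ne hG).1).1
    by_cases ea : p x = a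
    · subst ea; exact fin _ _ _ o1 o2 hac hbd hab
    by_cases ec : p x = c
    · subst ec
      exact fin _ _ _ ((o2.rotate hG)) ((o1.rotate hG).rotate hG) (SameCycle.refl _ _)
        hbd.symm (fun h => hab (h.trans hbd.symm))
    have eb : p x ≠ b := by rintro e; rw [← e] at hab; exact hab hya.symm
    have ed : p x ≠ d := by rintro e; rw [← e] at hbd; exact hab (hya.symm.trans hbd.symm)
    -- The points b and d divide the merged cycle into two arcs; `p x` can replace `a` or `c`,
    -- whichever lies on the same arc.
    have key : (CycOrd (g * swap x (p x)) (p x) b c ∧ CycOrd (g * swap x (p x)) (p x) c d) ∨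
        (CycOrd (g * swap x (p x)) (p x) d a ∧ CycOrd (g * swap x (p x)) (p x) a b) := by
      obtain ⟨q, q0, qi, hq⟩ := exists_coord hG (p x)
      have sy := SameCycle.refl (g * swap x (p x)) (p x)
      have sa := hGall a haS
      have sb := sa.trans o1.1
      have sc := sa.trans o1.2.1
      have sd := sa.trans o2.2.1
      have na : q (p x) ≠ q a := fun e => ea (qi _ _ sy sa e)
      have nb : q (p x) ≠ q b := fun e => eb (qi _ _ sy sb e)
      have nc : q (p x) ≠ q c := fun e => ec (qi _ _ sy sc e)
      have nd : q (p x) ≠ q d := fun e => ed (qi _ _ sy sd e)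
      rw [hq _ _ _ sa sb sc] at o1
      rw [hq _ _ _ sa sc sd] at o2
      rw [hq _ _ _ sy sb sc, hq _ _ _ sy sc sd, hq _ _ _ sy sd sa, hq _ _ _ sy sa sb]
      omega
    rcases key with ⟨k1, k2⟩ | ⟨k1, k2⟩
    · exact fin _ _ _ k1 k2 hac hbd hab
    · exact fin _ _ _ k1 k2 (SameCycle.refl _ _) hbd.symm (fun h => hab (h.trans hbd.symm))
  refine (geodesic_merge_iff hg hp h2 hx hy).1 (geodesic_of_noncrossing hG hQ ?_ ?_ ?_)
  · intro z
    by_cases hz : z ∈ S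
    · exact (hGall z hz).symm.trans (hGall _ (apply_mem_of_permsOn hQ hz))
    · rw [(mem_permsOn _ _).1 hQ z hz]
  · intro a b c o1 o2
    obtain ⟨nab, nac, nbc⟩ := o1.ne hG
    have hax := hxfix a b nab o2.1
    have o2' := lsplit_cycOrd hp hy hne o2
    by_cases hxa : p.SameCycle x a
    · have hya := remove_sameCycle hp hne.symm hne.symm hax (hy.symm.trans hxa)
      have haS := (mem_of_sameCycle_ne hG o1.1 nab).1
      obtain ⟨b', c', u1, u2⟩ := exists_common_triple hG hQ o1 o2 (hGall a haS) hya
      obtain ⟨n1, n2, n3⟩ := u2.ne hQ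
      exact hf (forbidden_of_merged_triple hg hp h2 hx u1 (lsplit_cycOrd hp hy hne u2)
        (hxfix _ _ n1.symm u2.1.symm) (hxfix _ _ n2.symm u2.2.1.symm))
    · exact hf (.cross_five hx o1 o2' hy hxa)
  · intro a b c d o1 o2 hac hbd
    by_contra hab
    have o3 := o1.trans hG o2
    by_cases hxa : p.SameCycle x a
    · exact quad a b c d o1 o2 hac hbd hab hxa
    by_cases hxb : p.SameCycle x b
    · exact quad b c d a o3.2 (o3.1.rotate hG) hbd hac.symm
        (fun h => hab (hac.trans h.symm)) hxb
    have hax := hxfix a c (o1.ne hG).2.1 hac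
    have hbx := hxfix b d (o3.2.ne hG).2.1 hbd
    exact hf (.cross_six hx o1 o2 (lsplit_le hp hy hne hac) (lsplit_le hp hy hne hbd) hy
      (fun h => hab (remove_sameCycle hp hne.symm hax hbx h)) hxa hxb)

/-- A connected permutation has genus zero relative to `g` (which has two cycles) if and only if none
of the forbidden configurations occurs. -/
theorem planar_iff_not_forbidden (hg : g ∈ permsOn S) (hp : p ∈ permsOn S)
    (h2 : numCycles S g = 2) (hlink : ∃ x ∈ S, ¬ g.SameCycle x (p x)) :
    numCycles S p + numCycles S (g * p) = S.card ↔ ¬ Forbidden g p :=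
  ⟨not_forbidden_of_planar hg hp h2 hlink, planar_of_not_forbidden hg hp h2 hlink⟩

end Annular

/-! ### Induced maps and cyclic orders -/

/-- Iterating `g` from `k`, the first element of `J` that is reached is `k'`. -/
inductive FirstHit (g : ℤ → ℤ) (J : Finset ℤ) : ℤ → ℤ → Prop
  | here {k : ℤ} : g k ∈ J → FirstHit g J k (g k)
  | step {k k' : ℤ} : g k ∉ J → FirstHit g J (g k) k' → FirstHit g J k k'

theorem induced_of_least {g : ℤ → ℤ} {J : Finset ℤ} {k : ℤ} {m : ℕ} (h0 : 0 < m)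
    (hm : g^[m] k ∈ J) (h : ∀ i, 0 < i → i < m → g^[i] k ∉ J) : induced g J k = g^[m] k := by
  have : sInf {m : ℕ | 0 < m ∧ g^[m] k ∈ J} = m := by
    have mem : m ∈ {m : ℕ | 0 < m ∧ g^[m] k ∈ J} := ⟨h0, hm⟩
    apply le_antisymm (Nat.sInf_le mem)
    have hs := Nat.sInf_mem ⟨m, mem⟩
    by_contra hlt
    exact h _ hs.1 (by omega) hs.2
  rw [induced, this]

theorem FirstHit.exists_least {g : ℤ → ℤ} {J : Finset ℤ} {k k' : ℤ} (h : FirstHit g J k k') :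
    ∃ m, 0 < m ∧ g^[m] k = k' ∧ k' ∈ J ∧ ∀ i, 0 < i → i < m → g^[i] k ∉ J := by
  induction h with
  | here h => exact ⟨1, one_pos, rfl, h, fun i h1 h2 => by omega⟩
  | @step k k' h _ ih =>
    obtain ⟨m, h0, h1, h2, h3⟩ := ih
    refine ⟨m + 1, by omega, h1, h2, fun i hi him => ?_⟩
    rcases Nat.exists_eq_succ_of_ne_zero hi.ne' with ⟨j, rfl⟩
    rcases Nat.eq_zero_or_pos j with rfl | hj
    · exact h
    · exact h3 j hj (by omega)

theorem FirstHit.induced_eq {g : ℤ → ℤ} {J : Finset ℤ} {k k' : ℤ} (h : FirstHit g J k k') :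
    induced g J k = k' := by
  obtain ⟨m, h0, h1, h2, h3⟩ := h.exists_least
  rw [induced_of_least h0 (h1 ▸ h2) h3, h1]

theorem exists_firstHit {g : ℤ → ℤ} {J : Finset ℤ} {m : ℕ} {k : ℤ} (h0 : 0 < m)
    (hm : g^[m] k ∈ J) : ∃ k', FirstHit g J k k' := by
  induction m generalizing k with
  | zero => omega
  | succ m ih =>
    by_cases hk : g k ∈ J
    · exact ⟨_, .here hk⟩
    · rcases Nat.eq_zero_or_pos m with rfl | h
      · exact absurd hm hk
      · obtain ⟨k', h'⟩ := ih h hm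
        exact ⟨k', .step hk h'⟩

/-- A map `f` that differs from `g` only by skipping elements outside `J` induces the same map. -/
theorem induced_eq_iff_of_skip {f g : ℤ → ℤ} {J : Finset ℤ} {Good : ℤ → Prop}
    (h : ∀ k, Good k → Good (f k) ∧ (f k = g k ∨ (g k ∉ J ∧ f k = g (g k))))
    {k k' : ℤ} (hk : Good k) (hg : ∃ m, 0 < m ∧ g^[m] k ∈ J) :
    induced f J k = k' ↔ induced g J k = k' := by
  have step1 : ∀ {k k'}, FirstHit f J k k' → Good k → FirstHit g J k k' := by
    intro k k' hf
    induction hf with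
    | @here k hJ =>
      intro hk
      rcases (h k hk).2 with e | ⟨e1, e2⟩
      · rw [e] at hJ ⊢; exact .here hJ
      · rw [e2] at hJ ⊢; exact .step e1 (.here hJ)
    | @step k k' hJ _ ih =>
      intro hk
      have ih := ih (h k hk).1
      rcases (h k hk).2 with e | ⟨e1, e2⟩
      · rw [e] at hJ ih; exact .step hJ ih
      · rw [e2] at hJ ih; exact .step e1 (.step hJ ih)
  -- The bound `n` makes the induction strong, since one step of `f` may consume two steps of `g`.
  have step2 : ∀ n m k, m ≤ n → Good k → 0 < m → g^[m] k ∈ J → ∃ k', FirstHit f J k k' := by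
    intro n
    induction n with
    | zero => intros; omega
    | succ n ih =>
      intro m k hmn hk h0 hm
      by_cases hfk : f k ∈ J
      · exact ⟨_, .here hfk⟩
      have hG := (h k hk).1
      obtain ⟨m, rfl⟩ := Nat.exists_eq_succ_of_ne_zero h0.ne'
      rcases (h k hk).2 with e | ⟨e1, e2⟩
      · rcases Nat.eq_zero_or_pos m with rfl | h1
        · rw [e] at hfk; exact absurd hm hfk
        · obtain ⟨k', hk'⟩ := ih m (f k) (by omega) hG h1 (by rw [e]; exact hm)
          exact ⟨k', .step hfk hk'⟩
      · rcases Nat.eq_zero_or_pos m with rfl | h1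
        · exact absurd hm e1
        obtain ⟨m, rfl⟩ := Nat.exists_eq_succ_of_ne_zero h1.ne'
        rcases Nat.eq_zero_or_pos m with rfl | h2
        · rw [e2] at hfk; exact absurd hm hfk
        · obtain ⟨k', hk'⟩ := ih m (f k) (by omega) hG h2 (by rw [e2]; exact hm)
          exact ⟨k', .step hfk hk'⟩
  obtain ⟨m, h0, hm⟩ := hg
  obtain ⟨k'', hk''⟩ := step2 m m k le_rfl hk h0 hm
  rw [hk''.induced_eq, (step1 hk'' hk).induced_eq]

/-- First returns of the map `f` to `J` are described by the cyclic order of `g`. -/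
def ReturnsVia (f : ℤ → ℤ) (g : Perm ℤ) (J : Finset ℤ) : Prop :=
  ∀ k ∈ J, ∀ k' ∈ J, k ≠ k' →
    (induced f J k = k' ↔ g.SameCycle k k' ∧ ∀ j ∈ J, ¬ CycOrd g k j k')

theorem HasPeriod.iterate_mem {g : Perm ℤ} {k : ℤ} {n : ℕ} (h : HasPeriod g k n) {J : Finset ℤ}
    (hk : k ∈ J) : ∃ m, 0 < m ∧ g^[m] k ∈ J :=
  ⟨n, h.pos, by rw [← Perm.coe_pow, h.pow_eq]; exact hk⟩

/-- The first return to `J` is the element of `J` reached after the fewest steps; no element of `J`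
lies strictly between. -/
theorem returnsVia_self {S : Finset ℤ} {g : Perm ℤ} (hg : g ∈ permsOn S) (J : Finset ℤ) :
    ReturnsVia g g J := by
  intro k hk k' hk' hne
  obtain ⟨n, hn⟩ := exists_hasPeriod hg k
  constructor
  · intro h
    obtain ⟨m, h0, hm⟩ := hn.iterate_mem hk
    obtain ⟨k'', hf⟩ := exists_firstHit h0 hm
    rw [hf.induced_eq] at h
    subst h
    obtain ⟨m, h0, h1, -, h3⟩ := hf.exists_least
    have hs : g.SameCycle k k'' := ⟨m, by rw [zpow_natCast, Perm.coe_pow, h1]⟩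
    refine ⟨hs, fun j hj o => ?_⟩
    have l1 : steps g k k'' ≤ m := Nat.sInf_le (by rw [Set.mem_ofPred_eq, Perm.coe_pow, h1])
    have := (hn.steps_lt o.1).2
    exact h3 (steps g k j) o.2.2.1 (lt_of_lt_of_le o.2.2.2 l1)
      (by rw [← Perm.coe_pow, this]; exact hj)
  · rintro ⟨hs, h⟩
    obtain ⟨l1, e1⟩ := hn.steps_lt hs
    have h0 := steps_pos_of_ne hn hs hne
    rw [induced_of_least h0 (by rw [← Perm.coe_pow, e1]; exact hk'), ← Perm.coe_pow, e1]
    intro i hi1 hi2 hJ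
    rw [← Perm.coe_pow] at hJ
    refine h _ hJ ⟨⟨i, by rw [zpow_natCast]⟩, hs, ?_⟩
    rw [hn.steps_pow (by omega)]
    exact ⟨hi1, hi2⟩

/-- `lamXY g x y` is the merged cycle with `x` and `y` skipped, so both maps have the same first
returns to a set avoiding these two points. -/
theorem returnsVia_lamXY {S : Finset ℤ} {g : Perm ℤ} (hg : g ∈ permsOn S) {x y : ℤ}
    (hx : x ∈ S) (hy : y ∈ S) (hxy : ¬ g.SameCycle x y) {J : Finset ℤ} (hxJ : x ∉ J)
    (hyJ : y ∉ J) : ReturnsVia (lamXY g x y) (g * swap x y) J := by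
  intro k hk k' hk' hne
  have hm := mul_swap_mem hg hx hy
  obtain ⟨n, hn⟩ := exists_hasPeriod hm k
  rw [← returnsVia_self hm J k hk k' hk' hne]
  have h1 : g y ≠ x := fun e => hxy (e ▸ (sameCycle_apply_self g y).symm)
  have h2 : g x ≠ y := fun e => hxy (e ▸ (sameCycle_apply_self g x))
  have h3 := ne_of_not_sameCycle hxy
  -- At a non-fixed point `x` or `y` the two maps take different routes. No orbit starting in `J`
  -- reaches such a point under `lamXY`; if `x` or `y` is a fixed point of `g`, the values agree
  -- there.
  refine induced_eq_iff_of_skip (Good := fun k => (k = x → g x = x) ∧ (k = y → g y = y)) ?_ ?_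
    (hn.iterate_mem hk)
  · rintro k ⟨g1, g2⟩
    unfold lamXY
    split_ifs with c1 c2
    · refine ⟨⟨fun e => absurd e h1, fun e => e ▸ e⟩, ?_⟩
      by_cases e1 : k = x
      · left; rw [e1, Perm.mul_apply, swap_apply_left]
      · have e2 : k ≠ y := by rintro rfl; exact h1 c1
        right
        rw [Perm.mul_apply, swap_apply_of_ne_of_ne e1 e2, c1]
        exact ⟨hxJ, by rw [Perm.mul_apply, swap_apply_left]⟩
    · refine ⟨⟨fun e => e ▸ e, fun e => absurd e h2⟩, ?_⟩
      by_cases e1 : k = y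
      · left; rw [e1, Perm.mul_apply, swap_apply_right]
      · have e2 : k ≠ x := by rintro rfl; exact h2 c2
        right
        rw [Perm.mul_apply, swap_apply_of_ne_of_ne e2 e1, c2]
        exact ⟨hyJ, by rw [Perm.mul_apply, swap_apply_right]⟩
    · refine ⟨⟨fun e => absurd e c1, fun e => absurd e c2⟩, Or.inl ?_⟩
      rw [Perm.mul_apply, swap_apply_of_ne_of_ne]
      · rintro rfl; exact c1 (g1 rfl)
      · rintro rfl; exact c2 (g2 rfl)
  · exact ⟨fun e => absurd (e ▸ hk) hxJ, fun e => absurd (e ▸ hk) hyJ⟩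

/-! ### The forbidden shapes in terms of cyclic order -/

section Shapes

variable {S : Finset ℤ} {f : ℤ → ℤ} {g : Perm ℤ}

theorem inducedEq_iff {J : Finset ℤ} (h : ReturnsVia f g J) {σ : Perm ℤ}
    (hσ : ∀ k ∈ J, σ k ∈ J ∧ k ≠ σ k) :
    InducedEq f J σ ↔ ∀ k ∈ J, g.SameCycle k (σ k) ∧ ∀ j ∈ J, ¬ CycOrd g k j (σ k) := by
  unfold InducedEq
  exact forall₂_congr fun k hk => h k hk _ (hσ k hk).1 (hσ k hk).2

theorem inducedEq_three (hg : g ∈ permsOn S) {a b c : ℤ} (hn : [a, b, c].Nodup)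
    (h : ReturnsVia f g {a, b, c}) :
    InducedEq f {a, b, c} (cyc [a, b, c]) ↔ CycOrd g a b c := by
  simp only [List.nodup_cons, List.mem_cons, List.not_mem_nil, not_or, or_false,
    not_false_eq_true, List.nodup_nil, and_true] at hn
  obtain ⟨⟨hab, hac⟩, hbc⟩ := hn
  have e1 : cyc [a, b, c] a = b := by simp [cyc, swap_apply_def, *]
  have e2 : cyc [a, b, c] b = c := by simp [cyc, swap_apply_def, *, Ne.symm hac, Ne.symm hbc]
  have e3 : cyc [a, b, c] c = a := by simp [cyc, *]
  rw [inducedEq_iff h (by simp [e1, e2, e3, hab, hac, hbc, Ne.symm hac])]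
  simp only [Finset.mem_insert, Finset.mem_singleton, forall_eq_or_imp, forall_eq, e1, e2, e3]
  constructor
  · rintro ⟨⟨s1, n1, n2, n3⟩, ⟨s2, -⟩, -⟩
    exact (CycOrd.total hg s1 (s1.trans s2) hab hac hbc).resolve_right n3
  · intro o
    have o1 := o.rotate hg
    have o2 := o1.rotate hg
    have d : ∀ u v, ¬ CycOrd g u u v := fun u v h => (h.ne hg).1 rfl
    have d' : ∀ u v, ¬ CycOrd g u v v := fun u v h => (h.ne hg).2.2 rfl
    exact ⟨⟨o.1, d _ _, d' _ _, o.not_flip hg⟩, ⟨o1.1, o1.not_flip hg, d _ _, d' _ _⟩,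
      o2.1, d' _ _, o2.not_flip hg, d _ _⟩

theorem inducedEq_four (hg : g ∈ permsOn S) {a b c d : ℤ} (hn : [a, b, c, d].Nodup)
    (h : ReturnsVia f g {a, b, c, d}) :
    InducedEq f {a, b, c, d} (cyc [a, b, c, d]) ↔ CycOrd g a b c ∧ CycOrd g a c d := by
  simp only [List.nodup_cons, List.mem_cons, List.not_mem_nil, not_or, or_false,
    not_false_eq_true, List.nodup_nil, and_true] at hn
  obtain ⟨⟨hab, hac, had⟩, ⟨hbc, hbd⟩, hcd⟩ := hn
  have e1 : cyc [a, b, c, d] a = b := by simp [cyc, swap_apply_def, *]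
  have e2 : cyc [a, b, c, d] b = c := by
    simp [cyc, swap_apply_def, *, Ne.symm hac, Ne.symm hbc]
  have e3 : cyc [a, b, c, d] c = d := by simp [cyc, swap_apply_def, *, Ne.symm]
  have e4 : cyc [a, b, c, d] d = a := by simp [cyc, *]
  rw [inducedEq_iff h (by simp [e1, e2, e3, e4, hab, hac, hbc, hbd, hcd, Ne.symm had])]
  simp only [Finset.mem_insert, Finset.mem_singleton, forall_eq_or_imp, forall_eq, e1, e2, e3, e4]
  constructor
  · rintro ⟨⟨s1, n1, n2, n3, n4⟩, ⟨s2, m1, m2, m3, m4⟩, ⟨s3, l1, l2, l3, l4⟩, -⟩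
    refine ⟨(CycOrd.total hg s1 (s1.trans s2) hab hac hbc).resolve_right n3,
      (CycOrd.total hg (s1.trans s2) (s1.trans (s2.trans s3)) hac had hcd).resolve_right ?_⟩
    intro o
    exact l1 ((o.rotate hg).rotate hg)
  · rintro ⟨o1, o2⟩
    obtain ⟨o3, o4⟩ := o1.trans hg o2
    have d : ∀ u v, ¬ CycOrd g u u v := fun u v h => (h.ne hg).1 rfl
    have d' : ∀ u v, ¬ CycOrd g u v v := fun u v h => (h.ne hg).2.2 rfl
    exact ⟨⟨o1.1, d _ _, d' _ _, o1.not_flip hg, o3.not_flip hg⟩,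
      ⟨o4.1, (o1.rotate hg).not_flip hg, d _ _, d' _ _, o4.not_flip hg⟩,
      ⟨(o2.rotate hg).1, (o2.rotate hg).not_flip hg, (o4.rotate hg).not_flip hg, d _ _, d' _ _⟩,
      o2.2.1.symm, d' _ _, ((o3.rotate hg).rotate hg).not_flip hg,
      ((o2.rotate hg).rotate hg).not_flip hg, d _ _⟩

theorem sameCycle_not_of_not_cycOrd (hg : g ∈ permsOn S) {a b c : ℤ} (hab : a ≠ b) (hac : a ≠ c)
    (hbc : b ≠ c) (h : g.SameCycle a b) (h1 : ¬ CycOrd g a c b) (h2 : ¬ CycOrd g b c a) :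
    ¬ g.SameCycle a c := by
  intro hs
  rcases CycOrd.total hg h hs hab hac hbc with o | o
  · exact h2 (o.rotate hg)
  · exact h1 o

theorem not_cycOrd_of_not_sameCycle {a b c : ℤ} (h : ¬ g.SameCycle a b) : ¬ CycOrd g a b c :=
  fun o => h o.1

/-- The set `J` is given only by its members, since one pattern lists the four points in an order
different from that of the two pairs. -/
theorem inducedEq_two_two (hg : g ∈ permsOn S) {a b c d : ℤ} (hn : [a, b, c, d].Nodup)
    {J : Finset ℤ} (hJ : ∀ z, z ∈ J ↔ z = a ∨ z = b ∨ z = c ∨ z = d)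
    (h : ReturnsVia f g J) :
    InducedEq f J (cyc [a, b] * cyc [c, d]) ↔
      g.SameCycle a b ∧ g.SameCycle c d ∧ ¬ g.SameCycle a c := by
  simp only [List.nodup_cons, List.mem_cons, List.not_mem_nil, not_or, or_false,
    not_false_eq_true, List.nodup_nil, and_true] at hn
  obtain ⟨⟨hab, hac, had⟩, ⟨hbc, hbd⟩, hcd⟩ := hn
  have e1 : (cyc [a, b] * cyc [c, d]) a = b := by simp [cyc, swap_apply_def, *]
  have e2 : (cyc [a, b] * cyc [c, d]) b = a := by simp [cyc, swap_apply_def, *]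
  have e3 : (cyc [a, b] * cyc [c, d]) c = d := by simp [cyc, swap_apply_def, *, Ne.symm]
  have e4 : (cyc [a, b] * cyc [c, d]) d = c := by simp [cyc, swap_apply_def, *, Ne.symm]
  rw [inducedEq_iff h (by
    simp only [hJ, forall_eq_or_imp, forall_eq, e1, e2, e3, e4]
    simp [hab, hcd, Ne.symm hab, Ne.symm hcd])]
  simp only [hJ, forall_eq_or_imp, forall_eq, e1, e2, e3, e4]
  constructor
  · rintro ⟨⟨s1, n1, n2, n3, n4⟩, ⟨s2, m1, m2, m3, m4⟩, ⟨s3, l1, l2, l3, l4⟩, -⟩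
    exact ⟨s1, s3, sameCycle_not_of_not_cycOrd hg hab hac hbc s1 n3 m3⟩
  · rintro ⟨s1, s2, n⟩
    have d : ∀ u v, ¬ CycOrd g u u v := fun u v h => (h.ne hg).1 rfl
    have d' : ∀ u v, ¬ CycOrd g u v v := fun u v h => (h.ne hg).2.2 rfl
    have nad : ¬ g.SameCycle a _ := fun h => n (h.trans s2.symm)
    have nbc : ¬ g.SameCycle b c := fun h => n (s1.trans h)
    have nbd : ¬ g.SameCycle b _ := fun h => nad (s1.trans h)
    have f' : ∀ {u v w}, ¬ g.SameCycle u v → ¬ CycOrd g u v w := not_cycOrd_of_not_sameCycle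
    have sy : ∀ {u v}, ¬ g.SameCycle u v → ¬ g.SameCycle v u := fun h h' => h h'.symm
    exact ⟨⟨s1, d _ _, d' _ _, f' n, f' nad⟩, ⟨s1.symm, d' _ _, d _ _, f' nbc, f' nbd⟩,
      ⟨s2, f' (sy n), f' (sy nbc), d _ _, d' _ _⟩,
      s2.symm, f' (sy nad), f' (sy nbd), d' _ _, d _ _⟩

theorem inducedEq_three_two (hg : g ∈ permsOn S) {a b c x y : ℤ} (hn : [a, b, c, x, y].Nodup)
    (h : ReturnsVia f g {a, b, c, x, y}) :
    InducedEq f {a, b, c, x, y} (cyc [a, b, c] * cyc [x, y]) ↔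
      CycOrd g a b c ∧ g.SameCycle x y ∧ ¬ g.SameCycle x a := by
  simp only [List.nodup_cons, List.mem_cons, List.not_mem_nil, not_or, or_false,
    not_false_eq_true, List.nodup_nil, and_true] at hn
  obtain ⟨⟨hab, hac, hax, hay⟩, ⟨hbc, hbx, hby⟩, ⟨hcx, hcy⟩, hxy⟩ := hn
  have e1 : (cyc [a, b, c] * cyc [x, y]) a = b := by simp [cyc, swap_apply_def, *]
  have e2 : (cyc [a, b, c] * cyc [x, y]) b = c := by
    simp [cyc, swap_apply_def, *, Ne.symm hac, Ne.symm hbc]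
  have e3 : (cyc [a, b, c] * cyc [x, y]) c = a := by simp [cyc, swap_apply_def, *]
  have e4 : (cyc [a, b, c] * cyc [x, y]) x = y := by simp [cyc, swap_apply_def, *, Ne.symm]
  have e5 : (cyc [a, b, c] * cyc [x, y]) y = x := by simp [cyc, swap_apply_def, *, Ne.symm]
  rw [inducedEq_iff h (by
    simp only [Finset.mem_insert, Finset.mem_singleton, forall_eq_or_imp, forall_eq, e1, e2, e3,
      e4, e5]
    simp [hab, hbc, Ne.symm hac, hxy, Ne.symm hxy])]
  simp only [Finset.mem_insert, Finset.mem_singleton, forall_eq_or_imp, forall_eq, e1, e2, e3, e4,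
    e5]
  constructor
  · rintro ⟨⟨s1, n1, n2, n3, n4⟩, ⟨s2, -⟩, -, ⟨s3, l1, -⟩, ⟨-, k1, -⟩⟩
    exact ⟨(CycOrd.total hg s1 (s1.trans s2) hab hac hbc).resolve_right n3, s3,
      sameCycle_not_of_not_cycOrd hg hxy (Ne.symm hax) (Ne.symm hay) s3 l1 k1⟩
  · rintro ⟨o, s, n⟩
    have o1 := o.rotate hg
    have o2 := o1.rotate hg
    have d : ∀ u v, ¬ CycOrd g u u v := fun u v h => (h.ne hg).1 rfl
    have d' : ∀ u v, ¬ CycOrd g u v v := fun u v h => (h.ne hg).2.2 rfl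
    have f' : ∀ {u v w}, ¬ g.SameCycle u v → ¬ CycOrd g u v w := not_cycOrd_of_not_sameCycle
    have sy : ∀ {u v}, ¬ g.SameCycle u v → ¬ g.SameCycle v u := fun h h' => h h'.symm
    have n2 : ¬ g.SameCycle x b := fun h => n (h.trans o.1.symm)
    have n3 : ¬ g.SameCycle x c := fun h => n (h.trans o.2.1.symm)
    have m1 : ¬ g.SameCycle y a := fun h => n (s.trans h)
    have m2 : ¬ g.SameCycle y b := fun h => n2 (s.trans h)
    have m3 : ¬ g.SameCycle y c := fun h => n3 (s.trans h)
    exact ⟨⟨o.1, d _ _, d' _ _, o.not_flip hg, f' (sy n), f' (sy m1)⟩,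
      ⟨o1.1, o1.not_flip hg, d _ _, d' _ _, f' (sy n2), f' (sy m2)⟩,
      ⟨o2.1, d' _ _, o2.not_flip hg, d _ _, f' (sy n3), f' (sy m3)⟩,
      ⟨s, f' n, f' n2, f' n3, d _ _, d' _ _⟩, s.symm, f' m1, f' m2, f' m3, d' _ _, d _ _⟩

theorem inducedEq_two_two_two (hg : g ∈ permsOn S) {a b c d x y : ℤ}
    (hn : [a, b, c, d, x, y].Nodup) (h : ReturnsVia f g {a, b, c, d, x, y}) :
    InducedEq f {a, b, c, d, x, y} (cyc [a, c] * cyc [b, d] * cyc [x, y]) ↔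
      g.SameCycle a c ∧ g.SameCycle b d ∧ g.SameCycle x y ∧ ¬ g.SameCycle a b ∧
        ¬ g.SameCycle x a ∧ ¬ g.SameCycle x b := by
  simp only [List.nodup_cons, List.mem_cons, List.not_mem_nil, not_or, or_false,
    not_false_eq_true, List.nodup_nil, and_true] at hn
  obtain ⟨⟨hab, hac, had, hax, hay⟩, ⟨hbc, hbd, hbx, hby⟩, ⟨hcd, hcx, hcy⟩, ⟨hdx, hdy⟩, hxy⟩ := hn
  have e1 : (cyc [a, c] * cyc [b, d] * cyc [x, y]) a = c := by simp [cyc, swap_apply_def, *]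
  have e2 : (cyc [a, c] * cyc [b, d] * cyc [x, y]) b = d := by
    simp [cyc, swap_apply_def, *, Ne.symm]
  have e3 : (cyc [a, c] * cyc [b, d] * cyc [x, y]) c = a := by
    simp [cyc, swap_apply_def, *, Ne.symm]
  have e4 : (cyc [a, c] * cyc [b, d] * cyc [x, y]) d = b := by
    simp [cyc, swap_apply_def, *, Ne.symm]
  have e5 : (cyc [a, c] * cyc [b, d] * cyc [x, y]) x = y := by
    simp [cyc, swap_apply_def, *, Ne.symm]
  have e6 : (cyc [a, c] * cyc [b, d] * cyc [x, y]) y = x := by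
    simp [cyc, swap_apply_def, *, Ne.symm]
  rw [inducedEq_iff h (by
    simp only [Finset.mem_insert, Finset.mem_singleton, forall_eq_or_imp, forall_eq, e1, e2, e3,
      e4, e5, e6]
    simp [hac, Ne.symm hac, hbd, Ne.symm hbd, hxy, Ne.symm hxy])]
  simp only [Finset.mem_insert, Finset.mem_singleton, forall_eq_or_imp, forall_eq, e1, e2, e3, e4,
    e5, e6]
  constructor
  · rintro ⟨⟨s1, n1, n2, -⟩, ⟨s2, -⟩, ⟨-, k1, k2, -⟩, -, ⟨s3, l1, l2, -⟩, ⟨-, r1, r2, -⟩⟩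
    exact ⟨s1, s2, s3, sameCycle_not_of_not_cycOrd hg hac hab (Ne.symm hbc) s1 n2 k2,
      sameCycle_not_of_not_cycOrd hg hxy (Ne.symm hax) (Ne.symm hay) s3 l1 r1,
      sameCycle_not_of_not_cycOrd hg hxy (Ne.symm hbx) (Ne.symm hby) s3 l2 r2⟩
  · rintro ⟨s1, s2, s3, n1, n2, n3⟩
    have dd : ∀ u v, ¬ CycOrd g u u v := fun u v h => (h.ne hg).1 rfl
    have d' : ∀ u v, ¬ CycOrd g u v v := fun u v h => (h.ne hg).2.2 rfl
    have f' : ∀ {u v w}, ¬ g.SameCycle u v → ¬ CycOrd g u v w := not_cycOrd_of_not_sameCycle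
    have sy : ∀ {u v}, ¬ g.SameCycle u v → ¬ g.SameCycle v u := fun h h' => h h'.symm
    have bl : ∀ {u v w}, ¬ g.SameCycle u v → g.SameCycle v w → ¬ g.SameCycle u w :=
      fun h h1 h2 => h (h2.trans h1.symm)
    have br : ∀ {u v w}, ¬ g.SameCycle u v → g.SameCycle u w → ¬ g.SameCycle w v :=
      fun h h1 h2 => h (h1.trans h2)
    have ad := bl n1 s2
    have cb := br n1 s1
    have cd := bl cb s2
    have xc := bl n2 s1
    have xd := bl n3 s2
    have ya := br n2 s3
    have yb := br n3 s3
    have yc := br xc s3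
    have yd := br xd s3
    exact ⟨⟨s1, dd _ _, f' n1, d' _ _, f' ad, f' (sy n2), f' (sy ya)⟩,
      ⟨s2, f' (sy n1), dd _ _, f' (sy cb), d' _ _, f' (sy n3), f' (sy yb)⟩,
      ⟨s1.symm, d' _ _, f' cb, dd _ _, f' cd, f' (sy xc), f' (sy yc)⟩,
      ⟨s2.symm, f' (sy ad), d' _ _, f' (sy cd), dd _ _, f' (sy xd), f' (sy yd)⟩,
      ⟨s3, f' n2, f' n3, f' xc, f' xd, dd _ _, d' _ _⟩,
      s3.symm, f' ya, f' yb, f' yc, f' yd, d' _ _, dd _ _⟩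

end Shapes

theorem forbidden_iff {S : Finset ℤ} {g p : Perm ℤ} (hg : g ∈ permsOn S) (hp : p ∈ permsOn S) :
    Forbidden g p ↔ AnnNonstandard S g p ∨ AnnCrossing S g p := by
  have rg := returnsVia_self hg
  have rp := returnsVia_self hp
  have mem : ∀ {u v}, p.SameCycle u v → u ≠ v → u ∈ S ∧ v ∈ S := fun h => mem_of_sameCycle_ne hp h
  have perm4 : ∀ a b c d : ℤ, ({a, b, c, d} : Finset ℤ) = {a, c, b, d} := by
    intro a b c d; ext z; simp only [Finset.mem_insert, Finset.mem_singleton]; tauto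
  constructor
  · rintro (⟨o1, o2⟩ | ⟨hab, hcd, hac, o1, o2⟩ | ⟨o1, o2, hac, hbd, hab⟩ | ⟨hxy, o1, o2, hy, hxa⟩ |
      ⟨hxy, o1, o2, hac, hbd, hy, hab, hxa, hxb⟩)
    · rename_i a b c
      obtain ⟨n1, n2, n3⟩ := o2.ne hp
      obtain ⟨aS, bS⟩ := mem o2.1 n1
      have hn : [a, b, c].Nodup := by simp [n1, n2, n3]
      exact .inl (.inl ⟨a, aS, b, bS, c, (mem o2.2.1 n2).2, hn,
        (inducedEq_three hg hn (rg _)).2 o1, (inducedEq_three hp hn (rp _)).2 o2⟩)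
    · rename_i a b c d
      obtain ⟨n1, n2, n3⟩ := o1.ne hp
      obtain ⟨m1, m2, m3⟩ := o2.ne hp
      have t := o1.trans hp o2
      have m4 := (t.1.ne hp).2.2
      obtain ⟨aS, cS⟩ := mem o1.1 n1
      have hn : [a, b, c, d].Nodup := by simp [n1, n2, n3.symm, m2, m3, m4]
      have hn' : [a, c, b, d].Nodup := by simp [n1, n2, n3, m2, m3, m4]
      refine .inl (.inr ⟨a, aS, b, (mem o1.2.1 n2).2, c, cS, d, (mem o2.2.1 m2).2, hn,
        (inducedEq_two_two hg hn (by simp) (rg _)).2 ⟨hab, hcd, hac⟩, ?_⟩)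
      rw [perm4]
      exact (inducedEq_four hp hn' (rp _)).2 ⟨o1, o2⟩
    · rename_i a b c d
      obtain ⟨n1, n2, n3⟩ := o1.ne hg
      obtain ⟨m1, m2, m3⟩ := o2.ne hg
      have m4 := ((o1.trans hg o2).1.ne hg).2.2
      obtain ⟨aS, cS⟩ := mem hac n2
      obtain ⟨bS, dS⟩ := mem hbd m4
      have hn : [a, b, c, d].Nodup := by simp [n1, n2, n3, m2, m3, m4]
      have hn' : [a, c, b, d].Nodup := by simp [n1, n2, n3.symm, m2, m3, m4]
      exact .inr (.inl ⟨a, aS, b, bS, c, cS, d, dS, hn,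
        (inducedEq_four hg hn (rg _)).2 ⟨o1, o2⟩,
        (inducedEq_two_two hp hn' (by simp; tauto) (rp _)).2 ⟨hac, hbd, hab⟩⟩)
    · rename_i x y a b c
      obtain ⟨n1, n2, n3⟩ := o2.ne hp
      have nxy := ne_of_not_sameCycle hxy
      obtain ⟨xS, yS⟩ := mem hy nxy
      obtain ⟨aS, bS⟩ := mem o2.1 n1
      have xa : x ≠ a := ne_of_not_sameCycle hxa
      have xb : x ≠ b := by rintro rfl; exact hxa o2.1.symm
      have xc : x ≠ c := by rintro rfl; exact hxa o2.2.1.symm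
      have ya : y ≠ a := by rintro rfl; exact hxa hy
      have yb : y ≠ b := by rintro rfl; exact hxa (hy.trans o2.1.symm)
      have yc : y ≠ c := by rintro rfl; exact hxa (hy.trans o2.2.1.symm)
      have hn : [a, b, c].Nodup := by simp [n1, n2, n3]
      have hn' : [a, b, c, x, y].Nodup := by
        simp [n1, n2, n3, nxy, xa.symm, xb.symm, xc.symm, ya.symm, yb.symm, yc.symm]
      exact .inr (.inr (.inl ⟨x, xS, y, yS, hxy, a, aS, b, bS, c, (mem o2.2.1 n2).2, hn',
        (inducedEq_three (mul_swap_mem hg xS yS) hn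
          (returnsVia_lamXY hg xS yS hxy (by simp [*]) (by simp [*]))).2 o1,
        (inducedEq_three_two hp hn' (rp _)).2 ⟨o2, hy, hxa⟩⟩))
    · rename_i x y a b c d
      have nxy := ne_of_not_sameCycle hxy
      obtain ⟨xS, yS⟩ := mem hy nxy
      have hm := mul_swap_mem hg xS yS
      obtain ⟨n1, n2, n3⟩ := o1.ne hm
      obtain ⟨m1, m2, m3⟩ := o2.ne hm
      have m4 := ((o1.trans hm o2).1.ne hm).2.2
      obtain ⟨aS, cS⟩ := mem hac n2
      obtain ⟨bS, dS⟩ := mem hbd m4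
      have xa : x ≠ a := ne_of_not_sameCycle hxa
      have xb : x ≠ b := ne_of_not_sameCycle hxb
      have xc : x ≠ c := by rintro rfl; exact hxa hac.symm
      have xd : x ≠ d := by rintro rfl; exact hxb hbd.symm
      have ya : y ≠ a := by rintro rfl; exact hxa hy
      have yb : y ≠ b := by rintro rfl; exact hxb hy
      have yc : y ≠ c := by rintro rfl; exact hxa (hy.trans hac.symm)
      have yd : y ≠ d := by rintro rfl; exact hxb (hy.trans hbd.symm)
      have hn : [a, b, c, d].Nodup := by simp [n1, n2, n3, m2, m3, m4]
      have hn' : [a, b, c, d, x, y].Nodup := by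
        simp [n1, n2, n3, m2, m3, m4, nxy, xa.symm, xb.symm, xc.symm, xd.symm, ya.symm, yb.symm,
          yc.symm, yd.symm]
      exact .inr (.inr (.inr ⟨x, xS, y, yS, hxy, a, aS, b, bS, c, cS, d, dS, hn',
        (inducedEq_four hm hn
          (returnsVia_lamXY hg xS yS hxy (by simp [*]) (by simp [*]))).2 ⟨o1, o2⟩,
        (inducedEq_two_two_two hp hn' (rp _)).2 ⟨hac, hbd, hy, hab, hxa, hxb⟩⟩))
  · rintro ((⟨a, -, b, -, c, -, hn, i1, i2⟩ | ⟨a, -, b, -, c, -, d, -, hn, i1, i2⟩) |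
      (⟨a, -, b, -, c, -, d, -, hn, i1, i2⟩ | ⟨x, xS, y, yS, hxy, a, -, b, -, c, -, hn, i1, i2⟩ |
        ⟨x, xS, y, yS, hxy, a, -, b, -, c, -, d, -, hn, i1, i2⟩))
    · exact .nonstd_three ((inducedEq_three hg hn (rg _)).1 i1) ((inducedEq_three hp hn (rp _)).1 i2)
    · obtain ⟨h1, h2, h3⟩ := (inducedEq_two_two hg hn (by simp) (rg _)).1 i1
      rw [perm4] at i2
      have hn' : [a, c, b, d].Nodup := by
        simp only [List.nodup_cons, List.mem_cons, List.not_mem_nil, not_or, or_false,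
          not_false_eq_true, List.nodup_nil, and_true] at hn ⊢
        tauto
      obtain ⟨o1, o2⟩ := (inducedEq_four hp hn' (rp _)).1 i2
      exact .nonstd_four h1 h2 h3 o1 o2
    · obtain ⟨o1, o2⟩ := (inducedEq_four hg hn (rg _)).1 i1
      have hn' : [a, c, b, d].Nodup := by
        simp only [List.nodup_cons, List.mem_cons, List.not_mem_nil, not_or, or_false,
          not_false_eq_true, List.nodup_nil, and_true] at hn ⊢
        tauto
      obtain ⟨h1, h2, h3⟩ := (inducedEq_two_two hp hn' (by simp; tauto) (rp _)).1 i2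
      exact .cross_four o1 o2 h1 h2 h3
    · obtain ⟨o2, h1, h2⟩ := (inducedEq_three_two hp hn (rp _)).1 i2
      simp only [List.nodup_cons, List.mem_cons, List.not_mem_nil, not_or, or_false,
          not_false_eq_true, List.nodup_nil, and_true] at hn
      obtain ⟨⟨hab, hac, hax, hay⟩, ⟨hbc, hbx, hby⟩, ⟨hcx, hcy⟩, -⟩ := hn
      have o1 := (inducedEq_three (mul_swap_mem hg xS yS) (by simp [*])
          (returnsVia_lamXY hg xS yS hxy (by simp [*, Ne.symm]) (by simp [*, Ne.symm]))).1 i1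
      exact .cross_five hxy o1 o2 h1 h2
    · obtain ⟨h1, h2, h3, h4, h5, h6⟩ := (inducedEq_two_two_two hp hn (rp _)).1 i2
      simp only [List.nodup_cons, List.mem_cons, List.not_mem_nil, not_or, or_false,
          not_false_eq_true, List.nodup_nil, and_true] at hn
      obtain ⟨⟨hab, hac, had, hax, hay⟩, ⟨hbc, hbd, hbx, hby⟩, ⟨hcd, hcx, hcy⟩, ⟨hdx, hdy⟩, -⟩ := hn
      obtain ⟨o1, o2⟩ := (inducedEq_four (mul_swap_mem hg xS yS) (by simp [*])
          (returnsVia_lamXY hg xS yS hxy (by simp [*, Ne.symm]) (by simp [*, Ne.symm]))).1 i1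
      exact .cross_six hxy o1 o2 h1 h2 h3 h4 h5 h6

/-! ### Counting cycles on unions and under conjugation -/

theorem sameCycle_iff_of_agree_on {A S S' : Finset ℤ} {g g' : Perm ℤ} (hg : g ∈ permsOn S)
    (hg' : g' ∈ permsOn S') (hA : ∀ k ∈ A, g k ∈ A) (h : ∀ k ∈ A, g' k = g k) {a : ℤ}
    (ha : a ∈ A) (b : ℤ) : g'.SameCycle a b ↔ g.SameCycle a b :=
  sameCycle_iff_of_agree hg hg' (fun z hz => h z (mem_of_sameCycle_invariant hg hA hz ha)) b

theorem numCycles_of_agree {A S S' : Finset ℤ} {g g' : Perm ℤ} (hg : g ∈ permsOn S)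
    (hg' : g' ∈ permsOn S') (hA : ∀ k ∈ A, g k ∈ A) (h : ∀ k ∈ A, g' k = g k) :
    numCycles A g' = numCycles A g :=
  numCycles_congr fun _ ha b => sameCycle_iff_of_agree_on hg hg' hA h ha b

theorem numCycles_union {A B S : Finset ℤ} {g : Perm ℤ} (hg : g ∈ permsOn S)
    (hA : ∀ k ∈ A, g k ∈ A) (hAB : Disjoint A B) :
    numCycles (A ∪ B) g = numCycles A g + numCycles B g := by
  rw [numCycles_eq_image, numCycles_eq_image, numCycles_eq_image, Finset.coe_union,
    Set.image_union, Set.ncard_union_eq _ (finite_orbits A g) (finite_orbits B g)]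
  rw [Set.disjoint_left]
  rintro _ ⟨a, ha, rfl⟩ ⟨b, hb, e⟩
  have := mem_of_sameCycle_invariant hg hA (orbitOf_eq_iff.1 e).symm ha
  exact (Finset.disjoint_left.1 hAB this) hb

theorem numCycles_union_of_agree {A B S : Finset ℤ} {q u v : Perm ℤ} (hAB : Disjoint A B)
    (hq : q ∈ permsOn S) (hu : u ∈ permsOn A) (hv : v ∈ permsOn B) (h1 : ∀ k ∈ A, q k = u k)
    (h2 : ∀ k ∈ B, q k = v k) : numCycles (A ∪ B) q = numCycles A u + numCycles B v := by
  rw [numCycles_union hq (fun k hk => by rw [h1 k hk]; exact apply_mem_of_permsOn hu hk) hAB,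
    numCycles_of_agree hu hq (fun k hk => apply_mem_of_permsOn hu hk) h1,
    numCycles_of_agree hv hq (fun k hk => apply_mem_of_permsOn hv hk) h2]

theorem numCycles_conj (A : Finset ℤ) (σ g : Perm ℤ) :
    numCycles (A.image σ) (σ * g * σ⁻¹) = numCycles A g := by
  rw [numCycles_eq_image, numCycles_eq_image, Finset.coe_image, Set.image_image]
  have : ∀ a, orbitOf (σ * g * σ⁻¹) (σ a) = (fun C => σ '' C) (orbitOf g a) := by
    intro a
    ext b
    simp only [orbitOf, Set.mem_image, Set.mem_ofPred_eq, sameCycle_conj]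
    constructor
    · intro h
      exact ⟨σ⁻¹ b, by simpa using h, by simp⟩
    · rintro ⟨c, hc, rfl⟩
      simpa using hc
  simp only [this]
  rw [← Set.image_image (fun C => σ '' C) (orbitOf g),
    Set.ncard_image_of_injective _ (Set.image_injective.2 σ.injective)]

theorem image_of_permsOn {A : Finset ℤ} {g : Perm ℤ} (hg : g ∈ permsOn A) : A.image g = A := by
  refine Finset.eq_of_subset_of_card_le ?_ (Finset.card_image_of_injective _ g.injective).ge
  intro k hk
  obtain ⟨j, hj, rfl⟩ := Finset.mem_image.1 hk
  exact apply_mem_of_permsOn hg hj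

theorem numCycles_mul_comm {A : Finset ℤ} {g h : Perm ℤ} (hh : h ∈ permsOn A) :
    numCycles A (h * g) = numCycles A (g * h) := by
  have := numCycles_conj A h (g * h)
  rw [image_of_permsOn hh] at this
  rw [← this]
  congr 1
  group

theorem numCycles_eq_one {A : Finset ℤ} {g : Perm ℤ} {a : ℤ} (ha : a ∈ A)
    (h : ∀ b ∈ A, g.SameCycle a b) : numCycles A g = 1 := by
  rw [numCycles_eq_image, Set.ncard_eq_one]
  refine ⟨orbitOf g a, ?_⟩
  ext C
  constructor
  · rintro ⟨b, hb, rfl⟩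
    exact orbitOf_eq_iff.2 (h b hb).symm
  · rintro rfl
    exact ⟨a, ha, rfl⟩

/-! ### Doubling permutations -/

theorem delta_apply (k : ℤ) : delta k = -k := rfl

theorem delta_mul_delta : delta * delta = 1 := by
  ext k; simp [delta_apply]

theorem delta_inv : delta⁻¹ = delta := inv_eq_of_mul_eq_one_left delta_mul_delta

theorem minus_apply (g : Perm ℤ) (k : ℤ) : minus g k = -g (-k) := rfl

theorem minus_inv (g : Perm ℤ) : (minus g)⁻¹ = minus g⁻¹ := by
  simp [minus, mul_inv_rev, delta_inv, mul_assoc]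

theorem minus_mul (g h : Perm ℤ) : minus (g * h) = minus g * minus h := by
  ext k; simp [minus_apply]

theorem minus_minus (g : Perm ℤ) : minus (minus g) = g := by
  ext k; simp [minus_apply]

/-- The double `π₊ π₋⁻¹` of a permutation. -/
def double (p : Perm ℤ) : Perm ℤ := p * (minus p)⁻¹

/-- `S` is the disjoint union of `T` and `-T`. -/
structure IsDouble (S T : Finset ℤ) : Prop where
  mem_iff : ∀ k, k ∈ S ↔ k ∈ T ∨ -k ∈ T
  not_neg_mem : ∀ k ∈ T, -k ∉ T

section Double

variable {S T : Finset ℤ} {p q : Perm ℤ}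

theorem IsDouble.subset (h : IsDouble S T) : T ⊆ S := fun k hk => (h.mem_iff k).2 (Or.inl hk)

theorem IsDouble.eq_union (h : IsDouble S T) : S = T ∪ T.image delta := by
  ext k
  rw [h.mem_iff, Finset.mem_union, Finset.mem_image]
  refine or_congr Iff.rfl ⟨fun hk => ⟨-k, hk, by rw [delta_apply, neg_neg]⟩, ?_⟩
  rintro ⟨j, hj, rfl⟩
  rwa [delta_apply, neg_neg]

theorem IsDouble.disjoint (h : IsDouble S T) : Disjoint T (T.image delta) := by
  rw [Finset.disjoint_left]
  intro k hk hk'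
  obtain ⟨j, hj, rfl⟩ := Finset.mem_image.1 hk'
  exact h.not_neg_mem _ hk (by rwa [delta_apply, neg_neg])

theorem IsDouble.card (h : IsDouble S T) : S.card = 2 * T.card := by
  rw [h.eq_union, Finset.card_union_of_disjoint h.disjoint,
    Finset.card_image_of_injective _ delta.injective, two_mul]

theorem minus_mem (hp : p ∈ permsOn T) : minus p ∈ permsOn (T.image delta) := by
  rw [mem_permsOn] at *
  intro k hk
  rw [minus_apply, hp, neg_neg]
  intro h
  exact hk (Finset.mem_image.2 ⟨-k, h, by rw [delta_apply, neg_neg]⟩)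

theorem numCycles_minus (T : Finset ℤ) (p : Perm ℤ) :
    numCycles (T.image delta) (minus p) = numCycles T p := by
  have := numCycles_conj T delta p
  rwa [delta_inv] at this

theorem apply_of_notMem (hp : p ∈ permsOn T) {k : ℤ} (hk : k ∉ T) : p k = k :=
  (mem_permsOn _ _).1 hp k hk

theorem double_apply_of_mem (h : IsDouble S T) (hp : p ∈ permsOn T) {k : ℤ} (hk : k ∈ T) :
    double p k = p k := by
  rw [double, minus_inv, Perm.mul_apply, minus_apply,
    apply_of_notMem (inv_mem_permsOn hp) (h.not_neg_mem k hk), neg_neg]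

theorem double_apply_of_neg_mem (h : IsDouble S T) (hp : p ∈ permsOn T) {k : ℤ} (hk : -k ∈ T) :
    double p k = -p⁻¹ (-k) := by
  rw [double, minus_inv, Perm.mul_apply, minus_apply]
  exact apply_of_notMem hp
    (h.not_neg_mem _ (apply_mem_of_permsOn (inv_mem_permsOn hp) hk))

theorem double_mem (h : IsDouble S T) (hp : p ∈ permsOn T) : double p ∈ permsOn S := by
  rw [double, h.eq_union]
  exact mul_mem_permsOn (permsOn_mono Finset.subset_union_left hp)
    (inv_mem_permsOn (permsOn_mono Finset.subset_union_right (minus_mem hp)))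

theorem eq_of_mem_image_delta {k : ℤ} (hk : k ∈ T.image delta) : -k ∈ T := by
  obtain ⟨j, hj, rfl⟩ := Finset.mem_image.1 hk
  rwa [delta_apply, neg_neg]

theorem numCycles_double (h : IsDouble S T) (hp : p ∈ permsOn T) :
    numCycles S (double p) = 2 * numCycles T p := by
  conv_lhs => rw [h.eq_union]
  rw [numCycles_union_of_agree h.disjoint (double_mem h hp) hp (minus_mem (inv_mem_permsOn hp))
    (fun k hk => double_apply_of_mem h hp hk)
    (fun k hk => double_apply_of_neg_mem h hp (eq_of_mem_image_delta hk)), numCycles_minus,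
    numCycles_inv, two_mul]

/-- The product acts on `T` as `p * q` and on the reflected half as the reflection of the inverse of
`q * p`; both have the same number of cycles. -/
theorem numCycles_double_mul (h : IsDouble S T) (hp : p ∈ permsOn T) (hq : q ∈ permsOn T) :
    numCycles S (double p * double q) = 2 * numCycles T (p * q) := by
  conv_lhs => rw [h.eq_union]
  have hqp := mul_mem_permsOn hq hp
  rw [numCycles_union_of_agree h.disjoint (mul_mem_permsOn (double_mem h hp) (double_mem h hq))
    (mul_mem_permsOn hp hq) (minus_mem (inv_mem_permsOn hqp)) ?_ ?_, numCycles_minus,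
    numCycles_inv, numCycles_mul_comm hq, two_mul]
  · intro k hk
    rw [Perm.mul_apply, double_apply_of_mem h hq hk,
      double_apply_of_mem h hp (apply_mem_of_permsOn hq hk), Perm.mul_apply]
  · intro k hk
    have hk := eq_of_mem_image_delta hk
    rw [Perm.mul_apply, double_apply_of_neg_mem h hq hk, double_apply_of_neg_mem h hp, neg_neg,
      minus_apply, mul_inv_rev, Perm.mul_apply]
    rw [neg_neg]
    exact apply_mem_of_permsOn (inv_mem_permsOn hq) hk

theorem double_injOn (h : IsDouble S T) (hp : p ∈ permsOn T) (hq : q ∈ permsOn T)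
    (e : double p = double q) : p = q := by
  ext k
  by_cases hk : k ∈ T
  · rw [← double_apply_of_mem h hp hk, e, double_apply_of_mem h hq hk]
  · rw [apply_of_notMem hp hk, apply_of_notMem hq hk]

/-! ### Annular noncrossing permutations and doubles -/

theorem mem_annNC {a : Perm ℤ} : p ∈ annNC T a ↔
    p ∈ permsOn T ∧ Transitive T a p ∧ ¬ AnnNonstandard T a p ∧ ¬ AnnCrossing T a p := by
  simp only [annNC, Finset.mem_filter]

/-- Without a link every element of the generated group preserves each cycle of `a`, so transitivity
would leave only one cycle. -/
theorem exists_link_of_transitive {a : Perm ℤ} (hp : p ∈ permsOn T) (h2 : numCycles T a ≠ 1)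
    (hT : T.Nonempty) (h : Transitive T a p) : ∃ x ∈ T, ¬ a.SameCycle x (p x) := by
  by_contra hcon
  push Not at hcon
  obtain ⟨s, hs⟩ := hT
  refine h2 (numCycles_eq_one hs fun b hb => ?_)
  obtain ⟨g, hg, rfl⟩ := h s hs b hb
  have : ∀ z, a.SameCycle z (g z) := by
    clear hb
    induction hg using Subgroup.closure_induction with
    | mem g hg =>
      intro z
      rcases hg with rfl | rfl
      · exact sameCycle_apply_self _ z
      · by_cases hz : z ∈ T
        · exact hcon z hz
        · rw [apply_of_notMem hp hz]
    | one => exact fun z => SameCycle.refl _ _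
    | mul g h _ _ hg hh => exact fun z => (hh z).trans (hg _)
    | inv g _ hg =>
      intro z
      have := hg (g⁻¹ z)
      rw [show g (g⁻¹ z) = z by simp] at this
      exact this.symm
  exact this s

theorem transitive_of_link {a : Perm ℤ}
    (h2 : numCycles T a = 2) {j k : ℤ} (hj : j ∈ T) (hk : k ∈ T) (hjk : ¬ a.SameCycle j k)
    (hl : p.SameCycle j k) : Transitive T a p := by
  have reach : ∀ z ∈ T, ∃ g ∈ Subgroup.closure ({a, p} : Set (Perm ℤ)), g j = z := by
    have am : a ∈ Subgroup.closure ({a, p} : Set (Perm ℤ)) := Subgroup.subset_closure (by simp)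
    have pm : p ∈ Subgroup.closure ({a, p} : Set (Perm ℤ)) := Subgroup.subset_closure (by simp)
    intro z hz
    rcases sameCycle_or_of_numCycles_eq_two h2 hj hk hz hjk with ⟨i, hi⟩ | ⟨i, hi⟩
    · exact ⟨a ^ i, Subgroup.zpow_mem _ am i, hi⟩
    · obtain ⟨l, hl⟩ := hl
      exact ⟨a ^ i * p ^ l, Subgroup.mul_mem _ (Subgroup.zpow_mem _ am i)
        (Subgroup.zpow_mem _ pm l), by rw [Perm.mul_apply, hl, hi]⟩
  intro x hx y hy
  obtain ⟨g, hg, rfl⟩ := reach x hx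
  obtain ⟨h, hh, rfl⟩ := reach y hy
  exact ⟨h * g⁻¹, Subgroup.mul_mem _ hh (Subgroup.inv_mem _ hg), by simp⟩

theorem connected_of_link {a : Perm ℤ} (ha : a ∈ permsOn T) (hp : p ∈ permsOn T)
    (h2 : numCycles T a = 2) {j k : ℤ} (hj : j ∈ T) (hk : k ∈ T) (hjk : ¬ a.SameCycle j k)
    (hl : p.SameCycle j k) : Connected T a p := by
  rintro U hU ⟨u, hu⟩ hinv
  have ia := fun z hz => (hinv z hz).1
  have ip := fun z hz => (hinv z hz).2
  have hiff : j ∈ U ∧ k ∈ U := by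
    rcases sameCycle_or_of_numCycles_eq_two h2 hj hk (hU hu) hjk with h | h
    · have := mem_of_sameCycle_invariant ha ia h.symm hu
      exact ⟨this, mem_of_sameCycle_invariant hp ip hl this⟩
    · have := mem_of_sameCycle_invariant ha ia h.symm hu
      exact ⟨mem_of_sameCycle_invariant hp ip hl.symm this, this⟩
  refine Finset.Subset.antisymm hU fun z hz => ?_
  rcases sameCycle_or_of_numCycles_eq_two h2 hj hk hz hjk with h | h
  · exact mem_of_sameCycle_invariant ha ia h hiff.1
  · exact mem_of_sameCycle_invariant ha ia h hiff.2

theorem exists_step_of_link {a : Perm ℤ} (hp : p ∈ permsOn T) {j k : ℤ} (hj : j ∈ T)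
    (hjk : ¬ a.SameCycle j k) (hl : p.SameCycle j k) : ∃ x ∈ T, ¬ a.SameCycle x (p x) := by
  by_contra hcon
  push Not at hcon
  obtain ⟨n, rfl⟩ := (sameCycle_iff_exists_pow hp).1 hl
  have : ∀ n : ℕ, (p ^ n) j ∈ T ∧ a.SameCycle j ((p ^ n) j) := by
    intro n
    induction n with
    | zero => exact ⟨hj, SameCycle.refl _ _⟩
    | succ n ih =>
      rw [pow_succ', Perm.mul_apply]
      exact ⟨apply_mem_of_permsOn hp ih.1, ih.2.trans (hcon _ ih.1)⟩
  exact hjk (this n).2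

/-- A link makes the pair transitive, so the remaining conditions are exactly the absence of
forbidden patterns, that is, planarity. -/
theorem mem_annNC_iff {a : Perm ℤ} (ha : a ∈ permsOn T) (hp : p ∈ permsOn T)
    (h2 : numCycles T a = 2) {j k : ℤ} (hj : j ∈ T) (hk : k ∈ T) (hjk : ¬ a.SameCycle j k)
    (hl : p.SameCycle j k) :
    p ∈ annNC T a ↔ numCycles T p + numCycles T (a * p) = T.card := by
  rw [mem_annNC, planar_iff_not_forbidden ha hp h2 (exists_step_of_link hp hj hjk hl),
    forbidden_iff ha hp, not_or]
  exact ⟨fun h => h.2.2, fun h => ⟨hp, transitive_of_link h2 hj hk hjk hl, h⟩⟩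

theorem exists_link_of_mem_annNC {a : Perm ℤ} (h2 : numCycles T a = 2) (h : p ∈ annNC T a) :
    ∃ j ∈ T, ∃ k ∈ T, ¬ a.SameCycle j k ∧ p.SameCycle j k := by
  rw [mem_annNC] at h
  have hT : T.Nonempty := by
    rw [Finset.nonempty_iff_ne_empty]
    rintro rfl
    rw [numCycles_eq_image] at h2
    simp at h2
  obtain ⟨x, hx, hl⟩ := exists_link_of_transitive h.1 (by omega) hT h.2.1
  exact ⟨x, hx, p x, apply_mem_of_permsOn h.1 hx, hl, sameCycle_apply_self p x⟩

/-- The restriction of `q` to an invariant set. -/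
theorem exists_restriction {q : Perm ℤ} (hq : q ∈ permsOn S) (hT : ∀ k ∈ T, q k ∈ T) :
    ∃ p ∈ permsOn T, ∀ k ∈ T, p k = q k := by
  have h1 : ∀ k, q k ∈ T ↔ k ∈ T := fun k =>
    ⟨fun h => mem_of_sameCycle_invariant hq hT (sameCycle_apply_self q k).symm h, hT k⟩
  refine ⟨Perm.ofSubtype (q.subtypePerm h1), ?_, ?_⟩
  · rw [mem_permsOn]
    intro k hk
    exact Perm.ofSubtype_apply_of_not_mem _ hk
  · intro k hk
    rw [Perm.ofSubtype_apply_of_mem _ hk]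
    rfl

theorem sameCycle_neg (hq : delta * q * delta = q⁻¹) {j k : ℤ} (h : q.SameCycle j k) :
    q.SameCycle (-j) (-k) := by
  have : (delta * q * delta⁻¹).SameCycle (delta j) (delta k) := h.conj
  rw [delta_inv, hq, sameCycle_inv] at this
  exact this

/-- Self-duality determines `q` on the reflected half from its values on `T`. -/
theorem eq_double_of_restriction (h : IsDouble S T) (hq : q ∈ permsOn S)
    (hd : delta * q * delta = q⁻¹) (hp : p ∈ permsOn T) (hpq : ∀ k ∈ T, p k = q k) :
    q = double p := by
  ext k
  by_cases hk : k ∈ T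
  · rw [double_apply_of_mem h hp hk, hpq k hk]
  · by_cases hk' : -k ∈ T
    · rw [double_apply_of_neg_mem h hp hk']
      have h1 := apply_mem_of_permsOn (inv_mem_permsOn hp) hk'
      have h2 := hpq _ h1
      rw [show p (p⁻¹ (-k)) = -k by simp] at h2
      have h3 : q⁻¹ (-k) = p⁻¹ (-k) := by rw [Perm.inv_eq_iff_eq, ← h2]
      rw [← h3, ← hd, Perm.mul_apply, Perm.mul_apply, delta_apply, delta_apply, neg_neg, neg_neg]
    · rw [apply_of_notMem (double_mem h hp), apply_of_notMem hq] <;>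
        rw [h.mem_iff] <;> tauto

theorem double_self_dual (a : Perm ℤ) : delta * double a * delta = (double a)⁻¹ := by
  change minus (double a) = _
  rw [double, minus_mul, ← minus_inv (minus a), minus_minus, mul_inv_rev, inv_inv]

/-- The genus inequality for a self-dual permutation `q` of `±T`, and the case of equality. -/
theorem self_dual_genus {a : Perm ℤ} (h : IsDouble S T) (ha : a ∈ permsOn T)
    (h2 : numCycles T a = 2) (hq : q ∈ permsOn S) (hd : delta * q * delta = q⁻¹) {j k : ℤ}
    (hj : j ∈ T) (hk : k ∈ T) (hjk : ¬ a.SameCycle j k) (hl : q.SameCycle j k) :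
    numCycles S q + numCycles S (double a * q) ≤ S.card ∧
      (numCycles S q + numCycles S (double a * q) = S.card → ∃ p ∈ annNC T a, q = double p) := by
  have hda := double_mem h ha
  by_cases hc : Connected S (double a) q
  -- The double of `a` has four cycles, so the genus inequality gives |S| − 2 and equality is
  -- impossible.
  · have := numCycles_add_le_of_connected hda hq ⟨j, h.subset hj⟩ hc
    rw [numCycles_double h ha, h2] at this
    omega
  · unfold Connected at hc
    push Not at hc
    obtain ⟨U, hUS, hU0, hinv, hne⟩ := hc
    have ia := fun z hz => (hinv z hz).1
    have ip := fun z hz => (hinv z hz).2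
    have hjk' : j ∈ U ↔ k ∈ U :=
      ⟨mem_of_sameCycle_invariant hq ip hl, mem_of_sameCycle_invariant hq ip hl.symm⟩
    have hnl := sameCycle_neg hd hl
    have hnjk : -j ∈ U ↔ -k ∈ U :=
      ⟨mem_of_sameCycle_invariant hq ip hnl, mem_of_sameCycle_invariant hq ip hnl.symm⟩
    have tr : ∀ u z, u ∈ T → a.SameCycle u z → ((u ∈ U ↔ z ∈ U) ∧ (-u ∈ U ↔ -z ∈ U)) := by
      intro u z hu huz
      have h1 : (double a).SameCycle u z :=
        (sameCycle_iff_of_agree_on ha hda (fun k hk => apply_mem_of_permsOn ha hk)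
          (fun k hk => double_apply_of_mem h ha hk) hu z).2 huz
      have h2 := sameCycle_neg (double_self_dual a) h1
      exact ⟨⟨mem_of_sameCycle_invariant hda ia h1, mem_of_sameCycle_invariant hda ia h1.symm⟩,
        ⟨mem_of_sameCycle_invariant hda ia h2, mem_of_sameCycle_invariant hda ia h2.symm⟩⟩
    have all : ∀ z ∈ T, (z ∈ U ↔ j ∈ U) ∧ (-z ∈ U ↔ -j ∈ U) := by
      intro z hz
      rcases sameCycle_or_of_numCycles_eq_two h2 hj hk hz hjk with e | e
      · exact ⟨(tr j z hj e).1.symm, (tr j z hj e).2.symm⟩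
      · exact ⟨(tr k z hk e).1.symm.trans hjk'.symm, (tr k z hk e).2.symm.trans hnjk.symm⟩
    -- By the link and its reflection, `U` contains all or nothing of `T`, and all or nothing of its
    -- negative. Being proper and nonempty, it is one of the two halves.
    have hxor : (j ∈ U ∧ -j ∉ U) ∨ (j ∉ U ∧ -j ∈ U) := by
      by_cases c1 : j ∈ U <;> by_cases c2 : -j ∈ U
      · exfalso
        refine hne (Finset.Subset.antisymm hUS fun z hz => ?_)
        rcases (h.mem_iff z).1 hz with hz | hz
        · exact (all z hz).1.2 c1
        · have := (all _ hz).2.2 c2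
          rwa [neg_neg] at this
      · exact Or.inl ⟨c1, c2⟩
      · exact Or.inr ⟨c1, c2⟩
      · exfalso
        obtain ⟨z, hz⟩ := hU0
        rcases (h.mem_iff z).1 (hUS hz) with hz' | hz'
        · exact c1 ((all z hz').1.1 hz)
        · exact c2 ((all _ hz').2.1 (by rwa [neg_neg]))
    have hTinv : ∀ z ∈ T, q z ∈ T := by
      intro z hz
      have hqS := apply_mem_of_permsOn hq (h.subset hz)
      have hqU : q z ∈ U ↔ z ∈ U :=
        ⟨mem_of_sameCycle_invariant hq ip (sameCycle_apply_self q z).symm, ip z⟩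
      rcases (h.mem_iff _).1 hqS with h' | h'
      · exact h'
      · have h3 := (all z hz).1
        have h4 := (all _ h').2
        rw [neg_neg] at h4
        tauto
    -- All counts on `S` are now twice those on `T`, where `a` has two cycles and the genus
    -- inequality reads #(p) + #(a * p) ≤ |T|.
    obtain ⟨p, hp, hpq⟩ := exists_restriction hq hTinv
    have hqp := eq_double_of_restriction h hq hd hp hpq
    have hl' : p.SameCycle j k :=
      (sameCycle_iff_of_agree_on hq hp hTinv hpq hj k).2 hl
    have hconn := numCycles_add_le_of_connected ha hp ⟨j, hj⟩
      (connected_of_link ha hp h2 hj hk hjk hl')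
    have hm := mem_annNC_iff ha hp h2 hj hk hjk hl'
    rw [hqp, numCycles_double h hp, numCycles_double_mul h ha hp, h.card]
    exact ⟨by omega, fun e => ⟨p, hm.2 (by omega), rfl⟩⟩

theorem double_annNC_genus {a : Perm ℤ} (h : IsDouble S T) (ha : a ∈ permsOn T)
    (h2 : numCycles T a = 2) (hp : p ∈ annNC T a) :
    numCycles S (double p) + numCycles S (double a * double p) = S.card := by
  obtain ⟨j, hj, k, hk, hjk, hl⟩ := exists_link_of_mem_annNC h2 hp
  have hp' := (mem_annNC.1 hp).1
  have := (mem_annNC_iff ha hp' h2 hj hk hjk hl).1 hp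
  rw [numCycles_double h hp', numCycles_double_mul h ha hp', h.card]
  omega

theorem double_sameCycle (h : IsDouble S T) (hp : p ∈ permsOn T) {j : ℤ} (hj : j ∈ T) (k : ℤ) :
    (double p).SameCycle j k ↔ p.SameCycle j k :=
  sameCycle_iff_of_agree_on hp (double_mem h hp) (fun _ hk => apply_mem_of_permsOn hp hk)
    (fun _ hk => double_apply_of_mem h hp hk) hj k

end Double

/-! ### Premaps -/

theorem mem_pos {I : Finset ℕ} {k : ℤ} : k ∈ pos I ↔ 0 ≤ k ∧ k.natAbs ∈ I := by
  simp only [pos, Finset.mem_image]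
  constructor
  · rintro ⟨a, ha, rfl⟩; exact ⟨by omega, by simpa using ha⟩
  · rintro ⟨h0, h⟩; exact ⟨_, h, by omega⟩

theorem mem_neg {I : Finset ℕ} {k : ℤ} : k ∈ neg I ↔ k ≤ 0 ∧ k.natAbs ∈ I := by
  simp only [neg, Finset.mem_image]
  constructor
  · rintro ⟨a, ha, rfl⟩; exact ⟨by omega, by simpa using ha⟩
  · rintro ⟨h0, h⟩; exact ⟨_, h, by omega⟩

theorem mem_pm {I : Finset ℕ} {k : ℤ} : k ∈ pm I ↔ k.natAbs ∈ I := by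
  rw [pm, Finset.mem_union, mem_pos, mem_neg]
  have := le_total 0 k
  tauto

theorem neg_mem_pm {I : Finset ℕ} {k : ℤ} : -k ∈ pm I ↔ k ∈ pm I := by
  rw [mem_pm, mem_pm, Int.natAbs_neg]

theorem isDouble_pos {I : Finset ℕ} (hI : 0 ∉ I) : IsDouble (pm I) (pos I) := by
  constructor
  · intro k
    rw [mem_pm, mem_pos, mem_pos, Int.natAbs_neg, ← or_and_right]
    simp only [iff_and_self]
    intro _
    omega
  · intro k hk hk'
    rw [mem_pos] at hk hk'
    have : k = 0 := by omega
    rw [this] at hk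
    exact hI hk.2

theorem IsPremap.self_dual {I : Finset ℕ} {q : Perm ℤ} (h : IsPremap I q) :
    delta * q * delta = q⁻¹ := by
  ext k
  rw [Perm.mul_apply, Perm.mul_apply, delta_apply, delta_apply]
  by_cases hk : k ∈ pm I
  · rw [h.2.1 _ (neg_mem_pm.2 hk), neg_neg, neg_neg]
  · rw [apply_of_notMem h.1 (fun h' => hk (neg_mem_pm.1 h')), neg_neg,
      apply_of_notMem (inv_mem_permsOn h.1) hk]

theorem isPremap_of_self_dual {I : Finset ℕ} {q : Perm ℤ} (hq : q ∈ permsOn (pm I))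
    (hd : delta * q * delta = q⁻¹) (h : ∀ k ∈ pm I, ¬ q.SameCycle k (-k)) : IsPremap I q := by
  refine ⟨hq, fun k _ => ?_, h⟩
  rw [← hd, Perm.mul_apply, Perm.mul_apply, delta_apply, delta_apply, neg_neg, neg_neg]

/-- Negation pairs the cycles, and no cycle is its own partner; hence their number vanishes modulo
2. -/
theorem IsPremap.even_numCycles {I : Finset ℕ} {q : Perm ℤ} (h : IsPremap I q) :
    Even (numCycles (pm I) q) := by
  classical
  have hn : ∀ k, (fun C => delta '' C) (orbitOf q k) = orbitOf q (-k) := by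
    intro k
    ext b
    simp only [orbitOf, Set.mem_image, Set.mem_ofPred_eq]
    constructor
    · rintro ⟨c, hc, rfl⟩
      exact sameCycle_neg h.self_dual hc
    · intro hb
      refine ⟨-b, ?_, neg_neg b⟩
      have := sameCycle_neg h.self_dual hb
      rwa [neg_neg] at this
  rw [numCycles_eq_image, Set.ncard_eq_toFinset_card _ (finite_orbits _ _), ← ZMod.natCast_eq_zero_iff_even,
    Finset.card_eq_sum_ones, Nat.cast_sum]
  refine Finset.sum_involution (fun C _ => delta '' C) ?_ ?_ ?_ ?_
  · intro C _
    norm_num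
    decide
  · intro C hC _ e
    rw [Set.Finite.mem_toFinset] at hC
    obtain ⟨k, hk, rfl⟩ := hC
    rw [show delta '' orbitOf q k = orbitOf q (-k) from hn k] at e
    exact h.2.2 k hk (orbitOf_eq_iff.1 e.symm)
  · intro C hC
    rw [Set.Finite.mem_toFinset] at *
    obtain ⟨k, hk, rfl⟩ := hC
    exact ⟨-k, by simpa [neg_mem_pm] using hk, (hn k).symm⟩
  · intro C hC
    rw [Set.image_image]
    simp [delta_apply]

/-- A self-dual path from `k` to its negative can be shortened by one step at each end and still
joins a point to its negative. Even length would end at a point equal to its own negative, so the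
path shrinks to a single step. -/
theorem exists_flip_of_pow {q : Perm ℤ} (hd : delta * q * delta = q⁻¹) (n : ℕ) :
    ∀ k, k ≠ 0 → q 0 = 0 → (q ^ n) k = -k → ∃ x, q.SameCycle k x ∧ q x = -x := by
  induction n using Nat.twoStepInduction with
  | zero => intro k hk _ h; simp at h; omega
  | one => intro k _ _ h; exact ⟨k, SameCycle.refl _ _, by simpa using h⟩
  | more n ih _ =>
    intro k hk h0 h
    have h1 : q ((q ^ n) (q k)) = -k := by
      rw [← h, pow_succ', pow_succ]; rfl
    have h2 : (q ^ n) (q k) = -(q k) := by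
      rw [← Perm.eq_inv_iff_eq] at h1
      rw [h1, ← hd, Perm.mul_apply, Perm.mul_apply, delta_apply, delta_apply, neg_neg]
    obtain ⟨x, hx, hx'⟩ := ih (q k) (fun e => hk (q.injective (e.trans h0.symm))) h0 h2
    exact ⟨x, (sameCycle_apply_self q k).trans hx, hx'⟩

/-! ### The Euler characteristic as an exact count -/

section Chi

variable {I : Finset ℕ} {g q : Perm ℤ}

theorem pos_subset_pm (I : Finset ℕ) : pos I ⊆ pm I := Finset.subset_union_left

theorem minus_mem_pm (hg : g ∈ permsOn (pm I)) : minus g ∈ permsOn (pm I) := by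
  rw [mem_permsOn] at *
  intro k hk
  rw [minus_apply, hg _ (fun h => hk (neg_mem_pm.1 h)), neg_neg]

/-- Self-duality is formal. A cycle containing a point and its negative would give a point `x`
mapped to its negative, and then `q` would map `g x` to its negative. -/
theorem isPremap_mul_mul (hI : 0 ∉ I) (hg : g ∈ permsOn (pm I)) (h : IsPremap I q) :
    IsPremap I ((minus g)⁻¹ * q * g) := by
  have hmem : (minus g)⁻¹ * q * g ∈ permsOn (pm I) :=
    mul_mem_permsOn (mul_mem_permsOn (inv_mem_permsOn (minus_mem_pm hg)) h.1) hg
  have h0 : (0 : ℤ) ∉ pm I := by rw [mem_pm]; exact hI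
  have hd : delta * ((minus g)⁻¹ * q * g) * delta = ((minus g)⁻¹ * q * g)⁻¹ := by
    change minus _ = _
    rw [minus_mul, minus_mul, ← minus_inv, minus_minus, show minus q = q⁻¹ from h.self_dual]
    simp only [mul_inv_rev, inv_inv, mul_assoc]
  refine isPremap_of_self_dual hmem hd fun k hk hs => ?_
  have hk0 : k ≠ 0 := by rintro rfl; exact h0 hk
  obtain ⟨n, hn⟩ := (sameCycle_iff_exists_pow hmem).1 hs
  obtain ⟨x, hx, hx'⟩ := exists_flip_of_pow hd n k hk0 (apply_of_notMem hmem h0) hn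
  have hxI := mem_of_sameCycle hmem hx hk
  rw [mul_assoc, Perm.mul_apply, Perm.inv_eq_iff_eq, minus_apply, neg_neg, Perm.mul_apply] at hx'
  exact h.2.2 _ (apply_mem_of_permsOn hg hxI) ⟨1, by rw [zpow_one, hx']⟩

/-- The Euler characteristic without divisions. -/
theorem two_mul_chi (hI : 0 ∉ I) (hg : g ∈ permsOn (pos I)) (h : IsPremap I q) :
    2 * chi I g q = 2 * numCycles (pos I) g + numCycles (pm I) q +
      numCycles (pm I) (double g * q) - 2 * I.card := by
  have hg' := permsOn_mono (pos_subset_pm I) hg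
  have e1 : numCycles (pm I) (g * (minus g)⁻¹) = 2 * numCycles (pos I) g :=
    numCycles_double (isDouble_pos hI) hg
  have e2 := h.even_numCycles
  have e3 := (isPremap_mul_mul hI hg' h).even_numCycles
  have e4 : numCycles (pm I) (g⁻¹ * q⁻¹ * minus g) = numCycles (pm I) ((minus g)⁻¹ * q * g) := by
    rw [← numCycles_inv]
    simp only [mul_inv_rev, inv_inv, mul_assoc]
  -- The two permutations are conjugate by `g`.
  have e5 : numCycles (pm I) (double g * q) = numCycles (pm I) ((minus g)⁻¹ * q * g) := by
    rw [double, mul_assoc, numCycles_mul_comm hg']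
  rw [chi, e1, e4, e5]
  obtain ⟨a, ha⟩ := e2
  obtain ⟨b, hb⟩ := e3
  rw [ha, hb]
  push_cast
  omega

end Chi

/-! ### Conjugation by signs -/

section Sign

variable (ε : ℕ → ℤˣ)

theorem deltaSign_apply (k : ℤ) : deltaSign ε k = (ε k.natAbs : ℤ) * k := rfl

theorem deltaSign_eq_or (k : ℤ) : deltaSign ε k = k ∨ deltaSign ε k = -k := by
  rw [deltaSign_apply]
  rcases Int.units_eq_one_or (ε k.natAbs) with h | h <;> simp [h]

theorem natAbs_deltaSign (k : ℤ) : (deltaSign ε k).natAbs = k.natAbs := by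
  rcases deltaSign_eq_or ε k with h | h <;> rw [h]
  exact Int.natAbs_neg k

theorem deltaSign_mul_self : deltaSign ε * deltaSign ε = 1 := by
  ext k
  rw [Perm.mul_apply, deltaSign_apply, natAbs_deltaSign, deltaSign_apply, ← mul_assoc]
  rcases Int.units_eq_one_or (ε k.natAbs) with h | h <;> simp [h]

theorem deltaSign_inv : (deltaSign ε)⁻¹ = deltaSign ε :=
  inv_eq_of_mul_eq_one_left (deltaSign_mul_self ε)

theorem signConj_eq (q : Perm ℤ) : signConj ε q = deltaSign ε * q * (deltaSign ε)⁻¹ := by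
  rw [deltaSign_inv]; rfl

theorem deltaSign_neg (k : ℤ) : deltaSign ε (-k) = -deltaSign ε k := by
  rw [deltaSign_apply, deltaSign_apply, Int.natAbs_neg, mul_neg]

theorem signConj_mul (p q : Perm ℤ) : signConj ε (p * q) = signConj ε p * signConj ε q := by
  simp only [signConj_eq]; group

theorem signConj_inv (p : Perm ℤ) : signConj ε p⁻¹ = (signConj ε p)⁻¹ := by
  simp only [signConj_eq]; group

theorem signConj_signConj (q : Perm ℤ) : signConj ε (signConj ε q) = q := by
  rw [signConj_eq, signConj, mul_assoc, mul_assoc, mul_inv_cancel, mul_one, ← mul_assoc,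
    deltaSign_mul_self, one_mul]

theorem signConj_injective : Function.Injective (signConj ε) :=
  Function.LeftInverse.injective (signConj_signConj ε)

theorem signConj_sameCycle {q : Perm ℤ} {j k : ℤ} :
    (signConj ε q).SameCycle j k ↔ q.SameCycle (deltaSign ε j) (deltaSign ε k) := by
  rw [signConj_eq, sameCycle_conj, deltaSign_inv]

theorem deltaSign_mem_pm {I : Finset ℕ} {k : ℤ} : deltaSign ε k ∈ pm I ↔ k ∈ pm I := by
  rw [mem_pm, mem_pm, natAbs_deltaSign]

theorem connects_signConj {q : Perm ℤ} {J K : Finset ℕ} :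
    Connects (signConj ε q) (pm J) (pm K) ↔ Connects q (pm J) (pm K) := by
  have key : ∀ q : Perm ℤ, Connects q (pm J) (pm K) → Connects (signConj ε q) (pm J) (pm K) := by
    rintro q ⟨j, hj, k, hk, h⟩
    refine ⟨deltaSign ε j, (deltaSign_mem_pm ε).2 hj, deltaSign ε k, (deltaSign_mem_pm ε).2 hk, ?_⟩
    rw [signConj_sameCycle, ← Perm.mul_apply, ← Perm.mul_apply, deltaSign_mul_self]
    exact h
  exact ⟨fun h => by simpa only [signConj_signConj] using key _ h, key q⟩

theorem isPremap_signConj {I : Finset ℕ} {q : Perm ℤ} (h : IsPremap I q) :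
    IsPremap I (signConj ε q) := by
  refine isPremap_of_self_dual ?_ ?_ ?_
  · rw [mem_permsOn]
    intro k hk
    rw [signConj, Perm.mul_apply, Perm.mul_apply, apply_of_notMem h.1, ← Perm.mul_apply,
      deltaSign_mul_self]
    · rfl
    · rwa [deltaSign_mem_pm]
  · have hc : delta * deltaSign ε = deltaSign ε * delta := by
      ext k
      rw [Perm.mul_apply, Perm.mul_apply, delta_apply, delta_apply, deltaSign_neg]
    calc delta * signConj ε q * delta
        = (delta * deltaSign ε) * q * (deltaSign ε * delta) := by simp only [signConj, mul_assoc]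
      _ = (deltaSign ε * delta) * q * (delta * deltaSign ε) := by rw [hc]
      _ = deltaSign ε * (delta * q * delta) * deltaSign ε := by
          simp only [mul_assoc]
      _ = (signConj ε q)⁻¹ := by rw [h.self_dual, ← signConj_inv]; rfl
  · intro k hk hs
    rw [signConj_sameCycle, deltaSign_neg] at hs
    exact h.2.2 _ ((deltaSign_mem_pm ε).2 hk) hs

end Sign

/-! ### Additivity of the Euler characteristic -/

section Additive

variable {I J K : Finset ℕ}

theorem pm_union (J K : Finset ℕ) : pm (J ∪ K) = pm J ∪ pm K := by
  ext k; simp only [mem_pm, Finset.mem_union]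

theorem pos_union (J K : Finset ℕ) : pos (J ∪ K) = pos J ∪ pos K := by
  ext k; simp only [mem_pos, Finset.mem_union]; tauto

theorem disjoint_pm (h : Disjoint J K) : Disjoint (pm J) (pm K) := by
  rw [Finset.disjoint_left] at *
  intro k hk hk'
  exact h (mem_pm.1 hk) (mem_pm.1 hk')

theorem disjoint_pos (h : Disjoint J K) : Disjoint (pos J) (pos K) :=
  (disjoint_pm h).mono (pos_subset_pm _) (pos_subset_pm _)

theorem mul_apply_left {A B : Finset ℤ} (h : Disjoint A B) (p : Perm ℤ) {q : Perm ℤ}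
    (hq : q ∈ permsOn B) {k : ℤ} (hk : k ∈ A) : (p * q) k = p k := by
  rw [Perm.mul_apply, apply_of_notMem hq (Finset.disjoint_left.1 h hk)]

theorem mul_apply_right {A B : Finset ℤ} (h : Disjoint A B) {p q : Perm ℤ}
    (hp : p ∈ permsOn A) (hq : q ∈ permsOn B) {k : ℤ} (hk : k ∈ B) : (p * q) k = q k := by
  rw [Perm.mul_apply, apply_of_notMem hp
    (Finset.disjoint_right.1 h (apply_mem_of_permsOn hq hk))]

theorem mul_mem_union {A B : Finset ℤ} {p q : Perm ℤ}
    (hp : p ∈ permsOn A) (hq : q ∈ permsOn B) : p * q ∈ permsOn (A ∪ B) :=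
  mul_mem_permsOn (permsOn_mono Finset.subset_union_left hp)
    (permsOn_mono Finset.subset_union_right hq)

theorem numCycles_mul_of_disjoint {A B : Finset ℤ} (h : Disjoint A B) {p q : Perm ℤ}
    (hp : p ∈ permsOn A) (hq : q ∈ permsOn B) :
    numCycles (A ∪ B) (p * q) = numCycles A p + numCycles B q :=
  numCycles_union_of_agree h (mul_mem_union hp hq) hp hq
    (fun _ hk => mul_apply_left h p hq hk) (fun _ hk => mul_apply_right h hp hq hk)

theorem commute_of_disjoint {A B : Finset ℤ} (h : Disjoint A B) {p q : Perm ℤ}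
    (hp : p ∈ permsOn A) (hq : q ∈ permsOn B) : p * q = q * p := by
  ext k
  by_cases hA : k ∈ A
  · rw [mul_apply_left h p hq hA, mul_apply_right h.symm hq hp hA]
  · by_cases hB : k ∈ B
    · rw [mul_apply_right h hp hq hB, mul_apply_left h.symm q hp hB]
    · rw [Perm.mul_apply, Perm.mul_apply, apply_of_notMem hp hA, apply_of_notMem hq hB,
        apply_of_notMem hp hA]

theorem double_mem_pm {I : Finset ℕ} {g : Perm ℤ} (hg : g ∈ permsOn (pos I)) :
    double g ∈ permsOn (pm I) :=
  mul_mem_permsOn (permsOn_mono (pos_subset_pm I) hg)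
    (inv_mem_permsOn (minus_mem_pm (permsOn_mono (pos_subset_pm I) hg)))

theorem double_mul_of_disjoint (hJK : Disjoint J K) {g g' : Perm ℤ} (hg : g ∈ permsOn (pos J))
    (hg' : g' ∈ permsOn (pos K)) : double (g * g') = double g * double g' := by
  have h1 := commute_of_disjoint (disjoint_pm hJK)
    (minus_mem_pm (permsOn_mono (pos_subset_pm J) hg))
    (minus_mem_pm (permsOn_mono (pos_subset_pm K) hg'))
  have h2 := commute_of_disjoint (disjoint_pm hJK)
    (inv_mem_permsOn (minus_mem_pm (permsOn_mono (pos_subset_pm J) hg)))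
    (permsOn_mono (pos_subset_pm K) hg')
  rw [double, double, double, minus_mul, h1, mul_inv_rev, mul_assoc, mul_assoc g,
    ← mul_assoc (minus g)⁻¹, h2, mul_assoc g']

/-- Each of the three cycle counts, as well as |I|, is additive over disjoint supports. -/
theorem chi_mul (hJ : 0 ∉ J) (hK : 0 ∉ K) (hJK : Disjoint J K) {g g' q q' : Perm ℤ}
    (hg : g ∈ permsOn (pos J)) (hg' : g' ∈ permsOn (pos K)) (hq : IsPremap J q)
    (hq' : IsPremap K q') (hqq : IsPremap (J ∪ K) (q * q')) :
    chi (J ∪ K) (g * g') (q * q') = chi J g q + chi K g' q' := by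
  have h1 := two_mul_chi hJ hg hq
  have h2 := two_mul_chi hK hg' hq'
  have hgg : g * g' ∈ permsOn (pos (J ∪ K)) := by rw [pos_union]; exact mul_mem_union hg hg'
  have h3 := two_mul_chi (by simp [hJ, hK]) hgg hqq
  have hd := disjoint_pm hJK
  have e : double (g * g') * (q * q') = (double g * q) * (double g' * q') := by
    have := commute_of_disjoint hd.symm (double_mem_pm hg') hq.1
    rw [double_mul_of_disjoint hJK hg hg', mul_assoc, ← mul_assoc (double g'), this, mul_assoc,
      mul_assoc]
  rw [e, pm_union, pos_union, numCycles_mul_of_disjoint (disjoint_pos hJK) hg hg',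
    numCycles_mul_of_disjoint hd hq.1 hq'.1,
    numCycles_mul_of_disjoint hd (mul_mem_permsOn (double_mem_pm hg) hq.1)
      (mul_mem_permsOn (double_mem_pm hg') hq'.1), Finset.card_union_of_disjoint hJK] at h3
  push_cast at h3
  omega

end Additive

/-! ### The cycles of the two annuli -/

/-- The cycle `(a + 1, …, a + r)`. -/
def block (a r : ℕ) : Perm ℤ := cyc ((List.range r).map fun i : ℕ => (a : ℤ) + i + 1)

theorem nodup_block (a r : ℕ) : ((List.range r).map fun i : ℕ => (a : ℤ) + i + 1).Nodup :=
  List.nodup_range.map fun i j h => by simpa using h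

theorem mem_pos_Icc {a r : ℕ} {k : ℤ} :
    k ∈ pos (Finset.Icc (a + 1) (a + r)) ↔ (a : ℤ) + 1 ≤ k ∧ k ≤ a + r := by
  rw [mem_pos, Finset.mem_Icc]
  omega

theorem block_mem (a r : ℕ) : block a r ∈ permsOn (pos (Finset.Icc (a + 1) (a + r))) := by
  rw [mem_permsOn]
  intro k hk
  refine List.formPerm_apply_of_notMem fun h => hk ?_
  obtain ⟨i, hi, rfl⟩ := List.mem_map.1 h
  rw [List.mem_range] at hi
  rw [mem_pos_Icc]
  omega

theorem block_pow_apply (a r i : ℕ) (hi : i < r) :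
    (block a r ^ i) ((a : ℤ) + 1) = (a : ℤ) + i + 1 := by
  have h := List.formPerm_pow_apply_getElem _ (nodup_block a r) i 0 (by simpa using by omega)
  simp only [List.getElem_map, List.getElem_range, List.length_map, List.length_range, zero_add,
    Nat.mod_eq_of_lt hi, Nat.cast_zero, add_zero] at h
  exact h

theorem hasPeriod_block (a r : ℕ) (hr : 0 < r) : HasPeriod (block a r) ((a : ℤ) + 1) r := by
  refine ⟨hr, ?_, ?_⟩
  · have := List.formPerm_pow_length_eq_one_of_nodup _ (nodup_block a r)
    rw [List.length_map, List.length_range] at this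
    rw [block, cyc, this]; rfl
  · intro i hi j hj e
    rw [block_pow_apply a r i hi, block_pow_apply a r j hj] at e
    omega

theorem block_sameCycle {a r : ℕ} {k : ℤ} (hk : k ∈ pos (Finset.Icc (a + 1) (a + r))) :
    (block a r).SameCycle ((a : ℤ) + 1) k := by
  rw [mem_pos_Icc] at hk
  refine ⟨(k - a - 1).toNat, ?_⟩
  rw [zpow_natCast, block_pow_apply _ _ _ (by omega)]
  omega

theorem numCycles_block (a r : ℕ) (hr : 0 < r) :
    numCycles (pos (Finset.Icc (a + 1) (a + r))) (block a r) = 1 :=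
  numCycles_eq_one (a := (a : ℤ) + 1) (by rw [mem_pos_Icc]; omega) fun _ hb => block_sameCycle hb

theorem gammaPar_eq (m n : ℕ) : gammaPar m n = block 0 m * block m n := by
  simp [gammaPar, block]

theorem conj_cyc (σ : Perm ℤ) (l : List ℤ) : σ * cyc l * σ⁻¹ = cyc (l.map σ) := by
  induction l with
  | nil => simp [cyc]
  | cons x l ih =>
    cases l with
    | nil => simp [cyc]
    | cons y l =>
      simp only [cyc, List.formPerm_cons_cons, List.map_cons] at ih ⊢
      rw [← ih, ← mul_assoc, Equiv.mul_swap_eq_swap_mul]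
      simp only [mul_assoc]

theorem minus_block_inv (m n : ℕ) :
    minus (block m n)⁻¹ = cyc ((List.range n).map fun i : ℕ => -(m : ℤ) - n + i) := by
  rw [← minus_inv, minus, block]
  have := conj_cyc delta ((List.range n).map fun i : ℕ => (m : ℤ) + i + 1)
  rw [delta_inv] at this
  rw [this, cyc, cyc, ← List.formPerm_reverse]
  congr 1
  refine List.ext_getElem (by simp) fun i h1 h2 => ?_
  simp only [List.length_map, List.length_range] at h2
  simp [delta_apply]
  omega

theorem gammaOp_eq (m n : ℕ) : gammaOp m n = block 0 m * minus (block m n)⁻¹ := by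
  rw [minus_block_inv]
  simp [gammaOp, block]

theorem disjoint_Icc (m n : ℕ) :
    Disjoint (Finset.Icc (0 + 1) (0 + m)) (Finset.Icc (m + 1) (m + n)) := by
  rw [Finset.disjoint_left]
  intro k h1 h2
  rw [Finset.mem_Icc] at h1 h2
  omega

theorem Icc_union (m n : ℕ) :
    Finset.Icc 1 (m + n) = Finset.Icc (0 + 1) (0 + m) ∪ Finset.Icc (m + 1) (m + n) := by
  ext k
  simp only [Finset.mem_union, Finset.mem_Icc]
  omega

theorem gammaPar_mem (m n : ℕ) : gammaPar m n ∈ permsOn (pos (Finset.Icc 1 (m + n))) := by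
  rw [gammaPar_eq, Icc_union, pos_union]
  exact mul_mem_union (block_mem 0 m) (block_mem m n)

theorem numCycles_gammaPar (m n : ℕ) (hm : 0 < m) (hn : 0 < n) :
    numCycles (pos (Finset.Icc 1 (m + n))) (gammaPar m n) = 2 := by
  rw [gammaPar_eq, Icc_union, pos_union, numCycles_mul_of_disjoint
    (disjoint_pos (disjoint_Icc m n)) (block_mem 0 m) (block_mem m n), numCycles_block _ _ hm,
    numCycles_block _ _ hn]

theorem neg_eq_image (I : Finset ℕ) : neg I = (pos I).image delta := by
  ext k
  simp only [mem_neg, Finset.mem_image, mem_pos]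
  constructor
  · rintro ⟨h1, h2⟩
    exact ⟨-k, ⟨by omega, by simpa using h2⟩, by simp [delta_apply]⟩
  · rintro ⟨j, ⟨h1, h2⟩, rfl⟩
    rw [delta_apply, Int.natAbs_neg]
    exact ⟨by omega, h2⟩

theorem minus_block_mem (m n : ℕ) :
    minus (block m n)⁻¹ ∈ permsOn (neg (Finset.Icc (m + 1) (m + n))) := by
  rw [neg_eq_image]
  exact minus_mem (inv_mem_permsOn (block_mem m n))

theorem domOp_eq (m n : ℕ) :
    domOp m n = pos (Finset.Icc (0 + 1) (0 + m)) ∪ neg (Finset.Icc (m + 1) (m + n)) := by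
  rw [domOp, zero_add, zero_add]

theorem disjoint_pos_neg (m n : ℕ) :
    Disjoint (pos (Finset.Icc (0 + 1) (0 + m))) (neg (Finset.Icc (m + 1) (m + n))) :=
  (disjoint_pm (disjoint_Icc m n)).mono (pos_subset_pm _) Finset.subset_union_right

theorem gammaOp_mem (m n : ℕ) : gammaOp m n ∈ permsOn (domOp m n) := by
  rw [gammaOp_eq, domOp_eq]
  exact mul_mem_union (block_mem 0 m) (minus_block_mem m n)

theorem numCycles_gammaOp (m n : ℕ) (hm : 0 < m) (hn : 0 < n) :
    numCycles (domOp m n) (gammaOp m n) = 2 := by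
  rw [gammaOp_eq, domOp_eq, numCycles_mul_of_disjoint (disjoint_pos_neg m n) (block_mem 0 m)
    (minus_block_mem m n), numCycles_block _ _ hm, neg_eq_image, numCycles_minus, numCycles_inv,
    numCycles_block _ _ hn]

theorem isDouble_domOp (m n : ℕ) : IsDouble (pm (Finset.Icc 1 (m + n))) (domOp m n) := by
  have key : ∀ k, k ∈ domOp m n ↔ (1 ≤ k ∧ k ≤ m) ∨ (-(m : ℤ) - n ≤ k ∧ k ≤ -(m : ℤ) - 1) := by
    intro k
    simp only [domOp, Finset.mem_union, mem_pos, mem_neg, Finset.mem_Icc]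
    omega
  constructor
  · intro k
    rw [key, key, mem_pm, Finset.mem_Icc]
    omega
  · intro k
    rw [key, key]
    omega

/-- Reversing and reflecting one cycle of γ only exchanges the two halves of the double of that
cycle. -/
theorem double_gammaOp (m n : ℕ) : double (gammaOp m n) = double (gammaPar m n) := by
  have hdis : Disjoint (pos (Finset.Icc (m + 1) (m + n))) (neg (Finset.Icc (m + 1) (m + n))) := by
    rw [neg_eq_image]
    exact (isDouble_pos (by simp)).disjoint
  have hc := commute_of_disjoint hdis (block_mem m n) (minus_block_mem m n)
  rw [gammaOp_eq, gammaPar_eq, double, double, minus_mul, minus_mul, minus_minus, mul_inv_rev,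
    mul_inv_rev, inv_inv, minus_inv (block m n), mul_assoc, mul_assoc, ← mul_assoc (block m n), hc,
    mul_assoc]

theorem zero_notMem_Icc (a b : ℕ) : 0 ∉ Finset.Icc (a + 1) b := by simp

theorem not_sameCycle_of_disjoint {A B : Finset ℤ} (h : Disjoint A B) {p q : Perm ℤ}
    (hp : p ∈ permsOn A) (hq : q ∈ permsOn B) {j k : ℤ} (hj : j ∈ A) (hk : k ∈ B) :
    ¬ (p * q).SameCycle j k := fun hs => by
  have := mem_of_sameCycle_invariant (T := A) (mul_mem_union hp hq) (fun z hz => by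
    rw [mul_apply_left h p hq hz]; exact apply_mem_of_permsOn hp hz) hs hj
  exact Finset.disjoint_left.1 h this hk

theorem sameCycle_mul_left {A B : Finset ℤ} (h : Disjoint A B) {p q : Perm ℤ}
    (hp : p ∈ permsOn A) (hq : q ∈ permsOn B) {j : ℤ} (hj : j ∈ A) (k : ℤ) :
    (p * q).SameCycle j k ↔ p.SameCycle j k :=
  sameCycle_iff_of_agree_on hp (mul_mem_union hp hq) (fun _ hk => apply_mem_of_permsOn hp hk)
    (fun _ hk => mul_apply_left h p hq hk) hj k

theorem sameCycle_mul_right {A B : Finset ℤ} (h : Disjoint A B) {p q : Perm ℤ}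
    (hp : p ∈ permsOn A) (hq : q ∈ permsOn B) {j : ℤ} (hj : j ∈ B) (k : ℤ) :
    (p * q).SameCycle j k ↔ q.SameCycle j k :=
  sameCycle_iff_of_agree_on hq (mul_mem_union hp hq) (fun _ hk => apply_mem_of_permsOn hq hk)
    (fun _ hk => mul_apply_right h hp hq hk) hj k

/-- A cycle of `p` that meets two cycles of `a * b`, where `a` and `b` are single cycles on `A` and
`B`, connects `A` and `B`. -/
theorem connects_of_link {A B T : Finset ℤ} (hAB : Disjoint A B) {a b p : Perm ℤ}
    (ha : a ∈ permsOn A) (hb : b ∈ permsOn B) (hA : ∀ j ∈ A, ∀ k ∈ A, a.SameCycle j k)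
    (hB : ∀ j ∈ B, ∀ k ∈ B, b.SameCycle j k) (hT : T = A ∪ B) {j k : ℤ} (hj : j ∈ T) (hk : k ∈ T)
    (hjk : ¬ (a * b).SameCycle j k) (hl : p.SameCycle j k) :
    ∃ j' ∈ A, ∃ k' ∈ B, p.SameCycle j' k' := by
  subst hT
  rcases Finset.mem_union.1 hj with hj | hj <;> rcases Finset.mem_union.1 hk with hk | hk
  · exact absurd ((sameCycle_mul_left hAB ha hb hj k).2 (hA j hj k hk)) hjk
  · exact ⟨j, hj, k, hk, hl⟩
  · exact ⟨k, hk, j, hj, hl.symm⟩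
  · exact absurd ((sameCycle_mul_right hAB ha hb hj k).2 (hB j hj k hk)) hjk

/-! ### Premaps of maximal Euler characteristic -/

section Maximal

variable {m n : ℕ}

theorem pos_Icc_eq_union (m n : ℕ) : pos (Finset.Icc 1 (m + n)) =
    pos (Finset.Icc (0 + 1) (0 + m)) ∪ pos (Finset.Icc (m + 1) (m + n)) := by
  rw [Icc_union, pos_union]

theorem disjoint_pos_Icc (m n : ℕ) :
    Disjoint (pos (Finset.Icc (0 + 1) (0 + m))) (pos (Finset.Icc (m + 1) (m + n))) :=
  disjoint_pos (disjoint_Icc m n)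

theorem two_mul_chi_gammaPar (hm : 0 < m) (hn : 0 < n) {q : Perm ℤ}
    (hq : IsPremap (Finset.Icc 1 (m + n)) q) :
    2 * chi (Finset.Icc 1 (m + n)) (gammaPar m n) q =
      4 + numCycles (pm (Finset.Icc 1 (m + n))) q +
        numCycles (pm (Finset.Icc 1 (m + n))) (double (gammaPar m n) * q) -
        (pm (Finset.Icc 1 (m + n))).card := by
  have h0 := zero_notMem_Icc 0 (m + n)
  have h := two_mul_chi h0 (gammaPar_mem m n) hq
  have hS := (isDouble_pos h0).card
  have hc : (pos (Finset.Icc 1 (m + n))).card = (Finset.Icc 1 (m + n)).card :=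
    Finset.card_image_of_injective _ Nat.cast_injective
  simp only [zero_add] at h hS
  rw [numCycles_gammaPar m n hm hn] at h
  rw [hS, hc, h]
  push_cast
  ring

/-- The sign pattern of one connecting cycle decides which annulus applies. -/
theorem chi_le_two (hm : 0 < m) (hn : 0 < n) {q : Perm ℤ}
    (hq : IsPremap (Finset.Icc 1 (m + n)) q)
    (hc : Connects q (pm (Finset.Icc (0 + 1) (0 + m))) (pm (Finset.Icc (m + 1) (m + n)))) :
    chi (Finset.Icc 1 (m + n)) (gammaPar m n) q ≤ 2 ∧
      (chi (Finset.Icc 1 (m + n)) (gammaPar m n) q = 2 →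
        (∃ p ∈ annNC (pos (Finset.Icc 1 (m + n))) (gammaPar m n), q = double p) ∨
          ∃ p ∈ annNC (domOp m n) (gammaOp m n), q = double p) := by
  have hchi := two_mul_chi_gammaPar hm hn hq
  have hd := hq.self_dual
  -- By self-duality the connecting cycle may be reflected so that its element in the first block is
  -- positive.
  have key : ∃ j ∈ pos (Finset.Icc (0 + 1) (0 + m)), ∃ k ∈ pm (Finset.Icc (m + 1) (m + n)),
      q.SameCycle j k := by
    obtain ⟨j, hj, k, hk, h⟩ := hc
    rw [pm, Finset.mem_union] at hj
    rcases hj with hj | hj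
    · exact ⟨j, hj, k, hk, h⟩
    · refine ⟨-j, ?_, -k, neg_mem_pm.2 hk, sameCycle_neg hd h⟩
      rw [neg_eq_image] at hj
      exact eq_of_mem_image_delta hj
  obtain ⟨j, hj, k, hk, h⟩ := key
  rw [pm, Finset.mem_union] at hk
  rcases hk with hk | hk
  · have hjk : ¬ (gammaPar m n).SameCycle j k := by
      rw [gammaPar_eq]
      exact not_sameCycle_of_disjoint (disjoint_pos_Icc m n) (block_mem 0 m) (block_mem m n) hj hk
    have hI := isDouble_pos (zero_notMem_Icc 0 (m + n))
    rw [zero_add] at hI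
    have := self_dual_genus hI (gammaPar_mem m n) (numCycles_gammaPar m n hm hn) hq.1 hd
      (by rw [pos_Icc_eq_union]; exact Finset.mem_union_left _ hj)
      (by rw [pos_Icc_eq_union]; exact Finset.mem_union_right _ hk) hjk h
    exact ⟨by omega, fun e => Or.inl (this.2 (by omega))⟩
  · have hjk : ¬ (gammaOp m n).SameCycle j k := by
      rw [gammaOp_eq]
      exact not_sameCycle_of_disjoint (disjoint_pos_neg m n) (block_mem 0 m)
        (minus_block_mem m n) hj hk
    have := self_dual_genus (isDouble_domOp m n) (gammaOp_mem m n) (numCycles_gammaOp m n hm hn)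
      hq.1 hd (by rw [domOp_eq]; exact Finset.mem_union_left _ hj)
      (by rw [domOp_eq]; exact Finset.mem_union_right _ hk) hjk h
    rw [double_gammaOp] at this
    exact ⟨by omega, fun e => Or.inr (this.2 (by omega))⟩

theorem link_of_annNC_gammaPar (hm : 0 < m) (hn : 0 < n) {p : Perm ℤ}
    (hp : p ∈ annNC (pos (Finset.Icc 1 (m + n))) (gammaPar m n)) :
    ∃ j ∈ pos (Finset.Icc (0 + 1) (0 + m)), ∃ k ∈ pos (Finset.Icc (m + 1) (m + n)),
      (double p).SameCycle j k := by
  obtain ⟨j, hj, k, hk, hjk, hl⟩ := exists_link_of_mem_annNC (numCycles_gammaPar m n hm hn) hp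
  rw [gammaPar_eq] at hjk
  have hI := isDouble_pos (zero_notMem_Icc 0 (m + n))
  rw [zero_add] at hI
  exact connects_of_link (disjoint_pos_Icc m n) (block_mem 0 m) (block_mem m n)
    (fun j hj k hk => (block_sameCycle hj).symm.trans (block_sameCycle hk))
    (fun j hj k hk => (block_sameCycle hj).symm.trans (block_sameCycle hk))
    (pos_Icc_eq_union m n) hj hk hjk ((double_sameCycle hI (mem_annNC.1 hp).1 hj k).2 hl)

theorem link_of_annNC_gammaOp (hm : 0 < m) (hn : 0 < n) {p : Perm ℤ}
    (hp : p ∈ annNC (domOp m n) (gammaOp m n)) :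
    ∃ j ∈ pos (Finset.Icc (0 + 1) (0 + m)), ∃ k ∈ neg (Finset.Icc (m + 1) (m + n)),
      (double p).SameCycle j k := by
  obtain ⟨j, hj, k, hk, hjk, hl⟩ := exists_link_of_mem_annNC (numCycles_gammaOp m n hm hn) hp
  rw [gammaOp_eq] at hjk
  refine connects_of_link (disjoint_pos_neg m n) (block_mem 0 m) (minus_block_mem m n)
    (fun j hj k hk => (block_sameCycle hj).symm.trans (block_sameCycle hk)) ?_
    (domOp_eq m n) hj hk hjk ((double_sameCycle (isDouble_domOp m n) (mem_annNC.1 hp).1 hj k).2 hl)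
  intro j hj k hk
  rw [neg_eq_image] at hj hk
  have := (block_sameCycle (eq_of_mem_image_delta hj)).symm.trans
    (block_sameCycle (eq_of_mem_image_delta hk))
  have h2 : (delta * (block m n)⁻¹ * delta⁻¹).SameCycle (delta (-j)) (delta (-k)) :=
    (sameCycle_inv.2 this).conj
  rw [delta_inv, delta_apply, delta_apply, neg_neg, neg_neg] at h2
  exact h2

theorem chi_gammaPar_eq_two (hm : 0 < m) (hn : 0 < n) {p : Perm ℤ}
    (hq : IsPremap (Finset.Icc 1 (m + n)) (double p))
    (hp : p ∈ annNC (pos (Finset.Icc 1 (m + n))) (gammaPar m n) ∨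
      p ∈ annNC (domOp m n) (gammaOp m n)) :
    Connects (double p) (pm (Finset.Icc (0 + 1) (0 + m))) (pm (Finset.Icc (m + 1) (m + n))) ∧
      chi (Finset.Icc 1 (m + n)) (gammaPar m n) (double p) = 2 := by
  have hchi := two_mul_chi_gammaPar hm hn hq
  rcases hp with hp | hp
  · obtain ⟨j, hj, k, hk, hl⟩ := link_of_annNC_gammaPar hm hn hp
    have hI := isDouble_pos (zero_notMem_Icc 0 (m + n))
    rw [zero_add] at hI
    have := double_annNC_genus hI (gammaPar_mem m n) (numCycles_gammaPar m n hm hn) hp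
    exact ⟨⟨j, pos_subset_pm _ hj, k, pos_subset_pm _ hk, hl⟩, by omega⟩
  · obtain ⟨j, hj, k, hk, hl⟩ := link_of_annNC_gammaOp hm hn hp
    have := double_annNC_genus (isDouble_domOp m n) (gammaOp_mem m n)
      (numCycles_gammaOp m n hm hn) hp
    rw [double_gammaOp] at this
    exact ⟨⟨j, pos_subset_pm _ hj, k, Finset.mem_union_right _ hk, hl⟩, by omega⟩

/-- A double from γ links a positive element of the first block to a positive one of the second,
whereas a double from γ_op preserves `domOp`, which contains no positive element of the second
block. -/
theorem double_ne_double (hm : 0 < m) (hn : 0 < n) {p p' : Perm ℤ}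
    (hp : p ∈ annNC (pos (Finset.Icc 1 (m + n))) (gammaPar m n))
    (hp' : p' ∈ annNC (domOp m n) (gammaOp m n)) : double p ≠ double p' := by
  intro e
  obtain ⟨j, hj, k, hk, hl⟩ := link_of_annNC_gammaPar hm hn hp
  have hI := isDouble_domOp m n
  have hp1 := (mem_annNC.1 hp').1
  rw [e] at hl
  have hkT := mem_of_sameCycle_invariant (T := domOp m n) (double_mem hI hp1)
    (fun z hz => by rw [double_apply_of_mem hI hp1 hz]; exact apply_mem_of_permsOn hp1 hz) hl
    (by rw [domOp_eq]; exact Finset.mem_union_left _ hj)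
  rw [domOp, Finset.mem_union, mem_pos, mem_neg, Finset.mem_Icc, Finset.mem_Icc] at hkT
  rw [mem_pos_Icc] at hk
  omega

end Maximal

/-! ### The genus expansion without matrices `Y` -/

section Expansion

variable {N : ℕ}

theorem cycleProd_eq {g : Perm ℤ} {a r : ℕ} (hg : HasPeriod g ((a : ℤ) + 1) r)
    (hi : ∀ i < r, (g ^ i) ((a : ℤ) + 1) = (a : ℤ) + i + 1) (M : ℤ → Matrix (Fin N) (Fin N) ℂ) :
    cycleProd g M ((a : ℤ) + 1) =
      ((List.range r).map fun i : ℕ => M (((a + i + 1 : ℕ) : ℤ))).prod := by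
  have hp : Function.minimalPeriod g ((a : ℤ) + 1) = r := by
    have h1 : Function.IsPeriodicPt g r ((a : ℤ) + 1) := by
      rw [Function.IsPeriodicPt, Function.IsFixedPt, ← Perm.coe_pow, hg.pow_eq]
    have h2 := h1.minimalPeriod_le hg.pos
    have h3 := h1.minimalPeriod_pos hg.pos
    rcases h2.lt_or_eq with h | h
    · have := hg.inj _ h 0 hg.pos (by rw [Perm.coe_pow, Function.iterate_minimalPeriod]; rfl)
      omega
    · exact h
  rw [cycleProd, hp]
  congr 1
  refine List.map_congr_left fun i h => ?_
  rw [hi i (List.mem_range.1 h)]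
  push_cast
  rfl

theorem traceWord_eq {Λ : Type*} {X : Λ → Matrix (Fin N) (Fin N) ℂ} {ε : ℕ → ℤˣ} {lam : ℕ → Λ}
    {g : Perm ℤ} {a r : ℕ} (hN : 0 < N) (hg : HasPeriod g ((a : ℤ) + 1) r)
    (hi : ∀ i < r, (g ^ i) ((a : ℤ) + 1) = (a : ℤ) + i + 1) :
    traceWord X ε lam a r =
      N * ntr (cycleProd g (fun k => signPow (ε k.natAbs) (X (lam k.natAbs))) ((a : ℤ) + 1)) := by
  have hN' : (N : ℂ) ≠ 0 := by exact_mod_cast hN.ne'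
  rw [cycleProd_eq hg hi, ntr, mul_inv_cancel_left₀ hN']
  rfl

theorem trPerm_block {a r : ℕ} (hr : 0 < r) (M : ℤ → Matrix (Fin N) (Fin N) ℂ) :
    trPerm (pos (Finset.Icc (a + 1) (a + r))) (block a r) M =
      ntr (cycleProd (block a r) M ((a : ℤ) + 1)) := by
  classical
  rw [trPerm, Finset.prod_eq_single_of_mem ((a : ℤ) + 1)]
  · rw [Finset.mem_filter]
    have h0 : (a : ℤ) + 1 ∈ pos (Finset.Icc (a + 1) (a + r)) := by rw [mem_pos_Icc]; omega
    refine ⟨h0, fun j hj => ?_⟩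
    exact (mem_pos_Icc.1 (mem_of_sameCycle (block_mem a r) hj h0)).1
  · intro k hk hne
    rw [Finset.mem_filter] at hk
    have h1 := hk.2 _ (block_sameCycle hk.1).symm
    have h2 := mem_pos_Icc.1 hk.1
    omega

theorem hasPeriod_of_agree {g g' : Perm ℤ} {x : ℤ} {n : ℕ} (h : HasPeriod g x n)
    (e : ∀ z, g.SameCycle x z → g' z = g z) : HasPeriod g' x n :=
  ⟨h.pos, by rw [pow_eq_pow_of_agree e, h.pow_eq], fun i hi j hj => by
    rw [pow_eq_pow_of_agree e, pow_eq_pow_of_agree e]; exact h.inj i hi j hj⟩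

theorem gammaPar_agree_left (m n : ℕ) (hm : 0 < m) (z : ℤ)
    (hz : (block 0 m).SameCycle (((0 : ℕ) : ℤ) + 1) z) : gammaPar m n z = block 0 m z := by
  rw [gammaPar_eq]
  refine mul_apply_left (disjoint_pos_Icc m n) _ (block_mem m n)
    (mem_of_sameCycle (block_mem 0 m) hz ?_)
  rw [mem_pos_Icc]; omega

theorem gammaPar_agree_right (m n : ℕ) (hn : 0 < n) (z : ℤ)
    (hz : (block m n).SameCycle ((m : ℤ) + 1) z) : gammaPar m n z = block m n z := by
  rw [gammaPar_eq]
  refine mul_apply_right (disjoint_pos_Icc m n) (block_mem 0 m) (block_mem m n)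
    (mem_of_sameCycle (block_mem m n) hz ?_)
  rw [mem_pos_Icc]; omega

theorem trPerm_gammaPar {m n : ℕ} (hm : 0 < m) (hn : 0 < n)
    (M : ℤ → Matrix (Fin N) (Fin N) ℂ) :
    trPerm (pos (Finset.Icc 1 (m + n))) (gammaPar m n) M =
      ntr (cycleProd (gammaPar m n) M (((0 : ℕ) : ℤ) + 1)) *
        ntr (cycleProd (gammaPar m n) M ((m : ℤ) + 1)) := by
  classical
  have h1 : (((0 : ℕ) : ℤ) + 1) ∈ pos (Finset.Icc (0 + 1) (0 + m)) := by rw [mem_pos_Icc]; omega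
  have h2 : ((m : ℤ) + 1) ∈ pos (Finset.Icc (m + 1) (m + n)) := by rw [mem_pos_Icc]; omega
  have hs1 {j : ℤ} (hj : j ∈ pos (Finset.Icc (0 + 1) (0 + m))) (k : ℤ) :=
    sameCycle_mul_left (disjoint_pos_Icc m n) (block_mem 0 m) (block_mem m n) hj k
  have hs2 {j : ℤ} (hj : j ∈ pos (Finset.Icc (m + 1) (m + n))) (k : ℤ) :=
    sameCycle_mul_right (disjoint_pos_Icc m n) (block_mem 0 m) (block_mem m n) hj k
  simp only [← gammaPar_eq] at hs1 hs2
  rw [trPerm, ← Finset.prod_pair (f := fun k => ntr (cycleProd (gammaPar m n) M k))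
    (a := ((0 : ℕ) : ℤ) + 1) (b := (m : ℤ) + 1) (by omega)]
  refine Finset.prod_congr ?_ fun _ _ => rfl
  ext k
  rw [Finset.mem_filter, Finset.mem_insert, Finset.mem_singleton, pos_Icc_eq_union,
    Finset.mem_union]
  constructor
  · rintro ⟨hk | hk, h⟩
    · left
      have := h _ ((hs1 hk _).2 (block_sameCycle hk).symm)
      have := mem_pos_Icc.1 hk
      omega
    · right
      have := h _ ((hs2 hk _).2 (block_sameCycle hk).symm)
      have := mem_pos_Icc.1 hk
      omega
  · rintro (rfl | rfl)
    · refine ⟨Or.inl h1, fun j hj => ?_⟩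
      exact (mem_pos_Icc.1 (mem_of_sameCycle (block_mem 0 m) ((hs1 h1 _).1 hj) h1)).1
    · refine ⟨Or.inr h2, fun j hj => ?_⟩
      exact (mem_pos_Icc.1 (mem_of_sameCycle (block_mem m n) ((hs2 h2 _).1 hj) h2)).1

theorem trPerm_one (hN : 0 < N) (S : Finset ℤ) (g : Perm ℤ) :
    trPerm S g (signedFam fun _ => (1 : Matrix (Fin N) (Fin N) ℂ)) = 1 := by
  have hN' : (N : ℂ) ≠ 0 := by exact_mod_cast hN.ne'
  have h1 : signedFam (fun _ => (1 : Matrix (Fin N) (Fin N) ℂ)) = fun _ => 1 := by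
    funext k
    simp [signedFam]
  rw [h1, trPerm]
  refine Finset.prod_eq_one fun k _ => ?_
  simp [cycleProd, ntr, hN']

variable {Ω Λ : Type*} [MeasurableSpace Ω] {P : Measure Ω} [IsProbabilityMeasure P]
  {X : (N : ℕ) → Λ → Ω → Matrix (Fin N) (Fin N) ℂ} {PMc : Finset ℕ → Finset (Perm ℤ)}
  {f : ℕ → (ℕ → Λ) → Finset ℕ → Perm ℤ → ℂ}

/-- Constant identity matrices are independent of everything, and all traces on the right-hand side
become 1. -/
theorem SatisfiesGeneral.expansion_one (h : SatisfiesGeneral P X PMc f) (hN : 0 < N)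
    {I : Finset ℕ} (hI : 0 ∉ I) {g : Perm ℤ} (hg : g ∈ permsOn (pos I)) (ε : ℕ → ℤˣ)
    (lam : ℕ → Λ) :
    ∫ ω, trPerm (pos I) g (fun k => signPow (ε k.natAbs) (X N (lam k.natAbs) ω)) ∂P =
      ∑ π ∈ PMc I, (N : ℂ) ^ (chi I g (signConj ε π) - 2 * (numCycles (pos I) g : ℤ)) *
        f N lam I π := by
  have := (h.expansion N hN I hI g hg ε lam (fun _ _ => 1) (fun _ _ _ => measurable_const)
    (fun _ _ _ _ => memLp_const _) (indepFun_const_right _ _)).2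
  simp only [mul_one, trPerm_one hN, integral_const, probReal_univ, one_smul] at this
  exact this

end Expansion

/-! ### The covariance as a sum over connecting premaps -/

section Covariance

variable {Ω Λ : Type*} [MeasurableSpace Ω] {P : Measure Ω}
  {X : (N : ℕ) → Λ → Ω → Matrix (Fin N) (Fin N) ℂ} {PMc : Finset ℕ → Finset (Perm ℤ)}
  {f : ℕ → (ℕ → Λ) → Finset ℕ → Perm ℤ → ℂ}

open Classical in
/-- The disconnected premaps contribute the product of the expectations. -/
theorem SatisfiesGeneral.sum_not_connects (h : SatisfiesGeneral P X PMc f) {N : ℕ}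
    (hN : 0 < N) (ε : ℕ → ℤˣ) (lam : ℕ → Λ) {J K : Finset ℕ} (hJ : 0 ∉ J) (hK : 0 ∉ K)
    (hJK : Disjoint J K) {g g' : Perm ℤ} (hg : g ∈ permsOn (pos J)) (hg' : g' ∈ permsOn (pos K)) :
    ∑ π ∈ PMc (J ∪ K) with ¬ Connects π (pm J) (pm K),
        (N : ℂ) ^ (chi (J ∪ K) (g * g') (signConj ε π) - 2) * f N lam (J ∪ K) π =
      (∑ π ∈ PMc J, (N : ℂ) ^ (chi J g (signConj ε π) - 1) * f N lam J π) *
        ∑ π ∈ PMc K, (N : ℂ) ^ (chi K g' (signConj ε π) - 1) * f N lam K π := by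
  have hN' : (N : ℂ) ≠ 0 := by exact_mod_cast hN.ne'
  have h0 : 0 ∉ J ∪ K := by simp [hJ, hK]
  have hK' : (J ∪ K) \ J = K := by
    rw [Finset.union_sdiff_left]
    exact Finset.sdiff_eq_self_of_disjoint hJK.symm
  have hsub : J ⊆ J ∪ K := Finset.subset_union_left
  rw [Finset.sum_mul_sum, ← Finset.sum_product']
  symm
  refine Finset.sum_bij (fun p _ => p.1 * p.2) ?_ ?_ ?_ ?_
  · rintro ⟨p, q⟩ hpq
    rw [Finset.mem_product] at hpq
    have := (h.split (J ∪ K) h0 J hsub (p * q)).2 ⟨p, hpq.1, q, by rw [hK']; exact hpq.2, rfl⟩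
    rw [hK'] at this
    exact Finset.mem_filter.2 this
  · rintro ⟨p, q⟩ hpq ⟨p', q'⟩ hpq' e
    rw [Finset.mem_product] at hpq hpq'
    have hp := (h.isPremap J hJ _ hpq.1).1
    have hq := (h.isPremap K hK _ hpq.2).1
    have hp' := (h.isPremap J hJ _ hpq'.1).1
    have hq' := (h.isPremap K hK _ hpq'.2).1
    have hd := disjoint_pm hJK
    simp only at e hp hq hp' hq'
    have e1 : p = p' := by
      ext k
      by_cases hk : k ∈ pm J
      · rw [← mul_apply_left hd p hq hk, e, mul_apply_left hd p' hq' hk]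
      · rw [apply_of_notMem hp hk, apply_of_notMem hp' hk]
    subst e1
    rw [mul_left_cancel e]
  · intro π hπ
    rw [Finset.mem_filter] at hπ
    obtain ⟨p, hp, q, hq, rfl⟩ := (h.split (J ∪ K) h0 J hsub π).1 (by rw [hK']; exact hπ)
    rw [hK'] at hq
    exact ⟨(p, q), Finset.mem_product.2 ⟨hp, hq⟩, rfl⟩
  · rintro ⟨p, q⟩ hpq
    rw [Finset.mem_product] at hpq
    have hm := h.multiplicative N hN lam (J ∪ K) h0 J hsub p hpq.1 q (by rw [hK']; exact hpq.2)
    have hmem := ((h.split (J ∪ K) h0 J hsub (p * q)).2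
      ⟨p, hpq.1, q, by rw [hK']; exact hpq.2, rfl⟩).1
    have hc := chi_mul hJ hK hJK hg hg' (isPremap_signConj ε (h.isPremap J hJ _ hpq.1))
      (isPremap_signConj ε (h.isPremap K hK _ hpq.2))
      (by rw [← signConj_mul]; exact isPremap_signConj ε (h.isPremap _ h0 _ hmem))
    rw [hK'] at hm
    simp only
    -- The normalization 2 is shared equally between the two factors, one for each trace.
    rw [hm, signConj_mul, hc, show chi J g (signConj ε p) + chi K g' (signConj ε q) - 2 =
      (chi J g (signConj ε p) - 1) + (chi K g' (signConj ε q) - 1) by ring, zpow_add₀ hN']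
    ring

open Classical in
/-- The premaps of maximal Euler characteristic are the doubles of the annular noncrossing
permutations of the two annuli. -/
theorem SatisfiesGeneral.filter_maximal (h : SatisfiesGeneral P X PMc f) (ε : ℕ → ℤˣ) {m n : ℕ}
    (hm : 0 < m) (hn : 0 < n) :
    (((PMc (Finset.Icc 1 (m + n))).filter fun π =>
        Connects π (pm (Finset.Icc (0 + 1) (0 + m))) (pm (Finset.Icc (m + 1) (m + n)))).filter
      fun π => chi (Finset.Icc 1 (m + n)) (gammaPar m n) (signConj ε π) = 2) =
      ((annNC (pos (Finset.Icc 1 (m + n))) (gammaPar m n)).filter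
        fun π => doubled ε π ∈ PMc (Finset.Icc 1 (m + n))).image (doubled ε) ∪
      ((annNC (domOp m n) (gammaOp m n)).filter
        fun π => doubled ε π ∈ PMc (Finset.Icc 1 (m + n))).image (doubled ε) := by
  have h0 := zero_notMem_Icc 0 (m + n)
  rw [zero_add] at h0
  have hdd : ∀ p, doubled ε p = signConj ε (double p) := fun _ => rfl
  ext π
  simp only [Finset.mem_union, Finset.mem_image, Finset.mem_filter]
  constructor
  · rintro ⟨⟨hπ, hc⟩, hchi⟩
    have hpre := isPremap_signConj ε (h.isPremap _ h0 _ hπ)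
    have back : ∀ p, signConj ε π = double p → doubled ε p = π := fun p e => by
      rw [hdd, ← e, signConj_signConj]
    rcases (chi_le_two hm hn hpre ((connects_signConj ε).2 hc)).2 hchi with ⟨p, hp, e⟩ | ⟨p, hp, e⟩
    · exact Or.inl ⟨p, ⟨hp, by rw [back p e]; exact hπ⟩, back p e⟩
    · exact Or.inr ⟨p, ⟨hp, by rw [back p e]; exact hπ⟩, back p e⟩
  · have fwd : ∀ p, doubled ε p ∈ PMc (Finset.Icc 1 (m + n)) →
        (p ∈ annNC (pos (Finset.Icc 1 (m + n))) (gammaPar m n) ∨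
          p ∈ annNC (domOp m n) (gammaOp m n)) →
        (doubled ε p ∈ PMc (Finset.Icc 1 (m + n)) ∧ Connects (doubled ε p)
          (pm (Finset.Icc (0 + 1) (0 + m))) (pm (Finset.Icc (m + 1) (m + n)))) ∧
        chi (Finset.Icc 1 (m + n)) (gammaPar m n) (signConj ε (doubled ε p)) = 2 := by
      intro p hp hA
      have hpre := isPremap_signConj ε (h.isPremap _ h0 _ hp)
      rw [hdd, signConj_signConj] at hpre
      have := chi_gammaPar_eq_two hm hn hpre hA
      rw [hdd, signConj_signConj, connects_signConj]
      exact ⟨⟨hp, this.1⟩, this.2⟩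
    rintro (⟨p, ⟨hp, hp'⟩, rfl⟩ | ⟨p, ⟨hp, hp'⟩, rfl⟩)
    · exact fwd p hp' (Or.inl hp)
    · exact fwd p hp' (Or.inr hp)

variable [IsProbabilityMeasure P]

/-- One cycle gives the exponent χ − 2, and the unnormalized trace restores one factor `N`. -/
theorem SatisfiesGeneral.integral_traceWord (h : SatisfiesGeneral P X PMc f) {N : ℕ} (hN : 0 < N)
    (ε : ℕ → ℤˣ) (lam : ℕ → Λ) (a r : ℕ) (hr : 0 < r) :
    ∫ ω, traceWord (fun l => X N l ω) ε lam a r ∂P =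
      ∑ π ∈ PMc (Finset.Icc (a + 1) (a + r)),
        (N : ℂ) ^ (chi (Finset.Icc (a + 1) (a + r)) (block a r) (signConj ε π) - 1) *
          f N lam (Finset.Icc (a + 1) (a + r)) π := by
  have hN' : (N : ℂ) ≠ 0 := by exact_mod_cast hN.ne'
  have e := h.expansion_one hN (zero_notMem_Icc a (a + r)) (block_mem a r) ε lam
  rw [numCycles_block a r hr] at e
  have hw : ∀ ω, traceWord (fun l => X N l ω) ε lam a r =
      N * trPerm (pos (Finset.Icc (a + 1) (a + r))) (block a r)
        (fun k => signPow (ε k.natAbs) (X N (lam k.natAbs) ω)) := by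
    intro ω
    rw [trPerm_block hr]
    exact traceWord_eq hN (hasPeriod_block a r hr) (block_pow_apply a r)
  simp only [hw]
  rw [integral_const_mul, e, Finset.mul_sum]
  refine Finset.sum_congr rfl fun π _ => ?_
  rw [← mul_assoc, ← zpow_one_add₀ hN']
  congr 2
  push_cast
  ring

/-- Two cycles give the exponent χ − 4, and the two unnormalized traces restore `N ^ 2`. -/
theorem SatisfiesGeneral.integral_mul_traceWord (h : SatisfiesGeneral P X PMc f) {N : ℕ}
    (hN : 0 < N) (ε : ℕ → ℤˣ) (lam : ℕ → Λ) {m n : ℕ} (hm : 0 < m) (hn : 0 < n) :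
    ∫ ω, traceWord (fun l => X N l ω) ε lam 0 m * traceWord (fun l => X N l ω) ε lam m n ∂P =
      ∑ π ∈ PMc (Finset.Icc 1 (m + n)),
        (N : ℂ) ^ (chi (Finset.Icc 1 (m + n)) (gammaPar m n) (signConj ε π) - 2) *
          f N lam (Finset.Icc 1 (m + n)) π := by
  have hN' : (N : ℂ) ≠ 0 := by exact_mod_cast hN.ne'
  have e := h.expansion_one hN (zero_notMem_Icc 0 (m + n)) (gammaPar_mem m n) ε lam
  rw [zero_add, numCycles_gammaPar m n hm hn] at e
  have hw : ∀ ω, traceWord (fun l => X N l ω) ε lam 0 m * traceWord (fun l => X N l ω) ε lam m n =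
      N ^ 2 * trPerm (pos (Finset.Icc 1 (m + n))) (gammaPar m n)
        (fun k => signPow (ε k.natAbs) (X N (lam k.natAbs) ω)) := by
    intro ω
    have a1 := gammaPar_agree_left m n hm
    have a2 := gammaPar_agree_right m n hn
    rw [trPerm_gammaPar hm hn,
      traceWord_eq hN (hasPeriod_of_agree (hasPeriod_block 0 m hm) a1)
        (fun i hi => by rw [pow_eq_pow_of_agree a1]; exact block_pow_apply 0 m i hi),
      traceWord_eq hN (hasPeriod_of_agree (hasPeriod_block m n hn) a2)
        (fun i hi => by rw [pow_eq_pow_of_agree a2]; exact block_pow_apply m n i hi)]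
    ring
  simp only [hw]
  rw [integral_const_mul, e, Finset.mul_sum]
  refine Finset.sum_congr rfl fun π _ => ?_
  rw [← mul_assoc, ← zpow_natCast, ← zpow_add₀ hN']
  congr 2
  push_cast
  ring

-- The nonconnecting part of the expansion of the joint moment is cancelled exactly, for each
-- positive `N`, by the product of the expectations.
open Classical in
theorem SatisfiesGeneral.cumulant2_eq (h : SatisfiesGeneral P X PMc f) {N : ℕ}
    (hN : 0 < N) (ε : ℕ → ℤˣ) (lam : ℕ → Λ) {m n : ℕ} (hm : 0 < m) (hn : 0 < n) :
    cumulant2 P (fun ω => traceWord (fun l => X N l ω) ε lam 0 m)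
        (fun ω => traceWord (fun l => X N l ω) ε lam m n) =
      ∑ π ∈ PMc (Finset.Icc 1 (m + n)) with
          Connects π (pm (Finset.Icc (0 + 1) (0 + m))) (pm (Finset.Icc (m + 1) (m + n))),
        (N : ℂ) ^ (chi (Finset.Icc 1 (m + n)) (gammaPar m n) (signConj ε π) - 2) *
          f N lam (Finset.Icc 1 (m + n)) π := by
  have h1 := h.sum_not_connects hN ε lam (zero_notMem_Icc 0 (0 + m)) (zero_notMem_Icc m (m + n))
    (disjoint_Icc m n) (block_mem 0 m) (block_mem m n)
  rw [← Icc_union, ← gammaPar_eq] at h1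
  rw [cumulant2, h.integral_mul_traceWord hN ε lam hm hn, h.integral_traceWord hN ε lam 0 m hm,
    h.integral_traceWord hN ε lam m n hn, ← h1, ← Finset.sum_filter_add_sum_filter_not
      (PMc (Finset.Icc 1 (m + n))) (fun π => Connects π (pm (Finset.Icc (0 + 1) (0 + m)))
        (pm (Finset.Icc (m + 1) (m + n)))), add_sub_cancel_right]

theorem tendsto_zpow_mul {c : ℤ} (hc : c ≤ 0) {u : ℕ → ℂ} {L : ℂ} (hu : Tendsto u atTop (𝓝 L)) :
    Tendsto (fun N : ℕ => (N : ℂ) ^ c * u N) atTop (𝓝 (if c = 0 then L else 0)) := by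
  split_ifs with h0
  · simpa [h0] using hu
  · obtain ⟨d, rfl⟩ : ∃ d : ℕ, c = -((d + 1 : ℕ) : ℤ) := ⟨(-c - 1).toNat, by omega⟩
    have h1 : Tendsto (fun N : ℕ => ((N : ℂ)⁻¹) ^ (d + 1)) atTop (𝓝 (0 ^ (d + 1))) :=
      tendsto_inv_atTop_nhds_zero_nat.pow (d + 1)
    rw [zero_pow (Nat.succ_ne_zero d)] at h1
    have h2 := h1.mul hu
    rw [zero_mul] at h2
    refine h2.congr fun N => ?_
    rw [zpow_neg, zpow_natCast, inv_pow]

end Covariance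

end RealFluct

open Classical in
theorem lemma4p6 {Ω Λ : Type*} [MeasurableSpace Ω] (P : Measure Ω) [IsProbabilityMeasure P]
    (X : (N : ℕ) → Λ → Ω → Matrix (Fin N) (Fin N) ℂ)
    (PMc : Finset ℕ → Finset (Equiv.Perm ℤ))
    (f : ℕ → (ℕ → Λ) → Finset ℕ → Equiv.Perm ℤ → ℂ)
    (h : RealFluct.SatisfiesGeneral P X PMc f)
    (m n : ℕ) (hm : 0 < m) (hn : 0 < n) (ε : ℕ → ℤˣ) (lam : ℕ → Λ) :
    Tendsto
      (fun N : ℕ => RealFluct.cumulant2 P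
        (fun ω => RealFluct.traceWord (fun l => X N l ω) ε lam 0 m)
        (fun ω => RealFluct.traceWord (fun l => X N l ω) ε lam m n))
      atTop
      (𝓝 ((∑ π ∈ RealFluct.annNC (RealFluct.pos (Finset.Icc 1 (m + n))) (RealFluct.gammaPar m n)
              with RealFluct.doubled ε π ∈ PMc (Finset.Icc 1 (m + n)),
            limUnder atTop
              (fun N : ℕ => f N lam (Finset.Icc 1 (m + n)) (RealFluct.doubled ε π))) +
          ∑ π ∈ RealFluct.annNC (RealFluct.domOp m n) (RealFluct.gammaOp m n)
              with RealFluct.doubled ε π ∈ PMc (Finset.Icc 1 (m + n)),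
            limUnder atTop
              (fun N : ℕ => f N lam (Finset.Icc 1 (m + n)) (RealFluct.doubled ε π)))) := by
  have h0 := RealFluct.zero_notMem_Icc 0 (m + n)
  rw [zero_add] at h0
  have hI := RealFluct.isDouble_pos h0
  -- Injectivity of doubling on each annulus and disjointness of the two images allow the two sums
  -- to be written as one sum over premaps, with no premap counted twice.
  have hinj : ∀ {T : Finset ℤ} {a : Equiv.Perm ℤ},
      RealFluct.IsDouble (RealFluct.pm (Finset.Icc 1 (m + n))) T →
      Set.InjOn (RealFluct.doubled ε) ((RealFluct.annNC T a).filter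
        fun π => RealFluct.doubled ε π ∈ PMc (Finset.Icc 1 (m + n)) : Finset (Equiv.Perm ℤ)) := by
    intro T a hT p hp q hq e
    rw [Finset.mem_coe, Finset.mem_filter, RealFluct.mem_annNC] at hp hq
    exact RealFluct.double_injOn hT hp.1.1 hq.1.1 (RealFluct.signConj_injective ε e)
  have hdis : Disjoint
      (((RealFluct.annNC (RealFluct.pos (Finset.Icc 1 (m + n))) (RealFluct.gammaPar m n)).filter
        fun π => RealFluct.doubled ε π ∈ PMc (Finset.Icc 1 (m + n))).image (RealFluct.doubled ε))
      (((RealFluct.annNC (RealFluct.domOp m n) (RealFluct.gammaOp m n)).filter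
        fun π => RealFluct.doubled ε π ∈ PMc (Finset.Icc 1 (m + n))).image
          (RealFluct.doubled ε)) := by
    rw [Finset.disjoint_left]
    intro π hπ hπ'
    obtain ⟨p, hp, rfl⟩ := Finset.mem_image.1 hπ
    obtain ⟨q, hq, e⟩ := Finset.mem_image.1 hπ'
    exact RealFluct.double_ne_double hm hn (Finset.mem_filter.1 hp).1 (Finset.mem_filter.1 hq).1
      (RealFluct.signConj_injective ε e.symm)
  rw [← Finset.sum_image (f := fun π => limUnder atTop
      (fun N : ℕ => f N lam (Finset.Icc 1 (m + n)) π)) (hinj hI),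
    ← Finset.sum_image (f := fun π => limUnder atTop
      (fun N : ℕ => f N lam (Finset.Icc 1 (m + n)) π)) (hinj (RealFluct.isDouble_domOp m n)),
    ← Finset.sum_union hdis, ← h.filter_maximal ε hm hn, Finset.sum_filter]
  -- The expansion needs `N > 0`, so the identity holds eventually and the limit is taken term by
  -- term.
  refine Tendsto.congr' ((eventually_gt_atTop 0).mono fun N hN =>
    (h.cumulant2_eq hN ε lam hm hn).symm) (tendsto_finsetSum _ fun π hπ => ?_)
  rw [Finset.mem_filter] at hπ
  obtain ⟨L, hL⟩ := h.limit_exists lam _ h0 π hπ.1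
  have hle := (RealFluct.chi_le_two hm hn (RealFluct.isPremap_signConj ε (h.isPremap _ h0 π hπ.1))
    ((RealFluct.connects_signConj ε).2 hπ.2)).1
  -- The exponent χ − 2 is nonpositive; only the terms with exponent 0 keep the limit of their
  -- weight.
  have := RealFluct.tendsto_zpow_mul (sub_nonpos.2 hle) hL
  simp only [sub_eq_zero] at this
  rw [hL.limUnder_eq]
  exact this
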